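/- **Notation.** Let $[n]=\{1,\dots,n\}$. Let $\tilde S_n$ be the group of bijections $f:\mathbb Z\to\mathbb Z$ with $f(i+n)=f(i)+n$ for all $i$ and $\sum_{i=1}^n(f(i)-i)=0$, and for integers $a,b\ge 0$ put $\tilde S_n(-a,b)=\{f\in\tilde S_n : i-a\le f(i)\le i+b \text{ for all } i\in\mathbb Z\}$. Let $\operatorname{inv}(f)$ be the number of pairs $(i,j)$ with $i\in[n]$, $j\in\mathbb Z$, $i<j$ and $f(i)>f(j)$. For $X\in\operatorname{Gr}(k,n)$ (the Grassmannian of $k$-dimensional subspaces of $\mathbb R^n$, with its usual topology) let $\Delta_J(X)$, $J\in\binom{[n]}{k}$, be its Plücker coordinates, i.e. the maximal minors of a $k\times n$ matrix with row span $X$; they are defined up to a common nonzero factor, and conditions on their signs mean that some representative satisfies them. $\operatorname{Gr}_{\ge0}(k,n)$ and $\operatorname{Gr}_{>0}(k,n)$ are the sets of $X$ with all $\Delta_J(X)\ge0$, respectively all $\Delta_J(X)>0$. For $f\in\tilde S_n(-k,n-k)$ and $i\in[n]$ let $I_i=\{f(j)+k : j<i,\ f(j)+k\ge i\}$, reduced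 modulo $n$ to a subset of $[n]$. For $k$-element subsets $S,T$ of $[n]$ write $S\preceq_i T$ if, when $S=\{s_1,\dots,s_k\}$ and $T=\{t_1,\dots,t_k\}$ are listed increasingly for the total order $i\prec_i i+1\prec_i\dots\prec_i i+n-1$ (entries modulo $n$), one has $s_r\preceq_i t_r$ for all $r$. The positroid of $f$ is $\mathcal M_f=\{J\in\binom{[n]}{k} : I_i\preceq_i J\text{ for all }i\in[n]\}$, and the positroid cell of $f$ is $$\Pi^{>0}_{k,f}=\{X\in\operatorname{Gr}_{\ge0}(k,n) : \Delta_J(X)>0\text{ for }J\in\mathcal M_f,\ \Delta_J(X)=0\text{ for }J\notin\mathcal M_f\}.$$ Let $k,m\ge0$ be integers with $k+m\le n$. A $(k+m)\times n$ matrix $Z$ with all maximal minors positive (a representative of a point of $\operatorname{Gr}_{>0}(k+m,n)$) induces the map $Z:\operatorname{Gr}_{\ge0}(k,n)\to\operatorname{Gr}(k,k+m)$ that sends the row span of $V$ to the row span of $V\cdot Z^t$; its image is the amplituhedron $\mathcal A_{n,k,m}(Z)$. A permutation $f\in\tilde S_n(-k,n-k)$ is *$Z$-admissible* if $Z$ is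 injective on $\Pi^{>0}_{k,f}$; two permutations $f,g\in\tilde S_n(-k,n-k)$ are *$Z$-compatible* if $Z(\Pi^{>0}_{k,f})\cap Z(\Pi^{>0}_{k,g})=\emptyset$; and $f_1,\dots,f_N\in\tilde S_n(-k,n-k)$ *form a $Z$-triangulation* if each $f_s$ is $Z$-admissible, $f_s$ and $f_t$ are $Z$-compatible for all $s\ne t$, $\operatorname{inv}(f_s)=k(n-k-m)$ for all $s$, and $\bigcup_s Z(\Pi^{>0}_{k,f_s})$ is dense in $\mathcal A_{n,k,m}(Z)$. One says *$(n,k,m)$-admissible*, *$(n,k,m)$-compatible*, *form an $(n,k,m)$-triangulation* if the respective property holds for every $(k+m)\times n$ matrix $Z$ with all maximal minors positive. **Theorem.** Let $k,\ell,m,n$ be nonnegative integers such that $m$ is even and $n=k+\ell+m$. 1. Let $f\in\tilde S_n(-k,\ell)$. Then $f^{-1}\in\tilde S_n(-\ell,k)$, and $f$ is $(n,k,m)$-admissible if and only if $f^{-1}$ is $(n,\ell,m)$-admissible. 2. Let $f,g\in\tilde S_n(-k,\ell)$. Then $f$ and $g$ are $(n,k,m)$-compatible if and only if $f^{-1}$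 and $g^{-1}$ are $(n,\ell,m)$-compatible. 3. Let $f_1,\dots,f_N\in\tilde S_n(-k,\ell)$. Then $f_1,\dots,f_N$ form an $(n,k,m)$-triangulation if and only if $f_1^{-1},\dots,f_N^{-1}$ form an $(n,\ell,m)$-triangulation. -/

import Mathlib

namespace Amplituhedron

/-! ## Affine permutations -/

/-- `f` belongs to the affine Coxeter group of type `A`: it is a bijection of the integers with
`f (i + n) = f i + n` for all `i` and `∑_{i=1}^n (f i - i) = 0`. -/
def IsAffinePerm (n : ℕ) (f : Equiv.Perm ℤ) : Prop :=
  (∀ i : ℤ, f (i + n) = f i + n) ∧ ∑ i ∈ Finset.Icc (1 : ℤ) n, (f i - i) = 0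

/-- The set of affine permutations `f` such that `i - a ≤ f i ≤ i + b` for all integers `i`. -/
def affinePerms (n a b : ℕ) : Set (Equiv.Perm ℤ) :=
  {f | IsAffinePerm n f ∧ ∀ i : ℤ, i - a ≤ f i ∧ f i ≤ i + b}

/-- The number of inversions: the number of pairs `(i, j)` with `i ∈ {1, …, n}`, `j ∈ ℤ`, `i < j`
and `f i > f j`. -/
noncomputable def inv (n : ℕ) (f : Equiv.Perm ℤ) : ℕ :=
  Set.ncard {p : ℤ × ℤ | 1 ≤ p.1 ∧ p.1 ≤ n ∧ p.1 < p.2 ∧ f p.2 < f p.1}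

/-! ## The real Grassmannian -/

/-- The Grassmannian of `k`-dimensional linear subspaces of `ℝⁿ`. -/
def Gr (k n : ℕ) : Type :=
  {V : Submodule ℝ (Fin n → ℝ) // Module.finrank ℝ V = k}

/-- The `k × n` matrices of rank `k`. -/
abbrev FullRankMatrix (k n : ℕ) : Type :=
  {A : Matrix (Fin k) (Fin n) ℝ // LinearIndependent ℝ A.row}

/-- The row span of a `k × n` matrix of rank `k`. -/
def rowSpan {k n : ℕ} (A : FullRankMatrix k n) : Gr k n :=
  ⟨Submodule.span ℝ (Set.range A.1.row), by
    simpa using finrank_span_eq_card (R := ℝ) A.2⟩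

/-- The usual topology of the Grassmannian: the quotient topology from the space of
`k × n` matrices of rank `k`. -/
instance (k n : ℕ) : TopologicalSpace (Gr k n) :=
  TopologicalSpace.coinduced rowSpan inferInstance

/-- The maximal minor of a `k × n` matrix with column set `J`, the columns being taken in
increasing order. -/
def minor {k n : ℕ} (A : Matrix (Fin k) (Fin n) ℝ) (J : Finset (Fin n)) (hJ : J.card = k) : ℝ :=
  (A.submatrix id (J.orderEmbOfFin hJ)).det

/-- The totally nonnegative Grassmannian. As Plücker coordinates are only defined up to a common
nonzero factor, the condition is that some matrix representing the subspace has nonnegative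
maximal minors. -/
def tnnGr (k n : ℕ) : Set (Gr k n) :=
  {X | ∃ A : FullRankMatrix k n, rowSpan A = X ∧
    ∀ (J : Finset (Fin n)) (hJ : J.card = k), 0 ≤ minor A.1 J hJ}

/-! ## Positroid cells

The column with index `c : Fin n` is the element `c + 1` of `[n] = {1, …, n}`. -/

/-- The `i`-th member of the Grassmann necklace of `f`:
the set `{f j + k | j < i, f j + k ≥ i}`, reduced modulo `n`. -/
noncomputable def necklace (k n : ℕ) (f : Equiv.Perm ℤ) (i : ℤ) : Finset (Fin n) :=
  open Classical in
  {c : Fin n | ∃ j : ℤ, j < i ∧ i ≤ f j + k ∧ f j + k ≡ (c : ℤ) + 1 [ZMOD n]}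

/-- The position (starting from `0`) of the element `c + 1` of `[n]` in the total order
`i ≺ i + 1 ≺ ⋯ ≺ i + n - 1` (entries modulo `n`). -/
def cyclicPos {n : ℕ} (i : ℤ) (c : Fin n) : ℤ := ((c : ℤ) + 1 - i) % n

/-- The Gale order for the total order that starts at `i`: if `S = {s₁ ≺ ⋯ ≺ sₖ}` and
`T = {t₁ ≺ ⋯ ≺ tₖ}`, then `s_r ≼ t_r` for every `r`. -/
def GaleLE {n : ℕ} (i : ℤ) (S T : Finset (Fin n)) : Prop :=
  List.Forall₂ (· ≤ ·) ((S.image (cyclicPos i)).sort (· ≤ ·))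
    ((T.image (cyclicPos i)).sort (· ≤ ·))

/-- The positroid of `f`: the `k`-element subsets `J` of `[n]` that, for every `i ∈ [n]`, are
at least the `i`-th member of the Grassmann necklace in the `i`-th Gale order. -/
def positroid (k n : ℕ) (f : Equiv.Perm ℤ) : Set (Finset (Fin n)) :=
  {J | J.card = k ∧ ∀ i ∈ Finset.Icc (1 : ℤ) n, GaleLE i (necklace k n f i) J}

/-- The open positroid cell of `f`: the points of the totally nonnegative Grassmannian whose
nonzero Plücker coordinates are exactly those indexed by the positroid of `f`. -/
def cell (k n : ℕ) (f : Equiv.Perm ℤ) : Set (Gr k n) :=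
  {X | ∃ A : FullRankMatrix k n, rowSpan A = X ∧
    ∀ (J : Finset (Fin n)) (hJ : J.card = k),
      (J ∈ positroid k n f → 0 < minor A.1 J hJ) ∧
      (J ∉ positroid k n f → minor A.1 J hJ = 0)}

/-! ## The amplituhedron -/

/-- The matrix `Z` represents a point of the totally positive Grassmannian: all its maximal minors
are positive. -/
def IsTotallyPositive {r n : ℕ} (Z : Matrix (Fin r) (Fin n) ℝ) : Prop :=
  ∀ (J : Finset (Fin n)) (hJ : J.card = r), 0 < minor Z J hJ

/-- The map induced by `Z`. It sends the row span of a matrix `V` to the row span of `V * Zᵀ`,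
that is, to the image of the row span of `V` under the linear map `v ↦ Z v`. -/
def zMap {k m n : ℕ} (Z : Matrix (Fin (k + m)) (Fin n) ℝ) (X : Gr k n) :
    Submodule ℝ (Fin (k + m) → ℝ) :=
  X.1.map Z.mulVecLin

/-- The image of a set of `k`-dimensional subspaces of `ℝⁿ` under `Z`, as a subset of the
Grassmannian of `k`-dimensional subspaces of `ℝ^(k+m)`. -/
def zImage {k m n : ℕ} (Z : Matrix (Fin (k + m)) (Fin n) ℝ) (S : Set (Gr k n)) :
    Set (Gr k (k + m)) :=
  {Y | ∃ X ∈ S, zMap Z X = Y.1}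

/-- The (tree) amplituhedron. -/
def amplituhedron {k m n : ℕ} (Z : Matrix (Fin (k + m)) (Fin n) ℝ) : Set (Gr k (k + m)) :=
  zImage Z (tnnGr k n)

/-- `f` is `Z`-admissible: the map `Z` is injective on the positroid cell of `f`. -/
def IsZAdmissible {k m n : ℕ} (Z : Matrix (Fin (k + m)) (Fin n) ℝ) (f : Equiv.Perm ℤ) : Prop :=
  Set.InjOn (zMap Z) (cell k n f)

/-- `f` is `(n, k, m)`-admissible: it is `Z`-admissible for all totally positive `Z`. -/
def IsAdmissible (n k m : ℕ) (f : Equiv.Perm ℤ) : Prop :=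
  ∀ Z : Matrix (Fin (k + m)) (Fin n) ℝ, IsTotallyPositive Z → IsZAdmissible Z f

/-- `f` and `g` are `Z`-compatible: the images under `Z` of their positroid cells do not
intersect. -/
def IsZCompatible {k m n : ℕ} (Z : Matrix (Fin (k + m)) (Fin n) ℝ) (f g : Equiv.Perm ℤ) : Prop :=
  Disjoint (zMap Z '' cell k n f) (zMap Z '' cell k n g)

/-- `f` and `g` are `(n, k, m)`-compatible: they are `Z`-compatible for all totally
positive `Z`. -/
def IsCompatible (n k m : ℕ) (f g : Equiv.Perm ℤ) : Prop :=
  ∀ Z : Matrix (Fin (k + m)) (Fin n) ℝ, IsTotallyPositive Z → IsZCompatible Z f g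

/-- `f₁, …, f_N` form a `Z`-triangulation: they are `Z`-admissible, pairwise `Z`-compatible, have
`k * ℓ` inversions each, where `ℓ = n - k - m`, and the union of the images of their positroid
cells is dense in the amplituhedron. -/
structure IsZTriangulation {k m n : ℕ} (Z : Matrix (Fin (k + m)) (Fin n) ℝ) {N : ℕ}
    (f : Fin N → Equiv.Perm ℤ) : Prop where
  mem : ∀ s, f s ∈ affinePerms n k (n - k)
  admissible : ∀ s, IsZAdmissible Z (f s)
  compatible : ∀ s t, s ≠ t → IsZCompatible Z (f s) (f t)
  inv_eq : ∀ s, inv n (f s) = k * (n - k - m)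
  dense : amplituhedron Z ⊆ closure (⋃ s, zImage Z (cell k n (f s)))

/-- `f₁, …, f_N` form an `(n, k, m)`-triangulation: they form a `Z`-triangulation for all totally
positive `Z`. -/
def IsTriangulation (n k m : ℕ) {N : ℕ} (f : Fin N → Equiv.Perm ℤ) : Prop :=
  ∀ Z : Matrix (Fin (k + m)) (Fin n) ℝ, IsTotallyPositive Z → IsZTriangulation Z f

end Amplituhedron

/-! The duality is induced by a twist of stacked matrices. Let `V` represent a totally nonnegative
`k`-plane and let the `l` rows of `W` span the kernel of `Z`. The image of the plane under `Z`
remembers exactly `V` modulo `W`: two planes have the same image when their matrices satisfy `V' = a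
V + b W` with `a` invertible. Stack `V` on `W` to a matrix `U`, index its columns periodically by
the integers, and let column `j` of the twist be a nonzero vector normal to the `k + l - 1` columns
of `U` at the positions strictly between `j - l` and `j + k`. Split the twist into an upper block
`X` with `k` rows and a lower block `Y` with `l` rows. After alternating column signs, `X` is
totally positive up to a common sign, so it spans the kernel of a totally positive `Z'` with `l + m`
rows. If `V` lies in the cell of `f`, then `Y` lies in the cell of `f⁻¹`. Replacing `V` by `a V + b
W` multiplies the twist by a block triangular matrix and replaces `Y` by some `a' Y + b' X`. Hence
equal images under `Z` become equal images under `Z'`, which transfers admissibility and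
compatibility (`exists_dual_pair`). Twisting twice only rescales columns; with continuity and
compactness this transfers density (`exists_mem_closure_of_dual`, `dense_of_inv`). One implication
for all `k`, `l` suffices, since `f` and `f⁻¹` play symmetric roles.

Three facts carry the construction.

Nondegeneracy (`nondeg_fromRows`): any `k + l` cyclically consecutive columns of `U` are
independent. A dependency would give a vector supported on the complementary window of `m` columns;
Cauchy–Binet excludes it because, for even `m`, all terms have the same sign.

Positivity (`exists_twist_nonneg`): for a trigonometric moment curve the twist is computed by
translation invariance (`exists_twist_base`). Normalized totally positive matrices form a connected
set (`isPreconnected_normalizedTP`), and positivity cannot be lost along it, because a totally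
nonnegative matrix with nonzero cyclically consecutive minors is totally positive. The nonnegative
case is a limit of the positive one.

Cells (`IsCellMatrix.twist`): a cell is determined by the ranks of cyclic intervals of columns
(`minor_ne_zero_of_cyclic_rank`, `mem_cell_iff`). Rank–nullity expresses the ranks of `Y` through
those of `V` (`IsTwist.ivlRank_eq`), and the counting functions of `f` and `f⁻¹` obey the same
relation (`rankCount_inv`). -/

namespace Amplituhedron
open Matrix Equiv

/-! ## Signs of maximal minors -/

/-- The determinant of the submatrix with column tuple `t`. -/
noncomputable def tupleMinor {k n : ℕ} (A : Matrix (Fin k) (Fin n) ℝ) (t : Fin k → Fin n) : ℝ :=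
  (A.submatrix id t).det

/-- The Vandermonde determinant of a tuple of indices; its sign is the sign of the permutation
that sorts the tuple. -/
noncomputable def vdm {k n : ℕ} (t : Fin k → Fin n) : ℝ :=
  (vandermonde fun a => ((t a : ℕ) : ℝ)).det

lemma tupleMinor_comp {k n : ℕ} (A : Matrix (Fin k) (Fin n) ℝ) (t : Fin k → Fin n)
    (σ : Perm (Fin k)) : tupleMinor A (t ∘ σ) = (Perm.sign σ : ℝ) * tupleMinor A t := by
  have := Matrix.det_permute' σ (A.submatrix id t)
  simpa [tupleMinor, Matrix.submatrix_submatrix] using this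

lemma vdm_comp {k n : ℕ} (t : Fin k → Fin n) (σ : Perm (Fin k)) :
    vdm (t ∘ σ) = (Perm.sign σ : ℝ) * vdm t := by
  have := Matrix.det_permute σ (vandermonde fun a => ((t a : ℕ) : ℝ))
  rw [vdm, vdm, ← this]
  rfl

lemma sign_mul_self {k : ℕ} (σ : Perm (Fin k)) :
    ((Perm.sign σ : ℤ) : ℝ) * ((Perm.sign σ : ℤ) : ℝ) = 1 := by
  rcases Int.units_eq_one_or (Perm.sign σ) with h | h <;> simp [h]

lemma vdm_ne_zero_iff {k n : ℕ} {t : Fin k → Fin n} : vdm t ≠ 0 ↔ Function.Injective t := by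
  rw [vdm, det_vandermonde_ne_zero_iff]
  constructor
  · intro h a b hab
    exact h (by simp [hab])
  · intro h a b hab
    exact h (Fin.ext (Nat.cast_injective (R := ℝ) hab))

lemma vdm_pos_of_strictMono {k n : ℕ} {t : Fin k → Fin n} (h : StrictMono t) : 0 < vdm t := by
  rw [vdm, det_vandermonde]
  refine Finset.prod_pos fun i _ => Finset.prod_pos fun j hj => ?_
  have : t i < t j := h (Finset.mem_Ioi.1 hj)
  have : ((t i : ℕ) : ℝ) < ((t j : ℕ) : ℝ) := by exact_mod_cast this
  linarith

lemma tupleMinor_eq_zero {k n : ℕ} (A : Matrix (Fin k) (Fin n) ℝ) {t : Fin k → Fin n}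
    (h : ¬ Function.Injective t) : tupleMinor A t = 0 := by
  simp only [Function.Injective, not_forall] at h
  obtain ⟨a, b, hab, hne⟩ := h
  exact Matrix.det_zero_of_column_eq hne fun i => by simp [hab]

lemma exists_strictMono_comp {k n : ℕ} {t : Fin k → Fin n} (h : Function.Injective t) :
    ∃ (s : Fin k → Fin n) (σ : Perm (Fin k)), StrictMono s ∧ t = s ∘ σ := by
  refine ⟨t ∘ Tuple.sort t, (Tuple.sort t)⁻¹,
    (Tuple.monotone_sort t).strictMono_of_injective (h.comp (Tuple.sort t).injective), ?_⟩
  ext a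
  simp

lemma card_image_tuple {k n : ℕ} {t : Fin k → Fin n} (h : Function.Injective t) :
    (Finset.univ.image t).card = k := by
  rw [Finset.card_image_of_injective _ h]; simp

lemma minor_eq_tupleMinor {k n : ℕ} (A : Matrix (Fin k) (Fin n) ℝ) (J : Finset (Fin n))
    (hJ : J.card = k) : minor A J hJ = tupleMinor A (J.orderEmbOfFin hJ) := rfl

/-- Both factors change by the sign of the permutation when the tuple is reordered, so up to a
positive factor the product depends only on the set of columns. This lets sign conditions range over
arbitrary tuples instead of increasing ones. -/
lemma exists_tupleMinor_mul_vdm {k n : ℕ} {t : Fin k → Fin n} (h : Function.Injective t) :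
    ∃ c : ℝ, 0 < c ∧ ∀ A : Matrix (Fin k) (Fin n) ℝ,
      tupleMinor A t * vdm t = c * minor A (Finset.univ.image t) (card_image_tuple h) := by
  obtain ⟨s, σ, hs, rfl⟩ := exists_strictMono_comp h
  refine ⟨vdm s, vdm_pos_of_strictMono hs, fun A => ?_⟩
  have : s = (Finset.univ.image (s ∘ σ)).orderEmbOfFin (card_image_tuple h) := by
    refine Finset.orderEmbOfFin_unique _ (fun x => ?_) hs
    simp only [Finset.mem_image, Finset.mem_univ, true_and]
    exact ⟨σ⁻¹ x, by simp⟩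
  rw [minor_eq_tupleMinor, ← this, tupleMinor_comp, vdm_comp]
  linear_combination (tupleMinor A s * vdm s) * sign_mul_self σ

lemma minor_mul_vdm {k n : ℕ} (J : Finset (Fin n)) (hJ : J.card = k) :
    0 < vdm (J.orderEmbOfFin hJ) := vdm_pos_of_strictMono (J.orderEmbOfFin hJ).strictMono

/-- All maximal minors are nonnegative, up to a common factor `e`. -/
def NonnegMinors {k n : ℕ} (e : ℝ) (A : Matrix (Fin k) (Fin n) ℝ) : Prop :=
  ∀ t, 0 ≤ e * (tupleMinor A t * vdm t)

/-- All maximal minors are positive, up to a common factor `e`. -/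
def PosMinors {k n : ℕ} (e : ℝ) (A : Matrix (Fin k) (Fin n) ℝ) : Prop :=
  ∀ t, Function.Injective t → 0 < e * (tupleMinor A t * vdm t)

lemma nonnegMinors_iff {k n : ℕ} {e : ℝ} {A : Matrix (Fin k) (Fin n) ℝ} :
    NonnegMinors e A ↔ ∀ (J : Finset (Fin n)) (hJ : J.card = k), 0 ≤ e * minor A J hJ := by
  constructor
  · intro h J hJ
    have h1 := h (J.orderEmbOfFin hJ)
    have h2 := minor_mul_vdm J hJ
    rw [← minor_eq_tupleMinor, ← mul_assoc] at h1
    exact nonneg_of_mul_nonneg_left h1 h2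
  · intro h t
    by_cases ht : Function.Injective t
    · obtain ⟨c, hc, h1⟩ := exists_tupleMinor_mul_vdm ht
      rw [h1, mul_left_comm]
      exact mul_nonneg hc.le (h _ _)
    · rw [tupleMinor_eq_zero A ht]; simp

lemma posMinors_iff {k n : ℕ} {e : ℝ} {A : Matrix (Fin k) (Fin n) ℝ} :
    PosMinors e A ↔ ∀ (J : Finset (Fin n)) (hJ : J.card = k), 0 < e * minor A J hJ := by
  constructor
  · intro h J hJ
    have h1 := h (J.orderEmbOfFin hJ) (J.orderEmbOfFin hJ).injective
    have h2 := minor_mul_vdm J hJ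
    rw [← minor_eq_tupleMinor, ← mul_assoc] at h1
    exact (pos_iff_pos_of_mul_pos h1).2 h2
  · intro h t ht
    obtain ⟨c, hc, h1⟩ := exists_tupleMinor_mul_vdm ht
    rw [h1, mul_left_comm]
    exact mul_pos hc (h _ _)

lemma isTotallyPositive_iff {r n : ℕ} {Z : Matrix (Fin r) (Fin n) ℝ} :
    IsTotallyPositive Z ↔ PosMinors 1 Z := by
  simp [posMinors_iff, IsTotallyPositive]

lemma PosMinors.nonneg {k n : ℕ} {e : ℝ} {A : Matrix (Fin k) (Fin n) ℝ} (h : PosMinors e A) :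
    NonnegMinors e A := by
  intro t
  by_cases ht : Function.Injective t
  · exact (h t ht).le
  · rw [tupleMinor_eq_zero A ht]; simp

lemma PosMinors.tupleMinor_ne_zero {k n : ℕ} {e : ℝ} {A : Matrix (Fin k) (Fin n) ℝ}
    (h : PosMinors e A) {t : Fin k → Fin n} (ht : Function.Injective t) : tupleMinor A t ≠ 0 := by
  intro h0
  have := h t ht
  simp [h0] at this

lemma tupleMinor_mul {k n : ℕ} (g : Matrix (Fin k) (Fin k) ℝ) (A : Matrix (Fin k) (Fin n) ℝ)
    (t : Fin k → Fin n) : tupleMinor (g * A) t = g.det * tupleMinor A t := by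
  rw [tupleMinor, tupleMinor, ← Matrix.det_mul]
  congr 1

/-! ## The Cauchy–Binet formula -/

/-- Expand each minor over permutations. Reindexing the tuples by the permutation cancels its sign
against that of `g`, so all `k!` permutations contribute the same sum. -/
lemma sum_prod_mul_alternating {k n : ℕ} (V : Matrix (Fin k) (Fin n) ℝ)
    (g : (Fin k → Fin n) → ℝ) (hg : ∀ t (σ : Perm (Fin k)), g (t ∘ σ) = (Perm.sign σ : ℝ) * g t) :
    (k.factorial : ℝ) * ∑ t : Fin k → Fin n, (∏ a, V a (t a)) * g t =
      ∑ t : Fin k → Fin n, tupleMinor V t * g t := by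
  have h1 : ∀ t : Fin k → Fin n, tupleMinor V t * g t =
      ∑ σ : Perm (Fin k), (Perm.sign σ : ℝ) * (∏ a, V (σ a) (t a)) * g t := by
    intro t
    rw [tupleMinor, Matrix.det_apply', Finset.sum_mul]
    rfl
  simp_rw [h1]
  rw [Finset.sum_comm]
  have h2 : ∀ σ : Perm (Fin k), ∑ t : Fin k → Fin n,
      (Perm.sign σ : ℝ) * (∏ a, V (σ a) (t a)) * g t =
      ∑ t : Fin k → Fin n, (∏ a, V a (t a)) * g t := by
    intro σ
    rw [← Equiv.sum_comp (Equiv.arrowCongr σ⁻¹ (Equiv.refl (Fin n)))]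
    refine Finset.sum_congr rfl fun t _ => ?_
    have h3 : (Equiv.arrowCongr σ⁻¹ (Equiv.refl (Fin n))) t = t ∘ σ := by
      ext a; simp [Equiv.arrowCongr, Perm.inv_def]
    rw [h3, hg]
    have h4 : ∏ a, V (σ a) ((t ∘ σ) a) = ∏ a, V a (t a) :=
      Equiv.prod_comp σ fun a => V a (t a)
    rw [h4]
    linear_combination ((∏ a, V a (t a)) * g t) * sign_mul_self σ
  simp_rw [h2]
  simp [Fintype.card_perm]

/-- The decidability instance is a variable because the fields of an alternating map quantify over
it. -/
lemma of_append_update {k m : ℕ} (inst : DecidableEq (Fin k)) (y : Fin m → Fin (k + m) → ℝ)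
    (x : Fin k → Fin (k + m) → ℝ) (a : Fin k) (w : Fin (k + m) → ℝ) :
    Matrix.of (Fin.append (@Function.update _ _ inst x a w) y) =
      (Matrix.of (Fin.append x y)).updateRow (Fin.castAdd m a) w := by
  have e : inst = instDecidableEqFin k := Subsingleton.elim _ _
  subst e
  ext b c
  refine Fin.addCases (fun b => ?_) (fun b => ?_) b
  · by_cases h : b = a
    · subst h; simp
    · simp [h, Matrix.updateRow_apply]
  · have : Fin.natAdd k b ≠ Fin.castAdd m a := by
      intro h; have := congrArg Fin.val h; simp at this; omega
    simp [this, Matrix.updateRow_apply]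

/-- The determinant as an alternating function of its first rows. -/
noncomputable def detAppend {k m : ℕ} (y : Fin m → Fin (k + m) → ℝ) :
    (Fin (k + m) → ℝ) [⋀^Fin k]→ₗ[ℝ] ℝ where
  toFun x := (Matrix.of (Fin.append x y)).det
  map_update_add' x a u v := by
    simp only [of_append_update]
    exact Matrix.det_updateRow_add _ _ _ _
  map_update_smul' x a c v := by
    simp only [of_append_update]
    exact Matrix.det_updateRow_smul _ _ _ _
  map_eq_zero_of_eq' x a b hab hne := by
    refine Matrix.det_zero_of_row_eq (i := Fin.castAdd m a) (j := Fin.castAdd m b) ?_ ?_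
    · simpa using hne
    · ext c
      simp [hab]

lemma detAppend_apply {k m : ℕ} (y : Fin m → Fin (k + m) → ℝ) (x : Fin k → Fin (k + m) → ℝ) :
    detAppend y x = (Matrix.of (Fin.append x y)).det := rfl

/-- Multilinear expansion over all tuples, followed by antisymmetrization. The factor `k!` is the
price for not restricting to increasing tuples. -/
lemma alternatingMap_sum {k n : ℕ} {E : Type*} [AddCommGroup E] [Module ℝ E]
    (f : E [⋀^Fin k]→ₗ[ℝ] ℝ) (V : Matrix (Fin k) (Fin n) ℝ) (z : Fin n → E) :
    (k.factorial : ℝ) * f (fun a => ∑ j, V a j • z j) =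
      ∑ t : Fin k → Fin n, tupleMinor V t * f (z ∘ t) := by
  rw [← sum_prod_mul_alternating V (fun t => f (z ∘ t))]
  · congr 1
    have := f.toMultilinearMap.map_sum (fun a j => V a j • z j)
    simp only [AlternatingMap.coe_multilinearMap] at this
    rw [this]
    refine Finset.sum_congr rfl fun t _ => ?_
    have := f.toMultilinearMap.map_smul_univ (fun a => V a (t a)) (fun a => z (t a))
    simp only [AlternatingMap.coe_multilinearMap, smul_eq_mul] at this
    exact this
  · intro t σ
    have := f.map_perm (z ∘ t) σ
    rw [Function.comp_assoc] at this
    rw [this]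
    rcases Int.units_eq_one_or (Perm.sign σ) with h | h <;> simp [h]

/-- The Cauchy–Binet formula, with a sum over all tuples of columns. -/
lemma cauchyBinet {k n p : ℕ} (V : Matrix (Fin k) (Fin n) ℝ) (G : Matrix (Fin n) (Fin p) ℝ)
    (t : Fin k → Fin p) :
    (k.factorial : ℝ) * tupleMinor (V * G) t =
      ∑ s : Fin k → Fin n, tupleMinor V s * (G.submatrix s t).det := by
  have := alternatingMap_sum (Matrix.detRowAlternating (n := Fin k) (R := ℝ)) V
    (fun j a => G j (t a))
  convert this using 2
  simp only [tupleMinor]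
  change _ = Matrix.det _
  congr 1
  ext a b
  simp [Matrix.mul_apply]
  rfl

end Amplituhedron

namespace Amplituhedron
open Matrix Equiv

/-! ## Cyclic intervals determine the positroid -/

/-- The `j`-th column of a matrix. -/
abbrev colv {ι : Type*} {n : ℕ} (A : Matrix ι (Fin n) ℝ) (j : Fin n) : ι → ℝ := fun a => A a j

/-- The set of columns congruent to an element of `{i, …, b}`. -/
noncomputable def cycIvl (n : ℕ) (i b : ℤ) : Finset (Fin n) :=
  open Classical in {c : Fin n | ∃ q : ℤ, i ≤ c + 1 + q * n ∧ c + 1 + q * n ≤ b}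

lemma mem_cycIvl {n : ℕ} {i b : ℤ} {c : Fin n} :
    c ∈ cycIvl n i b ↔ ∃ q : ℤ, i ≤ c + 1 + q * n ∧ (c : ℤ) + 1 + q * n ≤ b := by
  simp [cycIvl]

/-- The rank of a set of columns. -/
noncomputable def colRank {k n : ℕ} (A : Matrix (Fin k) (Fin n) ℝ) (I : Finset (Fin n)) : ℕ :=
  Module.finrank ℝ (Submodule.span ℝ (colv A '' (I : Set (Fin n))))

lemma finrank_span_image_eq {ι E : Type*} [AddCommGroup E] [Module ℝ E] {v : ι → E}
    {s : Finset ι} (h : LinearIndepOn ℝ v (s : Set ι)) :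
    Module.finrank ℝ (Submodule.span ℝ (v '' (s : Set ι))) = s.card := by
  have h1 := finrank_span_eq_card (R := ℝ) h.linearIndependent
  have h2 : Set.range (fun x : (s : Set ι) => v x) = v '' (s : Set ι) := by
    ext x; simp
  rw [h2] at h1
  simpa using h1

lemma exists_finset_linearIndepOn {ι E : Type*} [Finite ι] [AddCommGroup E] [Module ℝ E]
    (v : ι → E) (s t : Finset ι) (hst : s ⊆ t) (hs : LinearIndepOn ℝ v (s : Set ι)) :
    ∃ b : Finset ι, s ⊆ b ∧ b ⊆ t ∧ LinearIndepOn ℝ v (b : Set ι) ∧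
      Submodule.span ℝ (v '' (b : Set ι)) = Submodule.span ℝ (v '' (t : Set ι)) := by
  obtain ⟨b, hbt, hsb, htb, hli⟩ :=
    exists_linearIndepOn_extension hs (show (s : Set ι) ⊆ (t : Set ι) by exact_mod_cast hst)
  have hb : b.Finite := Set.toFinite b
  refine ⟨hb.toFinset, ?_, ?_, ?_, ?_⟩
  · intro x hx; simpa using hsb hx
  · intro x hx; exact hbt (by simpa using hx)
  · simpa using hli
  · simp only [Set.Finite.coe_toFinset]
    exact le_antisymm (Submodule.span_mono (Set.image_mono hbt)) (Submodule.span_le.2 htb)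

lemma vdm_cons {p n : ℕ} (c : Fin n) (s : Fin p → Fin n) :
    vdm (Fin.cons c s : Fin (p + 1) → Fin n) =
      (∏ q, (((s q : ℕ) : ℝ) - ((c : ℕ) : ℝ))) * vdm s := by
  simp only [vdm, det_vandermonde]
  rw [Fin.prod_univ_succ]
  congr 1
  · rw [Fin.Ioi_zero_eq_map]; simp
  · refine Finset.prod_congr rfl fun i _ => ?_
    rw [Fin.Ioi_succ]; simp

/-- The minors on `c, a, s` and on `i, a, s` have ratio `μ`, which does not depend on `a`. Their
Vandermonde signs differ by a factor independent of `a` and by `(a - c) (a - i)`. Total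
nonnegativity therefore fixes the sign of the latter product for all `a` in `D`: the points of `D`
lie on one side of the chord from `c` to `i`. -/
lemma sides_eq_of_circuit {p n : ℕ} {e : ℝ} {A : Matrix (Fin (p + 2)) (Fin n) ℝ}
    (hA : NonnegMinors e A) (he : e ≠ 0) {c i : Fin n} {s : Fin p → Fin n} {μ : ℝ} (hμ : μ ≠ 0)
    {D : Fin n → Prop}
    (h1 : ∀ a, D a → tupleMinor A (Fin.cons c (Fin.cons a s : Fin (p + 1) → Fin n)) ≠ 0)
    (h2 : ∀ a, D a → tupleMinor A (Fin.cons i (Fin.cons a s : Fin (p + 1) → Fin n)) =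
      μ * tupleMinor A (Fin.cons c (Fin.cons a s : Fin (p + 1) → Fin n)))
    {a b : Fin n} (ha : D a) (hb : D b) :
    0 < ((((a : ℕ) : ℝ) - (c : ℕ)) * (((a : ℕ) : ℝ) - (i : ℕ))) *
      ((((b : ℕ) : ℝ) - (c : ℕ)) * (((b : ℕ) : ℝ) - (i : ℕ))) := by
  set P : ℝ := (∏ q, (((s q : ℕ) : ℝ) - ((c : ℕ) : ℝ))) * ∏ q, (((s q : ℕ) : ℝ) - ((i : ℕ) : ℝ))
  have key : ∀ a, D a → 0 < (μ * P) * ((((a : ℕ) : ℝ) - (c : ℕ)) * (((a : ℕ) : ℝ) - (i : ℕ))) := by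
    intro a ha
    have n1 := h1 a ha
    have n2 : tupleMinor A (Fin.cons i (Fin.cons a s : Fin (p + 1) → Fin n)) ≠ 0 := by
      rw [h2 a ha]; exact mul_ne_zero hμ n1
    have v1 : vdm (Fin.cons c (Fin.cons a s : Fin (p + 1) → Fin n) : Fin (p + 2) → Fin n) ≠ 0 :=
      vdm_ne_zero_iff.2 (by by_contra h; exact n1 (tupleMinor_eq_zero A h))
    have v2 : vdm (Fin.cons i (Fin.cons a s : Fin (p + 1) → Fin n) : Fin (p + 2) → Fin n) ≠ 0 :=
      vdm_ne_zero_iff.2 (by by_contra h; exact n2 (tupleMinor_eq_zero A h))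
    have p1 := (hA (Fin.cons c (Fin.cons a s : Fin (p + 1) → Fin n))).lt_of_ne'
      (mul_ne_zero he (mul_ne_zero n1 v1))
    have p2 := (hA (Fin.cons i (Fin.cons a s : Fin (p + 1) → Fin n))).lt_of_ne'
      (mul_ne_zero he (mul_ne_zero n2 v2))
    have p3 := mul_pos p1 p2
    rw [h2 a ha] at p3
    rw [vdm_cons c, vdm_cons i] at p3
    simp only [Fin.prod_univ_succ, Fin.cons_zero, Fin.cons_succ] at p3
    set T := tupleMinor A (Fin.cons c (Fin.cons a s : Fin (p + 1) → Fin n))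
    set F := vdm (Fin.cons a s : Fin (p + 1) → Fin n)
    have e1 : e * (T * ((((a : ℕ) : ℝ) - (c : ℕ)) * (∏ q, (((s q : ℕ) : ℝ) - ((c : ℕ) : ℝ))) * F)) *
      (e * (μ * T * ((((a : ℕ) : ℝ) - (i : ℕ)) * (∏ q, (((s q : ℕ) : ℝ) - ((i : ℕ) : ℝ))) * F))) =
      (e * T * F) ^ 2 * ((μ * P) * ((((a : ℕ) : ℝ) - (c : ℕ)) * (((a : ℕ) : ℝ) - (i : ℕ)))) := by
      simp only [P]; ring
    rw [e1] at p3
    exact (pos_iff_pos_of_mul_pos p3).1 (lt_of_le_of_ne (sq_nonneg _) (by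
      intro h0; rw [← h0] at p3; simp at p3))
  have := mul_pos (key a ha) (key b hb)
  have e2 : (μ * P) * ((((a : ℕ) : ℝ) - (c : ℕ)) * (((a : ℕ) : ℝ) - (i : ℕ))) *
      ((μ * P) * ((((b : ℕ) : ℝ) - (c : ℕ)) * (((b : ℕ) : ℝ) - (i : ℕ)))) =
      (μ * P) ^ 2 * (((((a : ℕ) : ℝ) - (c : ℕ)) * (((a : ℕ) : ℝ) - (i : ℕ))) *
      ((((b : ℕ) : ℝ) - (c : ℕ)) * (((b : ℕ) : ℝ) - (i : ℕ)))) := by ring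
  rw [e2] at this
  exact (pos_iff_pos_of_mul_pos this).1 (lt_of_le_of_ne (sq_nonneg _) (by
      intro h0; rw [← h0] at this; simp at this))

lemma tupleMinor_ne_zero_iff {k n : ℕ} {A : Matrix (Fin k) (Fin n) ℝ} {t : Fin k → Fin n} :
    tupleMinor A t ≠ 0 ↔ ∀ ψ : Fin k → ℝ, (∀ a, ψ ⬝ᵥ colv A (t a) = 0) → ψ = 0 := by
  rw [tupleMinor, ne_eq, ← Matrix.exists_vecMul_eq_zero_iff]
  push Not
  constructor
  · intro h ψ hψ
    by_contra h0
    exact h ψ h0 (by ext a; exact hψ a)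
  · intro h ψ h0 hψ
    exact h0 (h ψ fun a => congrFun hψ a)

/-- Replacing the first column of a maximal minor by a linear combination. -/
lemma tupleMinor_cons_of_span {p n : ℕ} (A : Matrix (Fin (p + 1)) (Fin n) ℝ) {c i : Fin n}
    {r : Fin p → Fin n} {μ : ℝ}
    (h : colv A i - μ • colv A c ∈ Submodule.span ℝ (Set.range fun q => colv A (r q))) :
    tupleMinor A (Fin.cons i r : Fin (p + 1) → Fin n) =
      μ * tupleMinor A (Fin.cons c r : Fin (p + 1) → Fin n) := by
  set M := A.submatrix id (Fin.cons c r : Fin (p + 1) → Fin n)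
  -- `L v` is the minor with its first column replaced by `v`; it vanishes on the span of the other
  -- columns.
  let L : (Fin (p + 1) → ℝ) →ₗ[ℝ] ℝ := (LinearMap.proj 0).comp (cramer M)
  have hL : ∀ v, L v = (M.updateCol 0 v).det := fun v => Matrix.cramer_apply _ _ _
  have e1 : ∀ j, L (colv A j) = tupleMinor A (Fin.cons j r : Fin (p + 1) → Fin n) := by
    intro j
    rw [hL, tupleMinor]
    congr 1
    ext x y
    refine Fin.cases ?_ (fun y => ?_) y
    · simp
    · simp [M]
  have e2 : Submodule.span ℝ (Set.range fun q => colv A (r q)) ≤ LinearMap.ker L := by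
    rw [Submodule.span_le]
    rintro _ ⟨q, rfl⟩
    simp only [SetLike.mem_coe, LinearMap.mem_ker]
    rw [e1]
    apply tupleMinor_eq_zero
    intro hinj
    have := @hinj 0 q.succ (by simp)
    exact absurd this (Fin.succ_ne_zero q).symm
  have e3 := e2 h
  rw [LinearMap.mem_ker, map_sub, map_smul, e1, e1, smul_eq_mul] at e3
  linarith

/-- The zero set of a vector of minimal support has no circuit that crosses its support. -/
lemma circuit_sides {k n : ℕ} {e : ℝ} {A : Matrix (Fin k) (Fin n) ℝ}
    (hA : NonnegMinors e A) (he : e ≠ 0) {φ : Fin k → ℝ}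
    (hmin : ∀ a, φ ⬝ᵥ colv A a ≠ 0 → ∀ ψ : Fin k → ℝ,
      (∀ j, φ ⬝ᵥ colv A j = 0 → ψ ⬝ᵥ colv A j = 0) → ψ ⬝ᵥ colv A a = 0 → ψ = 0)
    {C : Finset (Fin n)} (hC : ∀ j ∈ C, φ ⬝ᵥ colv A j = 0)
    (hdep : ¬ LinearIndepOn ℝ (colv A) (C : Set (Fin n)))
    (hcirc : ∀ j ∈ C, LinearIndepOn ℝ (colv A) ((C.erase j : Finset (Fin n)) : Set (Fin n)))
    {c i : Fin n} (hc : c ∈ C) (hi : i ∈ C) (hci : c ≠ i) {a b : Fin n}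
    (ha : φ ⬝ᵥ colv A a ≠ 0) (hb : φ ⬝ᵥ colv A b ≠ 0) :
    0 < ((((a : ℕ) : ℝ) - (c : ℕ)) * (((a : ℕ) : ℝ) - (i : ℕ))) *
      ((((b : ℕ) : ℝ) - (c : ℕ)) * (((b : ℕ) : ℝ) - (i : ℕ))) := by
  classical
  set H : Finset (Fin n) := {j | φ ⬝ᵥ colv A j = 0} with hH
  have hCH : C.erase i ⊆ H := fun j hj => by
    simp [hH, hC j (Finset.mem_of_mem_erase hj)]
  -- `B` is a basis of the columns in the hyperplane normal to `φ` and contains the circuit without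
  -- `i`. By minimality of the support of `φ`, adding any column outside the hyperplane to `B` gives
  -- a basis of the whole space.
  obtain ⟨B, hCB, hBH, hBli, hBsp⟩ :=
    exists_finset_linearIndepOn (colv A) (C.erase i) H hCH (hcirc i hi)
  have hcB : c ∈ B := hCB (Finset.mem_erase.2 ⟨hci, hc⟩)
  -- a functional that vanishes on `B` vanishes on `H`
  have kill : ∀ ψ : Fin k → ℝ, (∀ j ∈ B, ψ ⬝ᵥ colv A j = 0) → ∀ j, φ ⬝ᵥ colv A j = 0 →
      ψ ⬝ᵥ colv A j = 0 := by
    intro ψ hψ j hj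
    let L : (Fin k → ℝ) →ₗ[ℝ] ℝ := dotProductBilin ℝ ℝ ψ
    have h1 : Submodule.span ℝ (colv A '' (B : Set (Fin n))) ≤ LinearMap.ker L := by
      rw [Submodule.span_le]
      rintro _ ⟨x, hx, rfl⟩
      exact hψ x hx
    rw [hBsp] at h1
    exact h1 (Submodule.subset_span ⟨j, by simp [hH, hj], rfl⟩)
  -- the cardinality of `B`
  have haB : a ∉ B := fun h => ha (by simpa [hH] using hBH h)
  have hcard : B.card + 1 = k := by
    have hins : LinearIndepOn ℝ (colv A) ((insert a B : Finset (Fin n)) : Set (Fin n)) := by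
      rw [Finset.coe_insert]
      refine hBli.insert fun h => ha ?_
      let L : (Fin k → ℝ) →ₗ[ℝ] ℝ := dotProductBilin ℝ ℝ φ
      have h1 : Submodule.span ℝ (colv A '' (B : Set (Fin n))) ≤ LinearMap.ker L := by
        rw [Submodule.span_le]
        rintro _ ⟨x, hx, rfl⟩
        have : φ ⬝ᵥ colv A x = 0 := by simpa [hH] using hBH hx
        exact this
      exact h1 h
    have htop : Submodule.span ℝ (colv A '' ((insert a B : Finset (Fin n)) : Set (Fin n))) = ⊤ := by
      by_contra hne
      obtain ⟨f, hf0, hf⟩ := Submodule.exists_le_ker_of_lt_top _ (lt_top_iff_ne_top.2 hne)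
      obtain ⟨ψ, rfl⟩ := (dotProductEquiv ℝ (Fin k)).surjective f
      have h3 : ∀ j ∈ insert a B, ψ ⬝ᵥ colv A j = 0 := fun j hj =>
        hf (Submodule.subset_span ⟨j, by exact_mod_cast hj, rfl⟩)
      have := hmin a ha ψ (kill ψ fun j hj => h3 j (Finset.mem_insert_of_mem hj))
        (h3 a (Finset.mem_insert_self _ _))
      exact hf0 (by simp [this])
    have h1 := finrank_span_image_eq hins
    rw [htop, finrank_top, Finset.card_insert_of_notMem haB] at h1
    simpa using h1.symm
  obtain ⟨p, rfl⟩ : ∃ p, k = p + 2 := by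
    have : 0 < B.card := Finset.card_pos.2 ⟨c, hcB⟩
    exact ⟨k - 2, by omega⟩
  have hcard' : (B.erase c).card = p := by
    rw [Finset.card_erase_of_mem hcB]; omega
  let s : Fin p → Fin n := fun q => (B.erase c).orderEmbOfFin hcard' q
  have hs : ∀ j, j ∈ B.erase c ↔ ∃ q, s q = j := by
    intro j
    have := Finset.range_orderEmbOfFin (B.erase c) hcard'
    have h2 : j ∈ Set.range s ↔ j ∈ ((B.erase c : Finset (Fin n)) : Set (Fin n)) := by
      rw [← this]
    simpa [and_comm] using h2.symm
  -- the relation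
  obtain ⟨μ, hμ, hrel⟩ : ∃ μ : ℝ, μ ≠ 0 ∧ colv A i - μ • colv A c ∈
      Submodule.span ℝ (colv A '' (((C.erase i).erase c : Finset (Fin n)) : Set (Fin n))) := by
    have h1 : colv A i ∈ Submodule.span ℝ (colv A '' ((C.erase i : Finset (Fin n)) : Set (Fin n))) := by
      by_contra h
      apply hdep
      have := (hcirc i hi).insert h
      rwa [← Finset.coe_insert, Finset.insert_erase hi] at this
    have h2 : colv A i ∉ Submodule.span ℝ
        (colv A '' (((C.erase i).erase c : Finset (Fin n)) : Set (Fin n))) := by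
      have h3 := hcirc c hc
      have h4 : C.erase c = insert i ((C.erase i).erase c) := by
        ext x; simp only [Finset.mem_erase, Finset.mem_insert]
        by_cases hx : x = i
        · subst hx; simp [hi, hci.symm]
        · simp [hx]
      rw [h4, Finset.coe_insert, linearIndepOn_insert (by simp)] at h3
      exact h3.2
    rw [← Finset.insert_erase (Finset.mem_erase.2 ⟨hci, hc⟩), Finset.coe_insert,
      Set.image_insert_eq, Submodule.mem_span_insert] at h1
    obtain ⟨μ, z, hz, hμz⟩ := h1
    refine ⟨μ, ?_, ?_⟩
    · rintro rfl
      apply h2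
      rw [hμz]; simpa using hz
    · rw [hμz]; simpa using hz
  -- Here `s` enumerates `B` without `c`. For `a` off the hyperplane, `c, a, s` is a basis, and
  -- exchanging `c` for `i` multiplies the minor by `μ`, since `i - μ c` lies in the span of `s`.
  refine sides_eq_of_circuit (s := s) hA he hμ (D := fun a => φ ⬝ᵥ colv A a ≠ 0) ?_ ?_ ha hb
  · intro a ha
    rw [tupleMinor_ne_zero_iff]
    intro ψ hψ
    refine hmin a ha ψ (kill ψ fun j hj => ?_) (by simpa using hψ 1)
    by_cases hjc : j = c
    · subst hjc; simpa using hψ 0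
    · obtain ⟨q, rfl⟩ := (hs j).1 (Finset.mem_erase.2 ⟨hjc, hj⟩)
      simpa using hψ q.succ.succ
  · intro a ha
    refine tupleMinor_cons_of_span A (Submodule.span_mono ?_ hrel)
    rintro _ ⟨j, hj, rfl⟩
    have hj' : j ∈ B.erase c := by
      simp only [Finset.coe_erase, Set.mem_sdiff, Finset.mem_coe, Set.mem_singleton_iff] at hj
      exact Finset.mem_erase.2 ⟨hj.2, hCB (Finset.mem_erase.2 ⟨hj.1.2, hj.1.1⟩)⟩
    obtain ⟨q, rfl⟩ := (hs j).1 hj'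
    exact ⟨q.succ, by simp⟩

lemma cycIvl_full {n : ℕ} (c : Fin n) : c ∈ cycIvl n 1 n :=
  mem_cycIvl.2 ⟨0, by omega, by omega⟩

/-- The class of columns between cyclically consecutive elements of `D` is a cyclic interval. -/
lemma exists_cycIvl_of_gap {n : ℕ} (D : Finset (Fin n)) (hD : D.Nonempty) {c : Fin n} (hc : c ∉ D) :
    ∃ i b : ℤ, cycIvl n i b = Finset.univ.filter fun j => j ∉ D ∧
      (D.filter (· < j)).card % D.card = (D.filter (· < c)).card % D.card := by
  -- The number of elements of `D` below `j` labels the gap containing `j`; reduction modulo the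
  -- size of `D` identifies the labels of the two ends, which form one gap on the circle.
  classical
  have hpos : 0 < D.card := hD.card_pos
  have hle : ∀ j, (D.filter (· < j)).card ≤ D.card := fun j => Finset.card_filter_le _ _
  have hfull : ∀ j, (D.filter (· < j)).card = D.card ↔ ∀ a ∈ D, a < j := by
    intro j
    rw [Finset.card_filter_eq_iff]
  have hzero : ∀ j, (D.filter (· < j)).card = 0 ↔ ∀ a ∈ D, ¬ a < j := by
    intro j
    rw [Finset.card_eq_zero, Finset.filter_eq_empty_iff]
  by_cases h1 : (∀ a ∈ D, a < c) ∨ (∀ a ∈ D, ¬ a < c)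
  · refine ⟨(D.max' hD : ℕ) + 2, (D.min' hD : ℕ) + n, ?_⟩
    have hmod : (D.filter (· < c)).card % D.card = 0 := by
      rcases h1 with h | h
      · rw [(hfull c).2 h, Nat.mod_self]
      · rw [(hzero c).2 h, Nat.zero_mod]
    ext j
    have hmod' : (D.filter (· < j)).card % D.card = 0 ↔
        ((∀ a ∈ D, a < j) ∨ (∀ a ∈ D, ¬ a < j)) := by
      rw [← hfull, ← hzero]
      constructor
      · intro h
        rcases (hle j).lt_or_eq with h2 | h2
        · right; rwa [Nat.mod_eq_of_lt h2] at h
        · left; exact h2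
      · rintro (h | h)
        · rw [h, Nat.mod_self]
        · rw [h, Nat.zero_mod]
    have hmM : D.min' hD ≤ D.max' hD := D.min'_le _ (D.max'_mem hD)
    rw [mem_cycIvl, Finset.mem_filter, hmod, hmod']
    simp only [Finset.mem_univ, true_and]
    constructor
    · rintro ⟨q, hq1, hq2⟩
      have hj := j.isLt
      have hm := (D.min' hD).isLt
      have hM := (D.max' hD).isLt
      have hq0 : 0 ≤ q := by
        by_contra h
        have : q * n ≤ -1 * n := by
          apply mul_le_mul_of_nonneg_right <;> omega
        omega
      have hq1' : q ≤ 1 := by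
        by_contra h
        have : 2 * (n : ℤ) ≤ q * n := by
          apply mul_le_mul_of_nonneg_right <;> omega
        omega
      have hq : q = 0 ∨ q = 1 := by omega
      rcases hq with rfl | rfl
      · have hlt : ∀ a ∈ D, a < j := fun a ha => by
          have := D.le_max' a ha
          rw [Fin.lt_def]; rw [Fin.le_def] at this; omega
        exact ⟨fun h => lt_irrefl _ (hlt j h), Or.inl hlt⟩
      · have hlt : ∀ a ∈ D, j < a := fun a ha => by
          have := D.min'_le a ha
          rw [Fin.lt_def]; rw [Fin.le_def] at this; omega
        exact ⟨fun h => lt_irrefl _ (hlt j h), Or.inr fun a ha => (hlt a ha).not_gt⟩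
    · rintro ⟨hj, h | h⟩
      · refine ⟨0, ?_, ?_⟩
        · have := h _ (D.max'_mem hD); rw [Fin.lt_def] at this; omega
        · have := j.isLt; omega
      · refine ⟨1, ?_, ?_⟩
        · have := (D.max' hD).isLt; omega
        · have h2 := h _ (D.min'_mem hD)
          have h3 : j ≠ D.min' hD := fun h => hj (h ▸ D.min'_mem hD)
          have h4 : j < D.min' hD := lt_of_le_of_ne (not_lt.1 h2) h3
          rw [Fin.lt_def] at h4; omega
  · push Not at h1
    obtain ⟨⟨q0, hq0, hcq0⟩, p0, hp0, hpc0⟩ := h1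
    have hP : (D.filter (· < c)).Nonempty := ⟨p0, by simp [hp0, hpc0]⟩
    have hQ : (D.filter (c < ·)).Nonempty :=
      ⟨q0, by simp [hq0, lt_of_le_of_ne hcq0 (fun h => hc (h ▸ hq0))]⟩
    set p := (D.filter (· < c)).max' hP
    set q := (D.filter (c < ·)).min' hQ
    have hp : p ∈ D ∧ p < c := Finset.mem_filter.1 (Finset.max'_mem _ hP)
    have hq : q ∈ D ∧ c < q := Finset.mem_filter.1 (Finset.min'_mem _ hQ)
    have hpmax : ∀ a ∈ D, a < c → a ≤ p := fun a ha h => Finset.le_max' _ _ (by simp [ha, h])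
    have hqmin : ∀ a ∈ D, c < a → q ≤ a := fun a ha h => Finset.min'_le _ _ (by simp [ha, h])
    have hclt : (D.filter (· < c)).card < D.card := by
      refine lt_of_le_of_ne (hle c) fun h => ?_
      exact ((hfull c).1 h q hq.1).not_gt hq.2
    have hc0 : (D.filter (· < c)).card ≠ 0 := fun h => (hzero c).1 h p hp.1 hp.2
    refine ⟨(p : ℕ) + 2, (q : ℕ), ?_⟩
    ext j
    rw [mem_cycIvl, Finset.mem_filter]
    simp only [Finset.mem_univ, true_and]
    have hmem : (∃ r : ℤ, ((p : ℕ) : ℤ) + 2 ≤ j + 1 + r * n ∧ (j : ℤ) + 1 + r * n ≤ (q : ℕ)) ↔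
        p < j ∧ j < q := by
      rw [Fin.lt_def, Fin.lt_def]
      constructor
      · rintro ⟨r, h1, h2⟩
        have hj := j.isLt
        have hm := q.isLt
        have hr0 : 0 ≤ r := by
          by_contra h
          have : r * n ≤ -1 * n := by
            apply mul_le_mul_of_nonneg_right <;> omega
          omega
        have hr1 : r ≤ 0 := by
          by_contra h
          have : 1 * (n : ℤ) ≤ r * n := by
            apply mul_le_mul_of_nonneg_right <;> omega
          omega
        have : r = 0 := by omega
        subst this
        omega
      · rintro ⟨h1, h2⟩
        exact ⟨0, by omega, by omega⟩
    rw [hmem]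
    constructor
    · rintro ⟨h1, h2⟩
      have hjD : j ∉ D := by
        intro hj
        rcases lt_trichotomy j c with h | h | h
        · exact (hpmax j hj h).not_gt h1
        · exact hc (h ▸ hj)
        · exact (hqmin j hj h).not_gt h2
      refine ⟨hjD, ?_⟩
      congr 2
      ext a
      simp only [Finset.mem_filter, and_congr_right_iff]
      intro ha
      constructor
      · intro haj
        by_contra hac
        have : c < a := lt_of_le_of_ne (not_lt.1 hac) fun h => hc (h ▸ ha)
        exact (lt_of_le_of_lt (hqmin a ha this) haj).not_gt h2
      · intro hac
        exact lt_of_le_of_lt (hpmax a ha hac) h1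
    · rintro ⟨hjD, hj⟩
      rw [Nat.mod_eq_of_lt hclt] at hj
      have hjcard : (D.filter (· < j)).card = (D.filter (· < c)).card := by
        rcases (hle j).lt_or_eq with h2 | h2
        · rwa [Nat.mod_eq_of_lt h2] at hj
        · rw [h2, Nat.mod_self] at hj; exact absurd hj.symm hc0
      constructor
      · by_contra h
        have hjp : j < p := lt_of_le_of_ne (not_lt.1 h) fun h => hjD (h ▸ hp.1)
        refine absurd hjcard (ne_of_lt (Finset.card_lt_card ?_))
        rw [Finset.ssubset_iff_of_subset]
        · exact ⟨p, by simp [hp], by simp [hjp.le]⟩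
        · intro a ha
          simp only [Finset.mem_filter] at ha ⊢
          exact ⟨ha.1, ha.2.trans (hjp.trans hp.2)⟩
      · by_contra h
        have hjq : q < j := lt_of_le_of_ne (not_lt.1 h) fun h => hjD (h ▸ hq.1)
        refine absurd hjcard.symm (ne_of_lt (Finset.card_lt_card ?_))
        rw [Finset.ssubset_iff_of_subset]
        · exact ⟨q, by simp [hq, hjq], by simp [hq.2.le]⟩
        · intro a ha
          simp only [Finset.mem_filter] at ha ⊢
          exact ⟨ha.1, ha.2.trans (hq.2.trans hjq)⟩

/-- If no two points of `D` are separated by `c` and `i`, then `c` and `i` lie in the same gap. -/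
lemma same_gap {n : ℕ} {D : Finset (Fin n)} {c i : Fin n} (hc : c ∉ D) (hi : i ∉ D)
    (h : ∀ a ∈ D, ∀ b ∈ D, 0 < ((((a : ℕ) : ℝ) - (c : ℕ)) * (((a : ℕ) : ℝ) - (i : ℕ))) *
      ((((b : ℕ) : ℝ) - (c : ℕ)) * (((b : ℕ) : ℝ) - (i : ℕ)))) :
    (D.filter (· < c)).card % D.card = (D.filter (· < i)).card % D.card := by
  wlog hci : c ≤ i generalizing c i
  · refine (this hi hc (fun a ha b hb => ?_) (le_of_not_ge hci)).symm
    convert h a ha b hb using 1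
    ring
  have hsub : D.filter (· < c) ⊆ D.filter (· < i) := by
    intro a ha
    simp only [Finset.mem_filter] at ha ⊢
    exact ⟨ha.1, ha.2.trans_le hci⟩
  by_cases heq : D.filter (· < c) = D.filter (· < i)
  · rw [heq]
  -- If some element of `D` lies between `c` and `i`, the sign hypothesis puts all of `D` there. The
  -- two counts are then `0` and the size of `D`, which agree modulo that size.
  obtain ⟨a, ha, hac⟩ := Finset.exists_of_ssubset (hsub.ssubset_of_ne heq)
  simp only [Finset.mem_filter, not_and, not_lt] at ha hac
  have hca : c < a := lt_of_le_of_ne (hac ha.1) fun h => hc (h ▸ ha.1)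
  have hneg : (((a : ℕ) : ℝ) - (c : ℕ)) * (((a : ℕ) : ℝ) - (i : ℕ)) < 0 := by
    have h1 : ((c : ℕ) : ℝ) < (a : ℕ) := by exact_mod_cast hca
    have h2 : ((a : ℕ) : ℝ) < (i : ℕ) := by exact_mod_cast ha.2
    nlinarith
  have hb : ∀ b ∈ D, c < b ∧ b < i := by
    intro b hb
    have h3 := h a ha.1 b hb
    have h4 : (((b : ℕ) : ℝ) - (c : ℕ)) * (((b : ℕ) : ℝ) - (i : ℕ)) < 0 := by
      by_contra h5
      exact h3.not_ge (mul_nonpos_of_nonpos_of_nonneg hneg.le (not_lt.1 h5))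
    have hci' : ((c : ℕ) : ℝ) ≤ (i : ℕ) := by exact_mod_cast hci
    rw [mul_neg_iff] at h4
    rcases h4 with ⟨h5, h6⟩ | ⟨h5, h6⟩
    · constructor
      · have : ((c : ℕ) : ℝ) < (b : ℕ) := by linarith
        exact_mod_cast this
      · have : ((b : ℕ) : ℝ) < (i : ℕ) := by linarith
        exact_mod_cast this
    · linarith
  have e1 : D.filter (· < c) = ∅ := by
    rw [Finset.filter_eq_empty_iff]
    exact fun b hb' => (hb b hb').1.not_gt
  have e2 : D.filter (· < i) = D := by
    rw [Finset.filter_eq_self]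
    exact fun b hb' => (hb b hb').2
  rw [e1, e2]; simp

lemma exists_independent_of_le_rank {k n : ℕ} (A : Matrix (Fin k) (Fin n) ℝ) (I : Finset (Fin n))
    {d : ℕ} (hd : d ≤ colRank A I) :
    ∃ B ⊆ I, B.card = d ∧ LinearIndepOn ℝ (colv A) (B : Set (Fin n)) := by
  obtain ⟨B, -, hBI, hli, hsp⟩ := exists_finset_linearIndepOn (colv A) ∅ I (by simp) (by simp)
  have : B.card = colRank A I := by rw [← finrank_span_image_eq hli, hsp, colRank]
  obtain ⟨B', hB', hc⟩ := Finset.exists_subset_card_eq (hd.trans this.ge)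
  exact ⟨B', hB'.trans hBI, hc, hli.mono (by exact_mod_cast hB')⟩

lemma exists_circuit {ι E : Type*} [AddCommGroup E] [Module ℝ E] [DecidableEq ι] (v : ι → E)
    (B : Finset ι) (h : ¬ LinearIndepOn ℝ v (B : Set ι)) :
    ∃ C ⊆ B, ¬ LinearIndepOn ℝ v (C : Set ι) ∧
      ∀ j ∈ C, LinearIndepOn ℝ v ((C.erase j : Finset ι) : Set ι) := by
  induction B using Finset.strongInduction with
  | H B ih =>
    by_cases hB : ∀ j ∈ B, LinearIndepOn ℝ v ((B.erase j : Finset ι) : Set ι)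
    · exact ⟨B, subset_rfl, h, hB⟩
    · push Not at hB
      obtain ⟨j, hj, hdep⟩ := hB
      obtain ⟨C, hC, h1, h2⟩ := ih _ (Finset.erase_ssubset hj) hdep
      exact ⟨C, hC.trans (Finset.erase_subset _ _), h1, h2⟩

/-- In the matroid of a totally nonnegative matrix, a set is a basis as soon as it satisfies the
rank inequalities for cyclic intervals. -/
theorem minor_ne_zero_of_cyclic_rank {k n : ℕ} {e : ℝ} {A : Matrix (Fin k) (Fin n) ℝ}
    (hA : NonnegMinors e A) (he : e ≠ 0) (J : Finset (Fin n)) (hJ : J.card = k)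
    (h : ∀ i b : ℤ, (J ∩ cycIvl n i b).card ≤ colRank A (cycIvl n i b)) :
    minor A J hJ ≠ 0 := by
  classical
  intro h0
  have hfull : ∀ ψ : Fin k → ℝ, (∀ j, ψ ⬝ᵥ colv A j = 0) → ψ = 0 := by
    intro ψ hψ
    have hI : cycIvl n 1 n = Finset.univ := by
      ext c; simp [cycIvl_full]
    have h1 := h 1 n
    rw [hI, Finset.inter_univ, hJ, colRank] at h1
    have htop : Submodule.span ℝ (colv A '' ((Finset.univ : Finset (Fin n)) : Set (Fin n))) = ⊤ := by
      apply Submodule.eq_top_of_finrank_eq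
      refine le_antisymm (Submodule.finrank_le _) (by simpa using h1)
    let L : (Fin k → ℝ) →ₗ[ℝ] ℝ := dotProductBilin ℝ ℝ ψ
    have h2 : (⊤ : Submodule ℝ (Fin k → ℝ)) ≤ LinearMap.ker L := by
      rw [← htop, Submodule.span_le]
      rintro _ ⟨x, -, rfl⟩
      exact hψ x
    have h3 : ψ ⬝ᵥ ψ = 0 := h2 (Submodule.mem_top (x := ψ))
    exact dotProduct_self_eq_zero.1 h3
  -- If the minor on `J` vanished, a nonzero functional would vanish on the columns in `J`. Choose
  -- one, `φ`, whose support `D` is as small as possible.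
  let P : (Fin k → ℝ) → Prop := fun φ => φ ≠ 0 ∧ ∀ j ∈ J, φ ⬝ᵥ colv A j = 0
  let supp : (Fin k → ℝ) → Finset (Fin n) := fun φ => Finset.univ.filter fun j => φ ⬝ᵥ colv A j ≠ 0
  have hexP : ∃ φ, P φ := by
    have h1 : ¬ tupleMinor A (J.orderEmbOfFin hJ) ≠ 0 := by
      rw [← minor_eq_tupleMinor]; simpa using h0
    rw [tupleMinor_ne_zero_iff] at h1
    push Not at h1
    obtain ⟨ψ, h2, h3⟩ := h1
    refine ⟨ψ, h3, fun j hj => ?_⟩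
    have : j ∈ Set.range (J.orderEmbOfFin hJ) := by
      rw [Finset.range_orderEmbOfFin]; exact hj
    obtain ⟨a, rfl⟩ := this
    exact h2 a
  obtain ⟨φ, ⟨hφ0, hφJ⟩, hφmin⟩ :=
    exists_minimalFor_of_wellFoundedLT P (fun φ => (supp φ).card) hexP
  set D := supp φ with hD
  have hDmem : ∀ j, j ∈ D ↔ φ ⬝ᵥ colv A j ≠ 0 := fun j => by simp [hD, supp]
  have hDne : D.Nonempty := by
    by_contra hne
    rw [Finset.not_nonempty_iff_eq_empty] at hne
    exact hφ0 (hfull φ fun j => by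
      by_contra hj
      have := (hDmem j).2 hj
      simp [hne] at this)
  have hmin : ∀ a, φ ⬝ᵥ colv A a ≠ 0 → ∀ ψ : Fin k → ℝ,
      (∀ j, φ ⬝ᵥ colv A j = 0 → ψ ⬝ᵥ colv A j = 0) → ψ ⬝ᵥ colv A a = 0 → ψ = 0 := by
    intro a ha ψ h1 h2
    by_contra hψ
    have hsub : supp ψ ⊂ D := by
      rw [Finset.ssubset_iff_of_subset]
      · exact ⟨a, (hDmem a).2 ha, by simp [supp, h2]⟩
      · intro j hj
        rw [hDmem]
        intro hj0
        simp [supp, h1 j hj0] at hj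
    have h3 := hφmin (show P ψ from ⟨hψ, fun j hj => h1 j (hφJ j hj)⟩)
      (Finset.card_lt_card hsub).le
    exact (Finset.card_lt_card hsub).not_ge h3
  let κ : Fin n → ℕ := fun j => (D.filter (· < j)).card % D.card
  let I : ℕ → Finset (Fin n) := fun x => Finset.univ.filter fun j => j ∉ D ∧ κ j = x
  have hJD : ∀ j ∈ J, j ∉ D := fun j hj h1 => (hDmem j).1 h1 (hφJ j hj)
  -- The gaps of `D` are cyclic intervals, so the rank hypothesis provides in each of them an
  -- independent set with as many elements as `J` has there.
  have hB : ∀ x, ∃ B ⊆ I x, B.card = (J ∩ I x).card ∧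
      LinearIndepOn ℝ (colv A) (B : Set (Fin n)) := by
    intro x
    by_cases hx : ∃ c, c ∈ I x
    · obtain ⟨c, hc⟩ := hx
      have hc' : c ∉ D ∧ κ c = x := by simpa [I] using hc
      obtain ⟨i, b, hib⟩ := exists_cycIvl_of_gap D hDne hc'.1
      have h1 : I x = cycIvl n i b := by
        rw [hib, ← hc'.2]
      rw [h1]
      exact exists_independent_of_le_rank A _ (h i b)
    · refine ⟨∅, by simp, ?_, by simp⟩
      have h1 : J ∩ I x = ∅ := by
        ext c
        simp only [Finset.mem_inter, Finset.notMem_empty, iff_false, not_and]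
        intro _ h2
        exact hx ⟨c, h2⟩
      rw [h1]
  choose B hBI hBcard hBli using hB
  let R := Finset.range D.card
  have hκR : ∀ j, κ j ∈ R := fun j => Finset.mem_range.2 (Nat.mod_lt _ hDne.card_pos)
  let BB := R.biUnion B
  have hBB : BB.card = k := by
    rw [Finset.card_biUnion]
    · simp_rw [hBcard]
      rw [← hJ, Finset.card_eq_sum_card_fiberwise (f := κ) (t := R) (fun j _ => hκR j)]
      refine Finset.sum_congr rfl fun x _ => ?_
      congr 1
      ext j
      simp only [Finset.mem_inter, Finset.mem_filter, I, Finset.mem_univ, true_and]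
      constructor
      · rintro ⟨h1, _, h2⟩; exact ⟨h1, h2⟩
      · rintro ⟨h1, h2⟩; exact ⟨h1, hJD j h1, h2⟩
    · intro x _ y _ hxy
      rw [Function.onFun, Finset.disjoint_left]
      intro j hjx hjy
      have h1 := hBI x hjx
      have h2 := hBI y hjy
      simp only [Finset.mem_filter, I] at h1 h2
      exact hxy (h1.2.2.symm.trans h2.2.2)
  have hBBzero : ∀ j ∈ BB, φ ⬝ᵥ colv A j = 0 := by
    intro j hj
    obtain ⟨x, _, hx⟩ := Finset.mem_biUnion.1 hj
    have h1 := hBI x hx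
    simp only [Finset.mem_filter, I] at h1
    by_contra h2
    exact h1.2.1 ((hDmem j).2 h2)
  -- The union has `k` elements but lies in the hyperplane normal to `φ`, so it contains a circuit.
  have hdep : ¬ LinearIndepOn ℝ (colv A) (BB : Set (Fin n)) := by
    intro hli
    have h1 := finrank_span_image_eq hli
    rw [hBB] at h1
    have htop : Submodule.span ℝ (colv A '' (BB : Set (Fin n))) = ⊤ :=
      Submodule.eq_top_of_finrank_eq (by simpa using h1)
    let L : (Fin k → ℝ) →ₗ[ℝ] ℝ := dotProductBilin ℝ ℝ φ
    have h2 : (⊤ : Submodule ℝ (Fin k → ℝ)) ≤ LinearMap.ker L := by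
      rw [← htop, Submodule.span_le]
      rintro _ ⟨x, hx, rfl⟩
      exact hBBzero x hx
    have h3 : φ ⬝ᵥ φ = 0 := h2 (Submodule.mem_top (x := φ))
    exact hφ0 (dotProduct_self_eq_zero.1 h3)
  obtain ⟨C, hCB, hCdep, hCcirc⟩ := exists_circuit (colv A) BB hdep
  have hCne : C.Nonempty := by
    by_contra hne
    rw [Finset.not_nonempty_iff_eq_empty] at hne
    apply hCdep
    simp [hne]
  obtain ⟨c, hc⟩ := hCne
  have hCD : ∀ j ∈ C, j ∉ D := fun j hj h1 => (hDmem j).1 h1 (hBBzero j (hCB hj))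
  -- A circuit inside the hyperplane cannot have two elements separated by `D`. It stays in a single
  -- gap, where the chosen columns are independent: a contradiction.
  have hsame : ∀ i ∈ C, κ i = κ c := by
    intro i hi
    by_cases hci : c = i
    · rw [hci]
    · refine (same_gap (hCD c hc) (hCD i hi) fun a ha b hb => ?_).symm
      exact circuit_sides hA he hmin (fun j hj => hBBzero j (hCB hj)) hCdep hCcirc hc hi hci
        ((hDmem a).1 ha) ((hDmem b).1 hb)
  apply hCdep
  refine (hBli (κ c)).mono ?_
  intro j hj
  obtain ⟨x, _, hx⟩ := Finset.mem_biUnion.1 (hCB hj)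
  have h1 := hBI x hx
  simp only [Finset.mem_filter, I] at h1
  rw [← hsame j hj, h1.2.2]
  exact hx

end Amplituhedron

namespace Amplituhedron
open Matrix Equiv Filter Topology

/-! ## Perturbation of totally nonnegative matrices -/

lemma posMinors_of_strictMono {k n : ℕ} {e : ℝ} {A : Matrix (Fin k) (Fin n) ℝ}
    (h : ∀ t, StrictMono t → 0 < e * tupleMinor A t) : PosMinors e A :=
  posMinors_iff.2 fun J hJ => h _ (J.orderEmbOfFin hJ).strictMono

lemma PosMinors.pos {k n : ℕ} {e : ℝ} {A : Matrix (Fin k) (Fin n) ℝ} (h : PosMinors e A)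
    {t : Fin k → Fin n} (ht : StrictMono t) : 0 < e * tupleMinor A t := by
  have h1 := h t ht.injective
  rw [← mul_assoc] at h1
  exact (pos_iff_pos_of_mul_pos h1).2 (vdm_pos_of_strictMono ht)

/-- The matrix with entries `q ^ ((i - j) ^ 2)`. -/
def gaussMatrix (n : ℕ) (q : ℝ) : Matrix (Fin n) (Fin n) ℝ :=
  Matrix.of fun i j => q ^ (((i : ℤ) - j).natAbs ^ 2)

lemma gaussMatrix_zero (n : ℕ) : gaussMatrix n 0 = 1 := by
  ext i j
  by_cases h : i = j
  · subst h; simp [gaussMatrix]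
  · have : ((i : ℤ) - j).natAbs ^ 2 ≠ 0 := by
      have : (i : ℕ) ≠ j := fun h' => h (Fin.ext h')
      apply pow_ne_zero; omega
    simp [gaussMatrix, h, zero_pow this]

lemma continuous_gaussMatrix (n : ℕ) : Continuous (gaussMatrix n) := by
  refine continuous_pi fun i => continuous_pi fun j => ?_
  simp only [gaussMatrix, Matrix.of_apply]
  fun_prop

/-- After expanding the squares, only the cross term depends on the permutation. The rearrangement
inequality shows that the identity is its only maximizer when both tuples increase strictly. -/
lemma sum_sq_lt_of_ne_one {k n p : ℕ} {s : Fin k → Fin n} {t : Fin k → Fin p} (hs : StrictMono s)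
    (ht : StrictMono t) {σ : Perm (Fin k)} (hσ : σ ≠ 1) :
    ∑ a, ((s a : ℤ) - t a).natAbs ^ 2 < ∑ a, ((s (σ a) : ℤ) - t a).natAbs ^ 2 := by
  have hm : Monovary (fun a => (s a : ℤ)) (fun a => (t a : ℤ)) := by
    intro a b hab
    have : t a < t b := by
      rw [Fin.lt_def]; exact Nat.cast_lt.1 hab
    have := hs (ht.lt_iff_lt.1 this)
    exact Nat.cast_le.2 this.le
  have h1 : ∑ a, (s (σ a) : ℤ) * (t a : ℤ) < ∑ a, (s a : ℤ) * (t a : ℤ) := by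
    rw [Monovary.sum_comp_perm_mul_lt_sum_mul_iff hm]
    intro h
    apply hσ
    have h2 : StrictMono σ := by
      intro a b hab
      have h3 : ((t a : ℕ) : ℤ) < (t b : ℕ) := by exact_mod_cast ht hab
      have h4 := h h3
      simp only [Function.comp_apply] at h4
      have h5 : s (σ a) ≤ s (σ b) := by rw [Fin.le_def]; exact_mod_cast h4
      exact lt_of_le_of_ne (hs.le_iff_le.1 h5) (fun h => hab.ne (σ.injective h))
    have h3 := (h2.range_inj strictMono_id).1 (by simp [σ.surjective.range_eq])
    ext a; simp [h3]
  have h2 : ∀ τ : Perm (Fin k), ((∑ a, ((s (τ a) : ℤ) - t a).natAbs ^ 2 : ℕ) : ℤ) =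
      ∑ a, (s a : ℤ) ^ 2 + ∑ a, (t a : ℤ) ^ 2 - 2 * ∑ a, (s (τ a) : ℤ) * (t a : ℤ) := by
    intro τ
    rw [← Equiv.sum_comp τ (fun a => (s a : ℤ) ^ 2)]
    push_cast
    rw [Finset.mul_sum, ← Finset.sum_add_distrib, ← Finset.sum_sub_distrib]
    refine Finset.sum_congr rfl fun a _ => ?_
    rw [sq_abs]; ring
  have h3 := h2 1
  have h4 := h2 σ
  simp only [Perm.coe_one, id_eq] at h3
  omega

/-- As a polynomial in `q`, the minor has a unique term of lowest degree, that of the identity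
permutation, with coefficient one. This term dominates for small positive `q`. -/
lemma eventually_gaussMatrix_pos {k n : ℕ} {s : Fin k → Fin n} {t : Fin k → Fin n}
    (hs : StrictMono s) (ht : StrictMono t) :
    ∀ᶠ q in 𝓝[>] (0 : ℝ), 0 < ((gaussMatrix n q).submatrix s t).det := by
  let E : Perm (Fin k) → ℕ := fun σ => ∑ a, ((s (σ a) : ℤ) - t a).natAbs ^ 2
  have hE : ∀ σ, E 1 ≤ E σ := by
    intro σ
    by_cases h : σ = 1
    · rw [h]
    · exact (sum_sq_lt_of_ne_one hs ht h).le
  let h : ℝ → ℝ := fun q => ∑ σ : Perm (Fin k), (Perm.sign σ : ℝ) * q ^ (E σ - E 1)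
  have hdet : ∀ q, ((gaussMatrix n q).submatrix s t).det = q ^ E 1 * h q := by
    intro q
    rw [Matrix.det_apply', Finset.mul_sum]
    refine Finset.sum_congr rfl fun σ _ => ?_
    simp only [gaussMatrix, Matrix.submatrix_apply, Matrix.of_apply]
    rw [Finset.prod_pow_eq_pow_sum, mul_left_comm, ← pow_add, Nat.add_sub_cancel' (hE σ)]
  have hc : Continuous h := by
    simp only [h]; fun_prop
  have h0 : h 0 = 1 := by
    simp only [h]
    rw [Finset.sum_eq_single 1]
    · simp
    · intro σ _ hσ
      have : E 1 < E σ := sum_sq_lt_of_ne_one hs ht hσ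
      rw [zero_pow (by omega), mul_zero]
    · simp
  have h1 : ∀ᶠ q in 𝓝[>] (0 : ℝ), 0 < h q :=
    nhdsWithin_le_nhds (hc.tendsto 0 |>.eventually (lt_mem_nhds (by rw [h0]; exact one_pos)))
  filter_upwards [h1, self_mem_nhdsWithin] with q hq hq0
  rw [hdet]
  exact mul_pos (pow_pos hq0 _) hq

/-- By Cauchy–Binet every maximal minor of the product is a sum of terms of one sign, at least one
of them nonzero. As the second factor tends to the identity, this approximates totally nonnegative
matrices of full rank by totally positive ones. -/
lemma eventually_posMinors_mul_gaussMatrix {k n : ℕ} {e : ℝ} {A : Matrix (Fin k) (Fin n) ℝ}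
    (hA : NonnegMinors e A) (he : e ≠ 0) (hr : ∃ t, tupleMinor A t ≠ 0) :
    ∀ᶠ q in 𝓝[>] (0 : ℝ), PosMinors e (A * gaussMatrix n q) := by
  have h1 : ∀ᶠ q in 𝓝[>] (0 : ℝ), ∀ (s t : Fin k → Fin n), StrictMono s → StrictMono t →
      0 < ((gaussMatrix n q).submatrix s t).det := by
    simp only [Filter.eventually_all]
    intro s t hs ht
    exact eventually_gaussMatrix_pos hs ht
  filter_upwards [h1] with q hq
  refine posMinors_of_strictMono fun t ht => ?_
  have hfac : (0 : ℝ) < k.factorial := by exact_mod_cast k.factorial_pos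
  have hterm : ∀ s, 0 ≤ e * (tupleMinor A s * ((gaussMatrix n q).submatrix s t).det) ∧
      (tupleMinor A s ≠ 0 → 0 < e * (tupleMinor A s * ((gaussMatrix n q).submatrix s t).det)) := by
    intro s
    by_cases hs : Function.Injective s
    · obtain ⟨s', σ, hs', rfl⟩ := exists_strictMono_comp hs
      have e1 : ((gaussMatrix n q).submatrix (s' ∘ σ) t).det =
          (Perm.sign σ : ℝ) * ((gaussMatrix n q).submatrix s' t).det := by
        have := Matrix.det_permute σ ((gaussMatrix n q).submatrix s' t)
        simpa [Matrix.submatrix_submatrix] using this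
      rw [e1, tupleMinor_comp]
      have e2 : e * ((Perm.sign σ : ℝ) * tupleMinor A s' *
          ((Perm.sign σ : ℝ) * ((gaussMatrix n q).submatrix s' t).det)) =
          (e * tupleMinor A s') * ((gaussMatrix n q).submatrix s' t).det := by
        linear_combination (e * tupleMinor A s' * ((gaussMatrix n q).submatrix s' t).det) *
          sign_mul_self σ
      rw [e2]
      have e3 : 0 ≤ e * tupleMinor A s' := by
        have := hA s'
        rw [← mul_assoc] at this
        exact nonneg_of_mul_nonneg_left this (vdm_pos_of_strictMono hs')
      refine ⟨mul_nonneg e3 (hq s' t hs' ht).le, fun h => mul_pos ?_ (hq s' t hs' ht)⟩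
      exact e3.lt_of_ne' (mul_ne_zero he (right_ne_zero_of_mul h))
    · have := tupleMinor_eq_zero A hs
      simp [this]
  obtain ⟨s0, hs0⟩ := hr
  have key : 0 < (k.factorial : ℝ) * (e * tupleMinor (A * gaussMatrix n q) t) := by
    rw [mul_left_comm, cauchyBinet, Finset.mul_sum]
    exact Finset.sum_pos' (fun s _ => (hterm s).1) ⟨s0, Finset.mem_univ _, (hterm s0).2 hs0⟩
  exact (pos_iff_pos_of_mul_pos key).1 hfac

/-! ## Adding a column to a totally positive matrix -/

/-- The matrix with an additional last column. -/
def snocCol {p n : ℕ} (A : Matrix (Fin p) (Fin n) ℝ) (c : Fin p → ℝ) :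
    Matrix (Fin p) (Fin (n + 1)) ℝ :=
  Matrix.of fun a => Fin.snoc (α := fun _ => ℝ) (A a) (c a)

@[simp] lemma snocCol_castSucc {p n : ℕ} (A : Matrix (Fin p) (Fin n) ℝ) (c : Fin p → ℝ) (a : Fin p)
    (j : Fin n) : snocCol A c a j.castSucc = A a j := by simp [snocCol]

@[simp] lemma snocCol_last {p n : ℕ} (A : Matrix (Fin p) (Fin n) ℝ) (c : Fin p → ℝ) (a : Fin p) :
    snocCol A c a (Fin.last n) = c a := by simp [snocCol]

/-- The maximal minor whose last column is `c`, as a linear form in `c`. -/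
noncomputable def lastColMinor {p n : ℕ} (A : Matrix (Fin (p + 1)) (Fin n) ℝ) (s : Fin p → Fin n) :
    (Fin (p + 1) → ℝ) →ₗ[ℝ] ℝ :=
  (LinearMap.proj (Fin.last p)).comp
    (cramer (Matrix.of fun a => Fin.snoc (α := fun _ => ℝ) (fun q => A a (s q)) 0))

lemma lastColMinor_apply {p n : ℕ} (A : Matrix (Fin (p + 1)) (Fin n) ℝ) (s : Fin p → Fin n)
    (c : Fin (p + 1) → ℝ) : lastColMinor A s c =
      (Matrix.of fun a => Fin.snoc (α := fun _ => ℝ) (fun q => A a (s q)) (c a)).det := by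
  rw [lastColMinor, LinearMap.comp_apply, LinearMap.proj_apply, Matrix.cramer_apply]
  congr 1
  ext x y
  refine Fin.lastCases ?_ (fun y => ?_) y
  · simp
  · simp [Fin.castSucc_ne_last]

lemma lastColMinor_col {p n : ℕ} (A : Matrix (Fin (p + 1)) (Fin n) ℝ) (s : Fin p → Fin n)
    (j : Fin n) : lastColMinor A s (colv A j) =
      tupleMinor A (Fin.snoc (α := fun _ => Fin n) s j) := by
  rw [lastColMinor_apply, tupleMinor]
  congr 1
  ext x y
  refine Fin.lastCases ?_ (fun y => ?_) y <;> simp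

/-- An increasing tuple either avoids the last column or ends with it. The conditions on a new
column are thus strict linear inequalities, and the admissible columns form a convex set. -/
lemma posMinors_snocCol_iff {p n : ℕ} {A : Matrix (Fin (p + 1)) (Fin n) ℝ} {c : Fin (p + 1) → ℝ} :
    PosMinors 1 (snocCol A c) ↔ PosMinors 1 A ∧ ∀ s, StrictMono s → 0 < lastColMinor A s c := by
  have e1 : ∀ t : Fin (p + 1) → Fin n,
      tupleMinor (snocCol A c) (Fin.castSucc ∘ t) = tupleMinor A t := by
    intro t
    rw [tupleMinor, tupleMinor]
    congr 1
    ext x y; simp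
  have e2 : ∀ s : Fin p → Fin n, tupleMinor (snocCol A c)
      (Fin.snoc (α := fun _ => Fin (n + 1)) (Fin.castSucc ∘ s) (Fin.last n)) =
      lastColMinor A s c := by
    intro s
    rw [tupleMinor, lastColMinor_apply]
    congr 1
    ext x y
    refine Fin.lastCases ?_ (fun y => ?_) y <;> simp
  have hcs : StrictMono (Fin.castSucc : Fin n → Fin (n + 1)) := Fin.strictMono_castSucc
  constructor
  · intro h
    refine ⟨posMinors_of_strictMono fun t ht => ?_, fun s hs => ?_⟩
    · rw [← e1]; exact h.pos (hcs.comp ht)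
    · rw [← e2]
      have := h.pos (t := Fin.snoc (α := fun _ => Fin (n + 1)) (Fin.castSucc ∘ s) (Fin.last n)) ?_
      · simpa using this
      · intro a b hab
        induction a using Fin.lastCases with
        | last => exact absurd hab (Fin.le_last b).not_gt
        | cast a =>
          induction b using Fin.lastCases with
          | last => simp [Fin.castSucc_lt_last]
          | cast b => simpa using hs (Fin.castSucc_lt_castSucc_iff.1 hab)
  · rintro ⟨h1, h2⟩
    refine posMinors_of_strictMono fun t ht => ?_
    rw [one_mul]
    by_cases hl : t (Fin.last p) = Fin.last n
    · have hlt : ∀ q : Fin p, t q.castSucc ≠ Fin.last n := fun q h => by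
        have := ht (Fin.castSucc_lt_last q)
        rw [h, hl] at this; exact lt_irrefl _ this
      let s : Fin p → Fin n := fun q => (t q.castSucc).castPred (hlt q)
      have hs : StrictMono s := fun a b hab => by
        simp only [s, Fin.castPred_lt_castPred_iff]
        exact ht (Fin.castSucc_lt_castSucc_iff.2 hab)
      have : t = Fin.snoc (α := fun _ => Fin (n + 1)) (Fin.castSucc ∘ s) (Fin.last n) := by
        ext a
        refine Fin.lastCases ?_ (fun a => ?_) a
        · simp [hl]
        · simp [s]
      rw [this, e2]
      exact h2 s hs
    · have hlt : ∀ q, t q ≠ Fin.last n := fun q h => by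
        have h3 := ht.monotone (Fin.le_last q)
        rw [h] at h3
        exact hl (le_antisymm (Fin.le_last _) h3)
      let s : Fin (p + 1) → Fin n := fun q => (t q).castPred (hlt q)
      have hs : StrictMono s := fun a b hab => by
        simp only [s, Fin.castPred_lt_castPred_iff]
        exact ht hab
      have : t = Fin.castSucc ∘ s := by
        ext a; simp [s]
      rw [this, e1]
      simpa using h1.pos hs

lemma vdm_snoc {p n : ℕ} (s : Fin p → Fin n) (j : Fin n) :
    vdm (Fin.snoc (α := fun _ => Fin n) s j) =
      vdm s * ∏ q, (((j : ℕ) : ℝ) - ((s q : ℕ) : ℝ)) := by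
  simp only [vdm, det_vandermonde]
  rw [Fin.prod_univ_castSucc]
  simp only [Fin.snoc_last, Fin.snoc_castSucc]
  have h1 : Finset.Ioi (Fin.last p) = ∅ := by
    ext x; simpa using Fin.le_last x
  rw [h1, Finset.prod_empty, mul_one, ← Finset.prod_mul_distrib]
  refine Finset.prod_congr rfl fun i _ => ?_
  have h2 : Finset.Ioi i.castSucc = insert (Fin.last p) ((Finset.Ioi i).map Fin.castSuccEmb) := by
    ext x
    refine Fin.lastCases ?_ (fun x => ?_) x
    · simp [Fin.castSucc_lt_last]
    · simpa using fun _ => Fin.le_last x.castSucc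
  rw [h2, Finset.prod_insert (by simp), Finset.prod_map, mul_comm]
  simp

lemma prod_sub_sign {p n : ℕ} {s : Fin p → Fin n} {j : Fin n} (hj : ∀ q, s q ≠ j) :
    0 < (-1 : ℝ) ^ (Finset.univ.filter fun q => j < s q).card *
      ∏ q, (((j : ℕ) : ℝ) - ((s q : ℕ) : ℝ)) := by
  have h1 : (-1 : ℝ) ^ (Finset.univ.filter fun q => j < s q).card =
      ∏ q, if j < s q then (-1 : ℝ) else 1 := by
    rw [Finset.prod_ite]; simp
  rw [h1, ← Finset.prod_mul_distrib]
  refine Finset.prod_pos fun q _ => ?_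
  split_ifs with h
  · have : ((j : ℕ) : ℝ) < (s q : ℕ) := by exact_mod_cast h
    linarith
  · have h2 : s q < j := lt_of_le_of_ne (not_lt.1 h) (hj q)
    have : ((s q : ℕ) : ℝ) < (j : ℕ) := by exact_mod_cast h2
    linarith

/-- The new column is an alternating combination of the last `p + 1` columns with weights `(-ε) ^
x`, counted from the right. In each minor, columns already present contribute nothing. The first
absent one, at distance `X` from the right, dominates for small `ε`; exactly `X` columns of the
minor lie to its right, and the resulting sign cancels that of `(-ε) ^ X`. -/
lemma exists_posMinors_snocCol {p n : ℕ} (hpn : p ≤ n) {A : Matrix (Fin p) (Fin n) ℝ}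
    (hA : PosMinors 1 A) : ∃ c, PosMinors 1 (snocCol A c) := by
  obtain _ | p := p
  · refine ⟨0, fun t _ => ?_⟩
    simp [tupleMinor, vdm]
  let col : ℕ → Fin n := fun x => ⟨n - 1 - x, by omega⟩
  let c : ℝ → Fin (p + 1) → ℝ := fun ε => ∑ x ∈ Finset.range (p + 1), (-ε) ^ x • colv A (col x)
  have key : ∀ s : Fin p → Fin n, StrictMono s →
      ∀ᶠ ε in 𝓝[>] (0 : ℝ), 0 < lastColMinor A s (c ε) := by
    intro s hs
    -- The tuple `s` has only `p` entries, so it misses one of the last `p + 1` columns; these are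
    -- distinct because now `p + 1 ≤ n`.
    have hex : ∃ x, x < p + 1 ∧ ∀ q, s q ≠ col x := by
      by_contra hcon
      push Not at hcon
      have h1 : (Finset.range (p + 1)).image col ⊆ Finset.univ.image s := by
        intro y hy
        obtain ⟨x, hx, rfl⟩ := Finset.mem_image.1 hy
        obtain ⟨q, hq⟩ := hcon x (Finset.mem_range.1 hx)
        exact Finset.mem_image.2 ⟨q, Finset.mem_univ _, hq⟩
      have h2 := Finset.card_le_card h1
      rw [Finset.card_image_of_injective _ hs.injective, Finset.card_image_of_injOn] at h2
      · simp at h2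
      · intro x hx y hy hxy
        simp only [Finset.coe_range, Set.mem_Iio] at hx hy
        have := congrArg Fin.val hxy
        simp only [col] at this
        omega
    classical
    obtain ⟨⟨hX, hXs⟩, hXmin⟩ := And.intro (Nat.find_spec hex) (fun y => Nat.find_min hex (m := y))
    set X := Nat.find hex
    have hmem : ∀ x < X, ∃ q, s q = col x := by
      intro x hx
      by_contra h
      push Not at h
      exact hXmin x hx ⟨by omega, h⟩
    have hcount : (Finset.univ.filter fun q => col X < s q).card = X := by
      have h1 : (Finset.univ.filter fun q => col X < s q).image s = Finset.Ioi (col X) := by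
        ext y
        simp only [Finset.mem_image, Finset.mem_filter, Finset.mem_univ, true_and, Finset.mem_Ioi]
        constructor
        · rintro ⟨q, hq, rfl⟩; exact hq
        · intro hy
          have hy' := hy
          rw [Fin.lt_def] at hy'
          simp only [col] at hy'
          have hyl := y.isLt
          obtain ⟨q, hq⟩ := hmem (n - 1 - y) (by omega)
          have : col (n - 1 - y) = y := by
            ext; simp only [col]; omega
          exact ⟨q, by rw [hq, this]; exact hy, by rw [hq, this]⟩
      rw [← Finset.card_image_of_injective _ hs.injective, h1, Fin.card_Ioi]
      simp only [col]; omega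
    let g : ℕ → ℝ := fun x => tupleMinor A (Fin.snoc (α := fun _ => Fin n) s (col x))
    have hg0 : ∀ x < X, g x = 0 := by
      intro x hx
      obtain ⟨q, hq⟩ := hmem x hx
      apply tupleMinor_eq_zero
      intro hinj
      have := @hinj q.castSucc (Fin.last p) (by simp [hq])
      exact Fin.castSucc_ne_last q this
    have hgX : 0 < (-1 : ℝ) ^ X * g X := by
      have hinj : Function.Injective (Fin.snoc (α := fun _ => Fin n) s (col X)) := by
        rw [Fin.snoc_injective_iff]
        exact ⟨hs.injective, by rintro ⟨q, hq⟩; exact hXs q hq⟩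
      have h1 := hA _ hinj
      rw [vdm_snoc, one_mul] at h1
      have h2 := prod_sub_sign hXs
      rw [hcount] at h2
      have h3 := vdm_pos_of_strictMono hs
      have h4 := mul_pos h1 h2
      have h5 : g X * (vdm s * ∏ q, (((col X : ℕ) : ℝ) - ((s q : ℕ) : ℝ))) *
        ((-1 : ℝ) ^ X * ∏ q, (((col X : ℕ) : ℝ) - ((s q : ℕ) : ℝ))) = ((-1 : ℝ) ^ X * g X) *
        (vdm s * (∏ q, (((col X : ℕ) : ℝ) - ((s q : ℕ) : ℝ))) ^ 2) := by ring
      rw [h5] at h4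
      refine (pos_iff_pos_of_mul_pos h4).2 (mul_pos h3 (sq_pos_of_ne_zero ?_))
      intro h0; rw [h0] at h2; simp at h2
    let h : ℝ → ℝ := fun ε => ∑ x ∈ Finset.range (p + 1), (-1) ^ x * g x * ε ^ (x - X)
    have hlin : ∀ ε, lastColMinor A s (c ε) = ε ^ X * h ε := by
      intro ε
      simp only [c, h, map_sum, map_smul, lastColMinor_col, Finset.mul_sum, smul_eq_mul]
      refine Finset.sum_congr rfl fun x _ => ?_
      change (-ε) ^ x * g x = _
      rcases lt_or_ge x X with hx | hx
      · rw [hg0 x hx]; simp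
      · have : ε ^ x = ε ^ X * ε ^ (x - X) := by rw [← pow_add, Nat.add_sub_cancel' hx]
        rw [neg_pow, this]; ring
    have hc : Continuous h := by simp only [h]; fun_prop
    have h0 : 0 < h 0 := by
      simp only [h]
      rw [Finset.sum_eq_single X]
      · simpa using hgX
      · intro x _ hx
        rcases lt_or_gt_of_ne hx with hx | hx
        · rw [hg0 x hx]; simp
        · rw [zero_pow (by omega)]; simp
      · intro hn; exact absurd (Finset.mem_range.2 hX) hn
    have h1 : ∀ᶠ q in 𝓝[>] (0 : ℝ), 0 < h q :=
      nhdsWithin_le_nhds (hc.tendsto 0 |>.eventually (lt_mem_nhds h0))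
    filter_upwards [h1, self_mem_nhdsWithin] with q hq hq0
    rw [hlin]
    exact mul_pos (pow_pos hq0 _) hq
  have hall : ∀ᶠ ε in 𝓝[>] (0 : ℝ), ∀ s : Fin p → Fin n, StrictMono s →
      0 < lastColMinor A s (c ε) := by
    simp only [Filter.eventually_all]
    exact key
  obtain ⟨ε, hε⟩ := hall.exists
  exact ⟨c ε, posMinors_snocCol_iff.2 ⟨hA, hε⟩⟩

lemma exists_posMinors_extend {p n : ℕ} (hpn : p ≤ n) {A : Matrix (Fin p) (Fin n) ℝ}
    (hA : PosMinors 1 A) (m : ℕ) : ∃ A' : Matrix (Fin p) (Fin (n + m)) ℝ, PosMinors 1 A' ∧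
      ∀ a j, A' a (Fin.castAdd m j) = A a j := by
  induction m with
  | zero => exact ⟨A, hA, fun a j => rfl⟩
  | succ m ih =>
    obtain ⟨A', hA', h⟩ := ih
    obtain ⟨c, hc⟩ := exists_posMinors_snocCol (hpn.trans (Nat.le_add_right n m)) hA'
    refine ⟨snocCol A' c, hc, fun a j => ?_⟩
    rw [← h]
    exact snocCol_castSucc A' c a (Fin.castAdd m j)

/-! ## Connectedness of the totally positive part -/

/-- Matrices with positive maximal minors whose first columns form the identity matrix. -/
def normalizedTP (p n : ℕ) : Set (Matrix (Fin p) (Fin n) ℝ) :=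
  {A | (∀ a b : Fin p, ∀ h : (b : ℕ) < n, A a ⟨b, h⟩ = (1 : Matrix (Fin p) (Fin p) ℝ) a b) ∧
    PosMinors 1 A}

lemma continuous_tupleMinor {k n : ℕ} (t : Fin k → Fin n) :
    Continuous fun A : Matrix (Fin k) (Fin n) ℝ => tupleMinor A t :=
  (continuous_id.matrix_submatrix _ _).matrix_det

lemma isOpen_posMinors (k n : ℕ) (e : ℝ) :
    IsOpen {A : Matrix (Fin k) (Fin n) ℝ | PosMinors e A} := by
  have : {A : Matrix (Fin k) (Fin n) ℝ | PosMinors e A} =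
      ⋂ t : Fin k → Fin n, {A | Function.Injective t → 0 < e * (tupleMinor A t * vdm t)} := by
    ext A; simp [PosMinors]
  rw [this]
  refine isOpen_iInter_of_finite fun t => ?_
  by_cases ht : Function.Injective t
  · simp only [ht, true_imp_iff]
    exact isOpen_lt continuous_const
      (continuous_const.mul ((continuous_tupleMinor t).mul continuous_const))
  · simp [ht]

lemma isClosed_nonnegMinors (k n : ℕ) (e : ℝ) :
    IsClosed {A : Matrix (Fin k) (Fin n) ℝ | NonnegMinors e A} := by
  have : {A : Matrix (Fin k) (Fin n) ℝ | NonnegMinors e A} =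
      ⋂ t : Fin k → Fin n, {A | 0 ≤ e * (tupleMinor A t * vdm t)} := by
    ext A; simp [NonnegMinors]
  rw [this]
  exact isClosed_iInter fun t => isClosed_le continuous_const
      (continuous_const.mul ((continuous_tupleMinor t).mul continuous_const))

lemma continuous_snocCol_left {p n : ℕ} (c : Fin p → ℝ) :
    Continuous fun A : Matrix (Fin p) (Fin n) ℝ => snocCol A c := by
  refine continuous_pi fun a => continuous_pi fun j => ?_
  induction j using Fin.lastCases with
  | last => simp only [snocCol_last]; fun_prop
  | cast j => simp only [snocCol_castSucc]; fun_prop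

lemma continuous_snocCol_right {p n : ℕ} (A : Matrix (Fin p) (Fin n) ℝ) :
    Continuous fun c : Fin p → ℝ => snocCol A c := by
  refine continuous_pi fun a => continuous_pi fun j => ?_
  induction j using Fin.lastCases with
  | last => simp only [snocCol_last]; fun_prop
  | cast j => simp only [snocCol_castSucc]; fun_prop

lemma exists_eq_snocCol {p n : ℕ} (A : Matrix (Fin p) (Fin (n + 1)) ℝ) :
    ∃ B c, A = snocCol B c := by
  refine ⟨Matrix.of fun a j => A a j.castSucc, fun a => A a (Fin.last n), ?_⟩
  ext a j
  induction j using Fin.lastCases <;> simp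

/-- Induction on the number of columns. Forgetting the last column is an open map, it is surjective
by `exists_posMinors_snocCol`, and its fibres are convex; so a separation upstairs would give one
downstairs. -/
lemma isPreconnected_normalizedTP {p n : ℕ} (hpn : p ≤ n) : IsPreconnected (normalizedTP p n) := by
  induction n, hpn using Nat.le_induction with
  | base =>
    apply Set.Subsingleton.isPreconnected
    rintro A ⟨hA, -⟩ B ⟨hB, -⟩
    ext a b
    rw [hA a b b.isLt, hB a b b.isLt]
  | succ n hpn ih =>
    obtain _ | p := p
    · apply Set.Subsingleton.isPreconnected
      intro A _ B _
      ext a; exact a.elim0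
    have hnorm : ∀ (B : Matrix (Fin (p + 1)) (Fin n) ℝ) c, snocCol B c ∈ normalizedTP (p + 1) (n + 1) ↔
        B ∈ normalizedTP (p + 1) n ∧ ∀ s, StrictMono s → 0 < lastColMinor B s c := by
      intro B c
      simp only [normalizedTP, Set.mem_ofPred_eq, posMinors_snocCol_iff, and_assoc]
      refine and_congr_left fun _ => ?_
      constructor
      · intro h a b hb
        rw [← h a b (by omega), ← snocCol_castSucc B c]; rfl
      · intro h a b hb
        rw [← h a b (by omega), ← snocCol_castSucc B c]; rfl
    have hfib : ∀ B, IsPreconnected {c | snocCol B c ∈ normalizedTP (p + 1) (n + 1)} := by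
      intro B
      apply Convex.isPreconnected
      intro c hc d hd α β hα hβ hαβ
      simp only [Set.mem_ofPred_eq, hnorm] at hc hd ⊢
      refine ⟨hc.1, fun s hs => ?_⟩
      have h1 := hc.2 s hs
      have h2 := hd.2 s hs
      rw [map_add, map_smul, map_smul, smul_eq_mul, smul_eq_mul]
      rcases hα.eq_or_lt with rfl | hα
      · have : β = 1 := by linarith
        subst this; simpa using h2
      · have := mul_pos hα h1
        have := mul_nonneg hβ h2.le
        linarith
    intro u v hu hv huv ⟨A, hA, hAu⟩ ⟨B, hB, hBv⟩
    -- The projection imposes positivity but not normalization, so that it sends open sets to open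
    -- sets of all matrices.
    let proj : Set (Matrix (Fin (p + 1)) (Fin (n + 1)) ℝ) → Set (Matrix (Fin (p + 1)) (Fin n) ℝ) :=
      fun w => {B | ∃ c, snocCol B c ∈ w ∩ {A | PosMinors 1 A}}
    have hproj : ∀ w, IsOpen w → IsOpen (proj w) := by
      intro w hw
      have : proj w = ⋃ c, (fun B => snocCol B c) ⁻¹' (w ∩ {A | PosMinors 1 A}) := by
        ext B; simp [proj]
      rw [this]
      exact isOpen_iUnion fun c => (hw.inter (isOpen_posMinors _ _ _)).preimage
        (continuous_snocCol_left c)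
    obtain ⟨A', a, rfl⟩ := exists_eq_snocCol A
    obtain ⟨B', b, rfl⟩ := exists_eq_snocCol B
    obtain ⟨C, hC, ⟨c, hcu, hcp⟩, d, hdv, hdp⟩ := ih (proj u) (proj v) (hproj u hu) (hproj v hv)
      (by
        intro C hC
        obtain ⟨c, hc⟩ := exists_posMinors_snocCol hpn hC.2
        have hc' : snocCol C c ∈ normalizedTP (p + 1) (n + 1) :=
          (hnorm _ _).2 ⟨hC, (posMinors_snocCol_iff.1 hc).2⟩
        rcases huv hc' with h | h
        · exact Or.inl ⟨c, h, hc⟩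
        · exact Or.inr ⟨c, h, hc⟩)
      ⟨A', ((hnorm _ _).1 hA).1, a, hAu, hA.2⟩ ⟨B', ((hnorm _ _).1 hB).1, b, hBv, hB.2⟩
    -- Both projections contain `C`, and the connected fibre over `C` meets `u` and `v`, hence their
    -- intersection.
    have hfc := hfib C ((fun c => snocCol C c) ⁻¹' u) ((fun c => snocCol C c) ⁻¹' v)
      (hu.preimage (continuous_snocCol_right C)) (hv.preimage (continuous_snocCol_right C))
      (fun c hc => huv hc)
      ⟨c, (hnorm _ _).2 ⟨hC, (posMinors_snocCol_iff.1 hcp).2⟩, hcu⟩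
      ⟨d, (hnorm _ _).2 ⟨hC, (posMinors_snocCol_iff.1 hdp).2⟩, hdv⟩
    obtain ⟨x, hx, hxu, hxv⟩ := hfc
    exact ⟨snocCol C x, hx, hxu, hxv⟩

end Amplituhedron

namespace Amplituhedron
open Matrix Equiv Filter Topology

/-! ## Kernels of totally positive matrices -/

lemma vdm_append {k m n : ℕ} (t : Fin k → Fin n) (u : Fin m → Fin n) :
    vdm (Fin.append t u) =
      vdm t * vdm u * ∏ a, ∏ b, (((u b : ℕ) : ℝ) - ((t a : ℕ) : ℝ)) := by
  have h : ∀ {k : ℕ} (t : Fin k → Fin n), vdm t =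
      ∏ i, ∏ j, if i < j then (((t j : ℕ) : ℝ) - ((t i : ℕ) : ℝ)) else 1 := by
    intro k t
    rw [vdm, det_vandermonde]
    refine Finset.prod_congr rfl fun i _ => ?_
    rw [← Finset.prod_filter]
    refine Finset.prod_congr ?_ fun _ _ => rfl
    ext; simp
  have h1 : ∀ (a : Fin k) (b : Fin m), Fin.castAdd m a < Fin.natAdd k b := fun a b => by
    rw [Fin.lt_def]; simp; omega
  have h2 : ∀ (a : Fin k) (b : Fin m), ¬ Fin.natAdd k b < Fin.castAdd m a := fun a b =>
    (h1 a b).not_gt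
  have h3 : ∀ a b : Fin k, Fin.castAdd m a < Fin.castAdd m b ↔ a < b := fun a b => by
    rw [Fin.lt_def, Fin.lt_def]; simp
  have h4 : ∀ a b : Fin m, Fin.natAdd k a < Fin.natAdd k b ↔ a < b := fun a b => by
    rw [Fin.lt_def, Fin.lt_def]; simp
  simp only [h, Fin.prod_univ_add, Fin.append_left, Fin.append_right, h1, h2, h3, h4, if_true,
    if_false, Finset.prod_const_one, Finset.prod_mul_distrib]
  ring

lemma detAppend_colv {k m n : ℕ} (Z : Matrix (Fin (k + m)) (Fin n) ℝ) (t : Fin k → Fin n)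
    (y : Fin m → Fin n) :
    detAppend (fun b => colv Z (y b)) (colv Z ∘ t) = tupleMinor Z (Fin.append t y) := by
  rw [detAppend_apply, tupleMinor, ← Matrix.det_transpose]
  congr 1
  ext a b
  refine Fin.addCases (fun b => ?_) (fun b => ?_) b <;> simp

/-- Cauchy–Binet writes the determinant as a sum of minors of `V` on `t` times minors of `Z` on `t`
followed by `y`. The Vandermonde factor of the joined tuple splits off the differences of `y` and
`t`, whose signs are controlled by `ε`. All terms therefore have one sign, and `hr` supplies a
nonzero one. -/
lemma det_append_ne_zero {k m n : ℕ} {e : ℝ} {V : Matrix (Fin k) (Fin n) ℝ}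
    (hV : NonnegMinors e V) (he : e ≠ 0) {Z : Matrix (Fin (k + m)) (Fin n) ℝ}
    (hZ : PosMinors 1 Z) {y : Fin m → Fin n} (hy : Function.Injective y) {ε : ℝ}
    (hε : ∀ s, s ∉ Set.range y → 0 < ε * ∏ b, (((y b : ℕ) : ℝ) - (s : ℕ)))
    (hr : ∃ t, tupleMinor V t ≠ 0 ∧ ∀ a, t a ∉ Set.range y) :
    detAppend (fun b => colv Z (y b)) (fun a => ∑ j, V a j • colv Z j) ≠ 0 := by
  intro h0
  have h1 := alternatingMap_sum (detAppend fun b => colv Z (y b)) V (colv Z)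
  simp only [h0, mul_zero, detAppend_colv] at h1
  set K : ℝ := e * ε ^ k * vdm y
  have key : ∀ t, (tupleMinor V t ≠ 0 ∧ ∀ a, t a ∉ Set.range y) →
      0 < K * (tupleMinor V t * tupleMinor Z (Fin.append t y)) := by
    rintro t ⟨h2, h3⟩
    have hinj : Function.Injective t := by
      by_contra h; exact h2 (tupleMinor_eq_zero V h)
    have hinj' : Function.Injective (Fin.append t y) := by
      rw [Fin.append_injective_iff]
      exact ⟨hinj, hy, fun a b h => h3 a ⟨b, h.symm⟩⟩
    have hv := vdm_ne_zero_iff.2 hinj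
    have p1 := (hV t).lt_of_ne' (mul_ne_zero he (mul_ne_zero h2 hv))
    have p2 := hZ _ hinj'
    rw [vdm_append, one_mul] at p2
    have p3 : 0 < ∏ a, (ε * ∏ b, (((y b : ℕ) : ℝ) - ((t a : ℕ) : ℝ))) :=
      Finset.prod_pos fun a _ => hε _ (h3 a)
    rw [Finset.prod_mul_distrib, Finset.prod_const, Finset.card_univ, Fintype.card_fin] at p3
    have p4 := mul_pos (mul_pos p1 p2) p3
    set Q := ∏ a, ∏ b, (((y b : ℕ) : ℝ) - ((t a : ℕ) : ℝ))
    have e1 : e * (tupleMinor V t * vdm t) *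
        (tupleMinor Z (Fin.append t y) * (vdm t * vdm y * Q)) * (ε ^ k * Q) =
        K * (tupleMinor V t * tupleMinor Z (Fin.append t y)) * (vdm t * Q) ^ 2 := by
      simp only [K]; ring
    rw [e1] at p4
    refine (pos_iff_pos_of_mul_pos p4).2 (lt_of_le_of_ne (sq_nonneg _) ?_)
    intro h; rw [← h] at p4; simp at p4
  have hnn : ∀ t, 0 ≤ K * (tupleMinor V t * tupleMinor Z (Fin.append t y)) := by
    intro t
    by_cases h : tupleMinor V t ≠ 0 ∧ ∀ a, t a ∉ Set.range y
    · exact (key t h).le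
    · rw [not_and_or] at h
      rcases h with h | h
      · rw [not_not.1 h]; simp
      · push Not at h
        obtain ⟨a, b, hab⟩ := h
        rw [tupleMinor_eq_zero Z (t := Fin.append t y)]
        · simp
        · rw [Fin.append_injective_iff]
          rintro ⟨-, -, h⟩
          exact h a b hab.symm
  obtain ⟨t0, ht0⟩ := hr
  have : 0 < ∑ t, K * (tupleMinor V t * tupleMinor Z (Fin.append t y)) :=
    Finset.sum_pos' (fun t _ => hnn t) ⟨t0, Finset.mem_univ _, key t0 ht0⟩
  rw [← Finset.mul_sum, ← h1, mul_zero] at this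
  exact lt_irrefl _ this

lemma eq_zero_of_detAppend_ne_zero {k m : ℕ} {y : Fin m → Fin (k + m) → ℝ}
    {x : Fin k → Fin (k + m) → ℝ} (h : detAppend y x ≠ 0) {φ : Fin k → ℝ} {η : Fin m → ℝ}
    (h0 : ∑ a, φ a • x a + ∑ b, η b • y b = 0) : φ = 0 ∧ η = 0 := by
  rw [detAppend_apply, ne_eq, ← Matrix.exists_vecMul_eq_zero_iff] at h
  push Not at h
  have h1 : Fin.append φ η = 0 := by
    by_contra hne
    apply h _ hne
    rw [← h0]
    ext c
    simp [Matrix.vecMul, dotProduct, Fin.sum_univ_add, Finset.sum_apply]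
  constructor
  · ext a; simpa using congrFun h1 (Fin.castAdd m a)
  · ext b; simpa using congrFun h1 (Fin.natAdd k b)

/-- The rows of `W` are independent and lie in the kernel of `Z`. -/
def IsKernelMatrix {p l n : ℕ} (Z : Matrix (Fin p) (Fin n) ℝ) (W : Matrix (Fin l) (Fin n) ℝ) : Prop :=
  Z * Wᵀ = 0 ∧ ∀ β, β ᵥ* W = 0 → β = 0

lemma IsKernelMatrix.mulVec {p l n : ℕ} {Z : Matrix (Fin p) (Fin n) ℝ}
    {W : Matrix (Fin l) (Fin n) ℝ} (h : IsKernelMatrix Z W) (β : Fin l → ℝ) :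
    Z *ᵥ (β ᵥ* W) = 0 := by
  rw [← Matrix.mulVec_transpose, Matrix.mulVec_mulVec, h.1, Matrix.zero_mulVec]

lemma mulVec_vecMul_eq_sum {k p n : ℕ} (Z : Matrix (Fin p) (Fin n) ℝ)
    (V : Matrix (Fin k) (Fin n) ℝ) (φ : Fin k → ℝ) :
    Z *ᵥ (φ ᵥ* V) = ∑ a, φ a • ∑ j, V a j • colv Z j := by
  ext c
  simp only [Matrix.mulVec, Matrix.vecMul, dotProduct, Finset.sum_apply, Pi.smul_apply,
    smul_eq_mul, Finset.mul_sum, colv]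
  rw [Finset.sum_comm]
  refine Finset.sum_congr rfl fun a _ => Finset.sum_congr rfl fun j _ => by ring

lemma mulVec_eq_sum_of_support {p n m : ℕ} (Z : Matrix (Fin p) (Fin n) ℝ) {x : Fin n → ℝ}
    {y : Fin m → Fin n} (hy : Function.Injective y) (hx : ∀ c, c ∉ Set.range y → x c = 0) :
    Z *ᵥ x = ∑ b, x (y b) • colv Z (y b) := by
  ext c
  simp only [Matrix.mulVec, dotProduct, Finset.sum_apply, Pi.smul_apply, smul_eq_mul, colv]
  rw [← Finset.sum_image (s := Finset.univ) (g := y) (f := fun j => x j * Z c j)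
    (fun a _ b _ h => hy h)]
  symm
  rw [Finset.sum_subset (Finset.subset_univ _)]
  · exact Finset.sum_congr rfl fun j _ => mul_comm _ _
  · intro j _ hj
    rw [hx j, zero_mul]
    rintro ⟨b, rfl⟩
    exact hj (Finset.mem_image_of_mem _ (Finset.mem_univ _))

/-- Applying `Z` kills the part from `W`. If the combination is supported on `y`, its image is both
a combination of the rows of `V * Zᵀ` and of the columns of `Z` at `y`. These vectors are
independent by `det_append_ne_zero`. -/
lemma stacked_eq_zero_of_vanish {k m l n : ℕ} {e : ℝ} {V : Matrix (Fin k) (Fin n) ℝ}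
    (hV : NonnegMinors e V) (he : e ≠ 0) {Z : Matrix (Fin (k + m)) (Fin n) ℝ}
    (hZ : PosMinors 1 Z) {W : Matrix (Fin l) (Fin n) ℝ} (hW : IsKernelMatrix Z W)
    {y : Fin m → Fin n} (hy : Function.Injective y) {ε : ℝ}
    (hε : ∀ s, s ∉ Set.range y → 0 < ε * ∏ b, (((y b : ℕ) : ℝ) - (s : ℕ)))
    (hr : ∃ t, tupleMinor V t ≠ 0 ∧ ∀ a, t a ∉ Set.range y)
    {φ : Fin k → ℝ} {β : Fin l → ℝ}
    (h0 : ∀ c, c ∉ Set.range y → (φ ᵥ* V + β ᵥ* W) c = 0) : φ = 0 ∧ β = 0 := by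
  have h1 := det_append_ne_zero hV he hZ hy hε hr
  set x := φ ᵥ* V + β ᵥ* W with hx
  have h2 : Z *ᵥ x = ∑ a, φ a • ∑ j, V a j • colv Z j := by
    rw [hx, Matrix.mulVec_add, hW.mulVec, add_zero, mulVec_vecMul_eq_sum]
  have h3 := mulVec_eq_sum_of_support Z hy h0
  rw [h2] at h3
  have h4 : ∑ a, φ a • (fun a => ∑ j, V a j • colv Z j) a +
      ∑ b, (-(x ∘ y)) b • (fun b => colv Z (y b)) b = 0 := by
    simp only [h3, Pi.neg_apply, neg_smul, Finset.sum_neg_distrib, Function.comp_apply]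
    exact add_neg_cancel _
  obtain ⟨h5, h6⟩ := eq_zero_of_detAppend_ne_zero h1 h4
  refine ⟨h5, hW.2 β ?_⟩
  have h7 : x = β ᵥ* W := by rw [hx, h5]; simp
  rw [← h7]
  ext c
  by_cases hc : c ∈ Set.range y
  · obtain ⟨b, rfl⟩ := hc
    have := congrFun h6 b
    simpa using this
  · exact h0 c hc

lemma PosMinors.eq_zero_of_vecMul {k n : ℕ} (hkn : k ≤ n) {e : ℝ} {A : Matrix (Fin k) (Fin n) ℝ}
    (h : PosMinors e A) {φ : Fin k → ℝ} (h0 : φ ᵥ* A = 0) : φ = 0 := by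
  have h1 := h.tupleMinor_ne_zero (Fin.castLE_injective hkn)
  rw [tupleMinor_ne_zero_iff] at h1
  exact h1 φ fun a => congrFun h0 _

/-- A totally positive matrix is injective on totally nonnegative subspaces. -/
lemma injective_of_nonnegMinors {k m n : ℕ} (hn : k + m ≤ n) {e : ℝ}
    {V : Matrix (Fin k) (Fin n) ℝ} (hV : NonnegMinors e V) (he : e ≠ 0)
    (hr : ∃ t, tupleMinor V t ≠ 0) {Z : Matrix (Fin (k + m)) (Fin n) ℝ} (hZ : PosMinors 1 Z)
    {φ : Fin k → ℝ} (h0 : Z *ᵥ (φ ᵥ* V) = 0) : φ = 0 := by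
  -- Append `m` columns to `Z` and zero columns to `V`. The appended columns lie to the right of all
  -- others, so the sign condition holds with `ε = 1`, whatever the parity of `m`.
  obtain ⟨Z', hZ', hext⟩ := exists_posMinors_extend hn hZ m
  let V' : Matrix (Fin k) (Fin (n + m)) ℝ := Matrix.of fun a => Fin.append (V a) 0
  have hV'l : ∀ a j, V' a (Fin.castAdd m j) = V a j := fun a j => by simp [V']
  have hV'r : ∀ a j, V' a (Fin.natAdd n j) = 0 := fun a j => by simp [V']
  have hminor : ∀ t : Fin k → Fin n, tupleMinor V' (Fin.castAdd m ∘ t) = tupleMinor V t := by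
    intro t
    rw [tupleMinor, tupleMinor]; congr 1
    ext a b; simp [hV'l]
  have hV'nn : NonnegMinors e V' := by
    intro t
    by_cases ht : ∃ s, t = Fin.castAdd m ∘ s
    · obtain ⟨s, rfl⟩ := ht
      rw [hminor]
      exact hV s
    · have : ∃ a j, t a = Fin.natAdd n j := by
        by_contra hcon
        push Not at hcon
        apply ht
        have : ∀ a, ∃ j, t a = Fin.castAdd m j := by
          intro a
          generalize hx : t a = x
          induction x using Fin.addCases with
          | left i => exact ⟨i, rfl⟩
          | right i => exact absurd hx (hcon a i)
        choose s hs using this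
        exact ⟨s, funext hs⟩
      obtain ⟨a, j, haj⟩ := this
      have h1 : tupleMinor V' t = 0 :=
        Matrix.det_eq_zero_of_column_eq_zero a fun i => by simp [haj, hV'r]
      simp [h1]
  obtain ⟨t0, ht0⟩ := hr
  have hne : ∀ (j : Fin n) (b : Fin m), Fin.natAdd n b ≠ Fin.castAdd m j := fun j b h => by
    have := congrArg Fin.val h; simp at this; omega
  have h1 := det_append_ne_zero (y := fun b : Fin m => Fin.natAdd n b) (ε := 1) hV'nn he hZ'
    (fun a b h => by simpa using h)
    (fun s hs => by
      rw [one_mul]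
      refine Finset.prod_pos fun b _ => ?_
      induction s using Fin.addCases with
      | left j =>
        have : ((j : ℕ) : ℝ) < ((n + b : ℕ) : ℝ) := by
          exact_mod_cast lt_of_lt_of_le j.isLt (Nat.le_add_right n b)
        simpa using this
      | right j => exact absurd ⟨j, rfl⟩ hs)
    ⟨Fin.castAdd m ∘ t0, by rw [hminor]; exact ht0, fun a => by
      rintro ⟨b, hb⟩; exact hne _ _ hb⟩
  refine (eq_zero_of_detAppend_ne_zero h1 (φ := φ) (η := 0) ?_).1
  rw [mulVec_vecMul_eq_sum] at h0
  simp only [Pi.zero_apply, zero_smul, Finset.sum_const_zero, add_zero]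
  rw [← h0]
  refine Finset.sum_congr rfl fun a _ => ?_
  rw [Fin.sum_univ_add]
  simp only [hV'l, hV'r, zero_smul, Finset.sum_const_zero, add_zero]
  congr 1
  refine Finset.sum_congr rfl fun j _ => ?_
  congr 1
  ext c; exact hext c j

lemma exists_complement_tuple {l n : ℕ} {y : Fin l → Fin n} (hy : Function.Injective y) {p : ℕ}
    (hn : p + l = n) : ∃ t : Fin p → Fin n, Function.Injective t ∧ (∀ a, t a ∉ Set.range y) ∧
      ∀ c, c ∈ Set.range t ∨ c ∈ Set.range y := by
  classical
  have hcard : ((Finset.univ.image y)ᶜ).card = p := by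
    rw [Finset.card_compl, Finset.card_image_of_injective _ hy]; simp; omega
  have hmem : ∀ c, c ∈ Set.range (((Finset.univ.image y)ᶜ).orderEmbOfFin hcard) ↔
      c ∉ Set.range y := by
    intro c
    rw [Finset.range_orderEmbOfFin]; simp
  refine ⟨((Finset.univ.image y)ᶜ).orderEmbOfFin hcard, (Finset.orderEmbOfFin _ hcard).injective,
    fun a => (hmem _).1 ⟨a, rfl⟩, fun c => ?_⟩
  rw [hmem]
  exact (em _).symm

/-- A vector in the kernel of a totally positive matrix that vanishes at sufficiently many places
is zero. -/
lemma PosMinors.eq_zero_of_mulVec {p l n : ℕ} (hn : p + l = n) {Z : Matrix (Fin p) (Fin n) ℝ}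
    (hZ : PosMinors 1 Z) {x : Fin n → ℝ} (hx : Z *ᵥ x = 0) {y : Fin l → Fin n}
    (hy : Function.Injective y) (h0 : ∀ b, x (y b) = 0) : x = 0 := by
  obtain ⟨t, ht, -, hcov⟩ := exists_complement_tuple hy hn
  have hsupp : ∀ c, c ∉ Set.range t → x c = 0 := by
    intro c hc
    obtain ⟨b, rfl⟩ := (hcov c).resolve_left hc
    exact h0 b
  have h1 := mulVec_eq_sum_of_support Z ht hsupp
  rw [hx] at h1
  have h2 := hZ.tupleMinor_ne_zero ht
  rw [tupleMinor, ne_eq, ← Matrix.exists_mulVec_eq_zero_iff] at h2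
  push Not at h2
  have h3 : x ∘ t = 0 := by
    by_contra hne
    apply h2 _ hne
    rw [h1]
    ext c
    simp [Matrix.mulVec, dotProduct, Finset.sum_apply, mul_comm]
  ext c
  by_cases hc : c ∈ Set.range t
  · obtain ⟨a, rfl⟩ := hc
    exact congrFun h3 a
  · exact hsupp c hc

/-- Any `l` columns of a kernel matrix of a totally positive matrix are independent. -/
lemma IsKernelMatrix.eq_zero_of_vanish {p l n : ℕ} (hn : p + l = n) {Z : Matrix (Fin p) (Fin n) ℝ}
    {W : Matrix (Fin l) (Fin n) ℝ} (h : IsKernelMatrix Z W) (hZ : PosMinors 1 Z) {y : Fin l → Fin n}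
    (hy : Function.Injective y) {β : Fin l → ℝ} (h0 : ∀ b, (β ᵥ* W) (y b) = 0) : β = 0 :=
  h.2 β (hZ.eq_zero_of_mulVec hn (h.mulVec β) hy h0)

/-! ## Duality -/

/-- The matrix with the sign of every second column changed. -/
def altSign {k n : ℕ} (A : Matrix (Fin k) (Fin n) ℝ) : Matrix (Fin k) (Fin n) ℝ :=
  Matrix.of fun a j => (-1) ^ (j : ℕ) * A a j

@[simp] lemma altSign_apply {k n : ℕ} (A : Matrix (Fin k) (Fin n) ℝ) (a : Fin k) (j : Fin n) :
    altSign A a j = (-1) ^ (j : ℕ) * A a j := rfl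

@[simp] lemma altSign_altSign {k n : ℕ} (A : Matrix (Fin k) (Fin n) ℝ) : altSign (altSign A) = A := by
  ext a j
  simp [← mul_assoc, ← mul_pow]

lemma tupleMinor_altSign {k n : ℕ} (A : Matrix (Fin k) (Fin n) ℝ) (t : Fin k → Fin n) :
    tupleMinor (altSign A) t = (∏ a, (-1) ^ (t a : ℕ)) * tupleMinor A t :=
  Matrix.det_mul_row (fun b => (-1) ^ (t b : ℕ)) (A.submatrix id t)

/-- The determinant of the rows of `[Zᵀ | Wᵀ]` in the order given by `τ`. -/
noncomputable def stackDet {p l n : ℕ} (Z : Matrix (Fin p) (Fin n) ℝ) (W : Matrix (Fin l) (Fin n) ℝ)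
    (τ : Fin p ⊕ Fin l ≃ Fin n) : ℝ :=
  ((Matrix.fromCols Zᵀ Wᵀ).submatrix τ id).det

lemma stackDet_eq {p l n : ℕ} (Z : Matrix (Fin p) (Fin n) ℝ) (W : Matrix (Fin l) (Fin n) ℝ)
    (τ τ' : Fin p ⊕ Fin l ≃ Fin n) :
    stackDet Z W τ = (Perm.sign (τ.trans τ'.symm) : ℝ) * stackDet Z W τ' := by
  have := Matrix.det_permute (τ.trans τ'.symm) ((Matrix.fromCols Zᵀ Wᵀ).submatrix τ' id)
  rw [stackDet, stackDet, ← this]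
  congr 1
  ext a b
  simp

/-- This relates complementary minors of a matrix and of its kernel. Orthogonality makes the
displayed product of block matrices block lower triangular; compare determinants. -/
lemma tupleMinor_mul_stackDet {p l n : ℕ} {Z : Matrix (Fin p) (Fin n) ℝ}
    {W : Matrix (Fin l) (Fin n) ℝ} (h : Z * Wᵀ = 0) (τ : Fin p ⊕ Fin l ≃ Fin n) :
    tupleMinor Z (τ ∘ Sum.inl) * stackDet Z W τ =
      (Z * Zᵀ).det * tupleMinor W (τ ∘ Sum.inr) := by
  have h1 : fromBlocks (Z.submatrix id (τ ∘ Sum.inl)) (Z.submatrix id (τ ∘ Sum.inr)) 0 1 *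
      (Matrix.fromCols Zᵀ Wᵀ).submatrix τ id =
      fromBlocks (Z * Zᵀ) 0 (Zᵀ.submatrix (τ ∘ Sum.inr) id) (Wᵀ.submatrix (τ ∘ Sum.inr) id) := by
    have hs : ∀ f : Fin n → ℝ, ∑ a, f (τ (Sum.inl a)) + ∑ b, f (τ (Sum.inr b)) = ∑ c, f c := by
      intro f
      rw [← Equiv.sum_comp τ, Fintype.sum_sum_type]
    ext i j
    rcases i with i | i <;> rcases j with j | j
    · simp only [Matrix.mul_apply, Fintype.sum_sum_type, fromBlocks_apply₁₁, fromBlocks_apply₁₂,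
        submatrix_apply, id_eq, Function.comp_apply, fromCols_apply_inl, transpose_apply]
      exact hs fun c => Z i c * Z j c
    · simp only [Matrix.mul_apply, Fintype.sum_sum_type, fromBlocks_apply₁₁, fromBlocks_apply₁₂,
        submatrix_apply, id_eq, Function.comp_apply, fromCols_apply_inr, transpose_apply,
        Matrix.zero_apply]
      rw [hs fun c => Z i c * W j c]
      exact congrFun (congrFun h i) j
    · simp [Matrix.mul_apply, Fintype.sum_sum_type, Matrix.one_apply]
    · simp [Matrix.mul_apply, Fintype.sum_sum_type, Matrix.one_apply]
  have h2 := congrArg Matrix.det h1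
  rw [Matrix.det_mul, det_fromBlocks_zero₂₁, det_fromBlocks_zero₁₂, Matrix.det_one, mul_one] at h2
  rw [tupleMinor, stackDet, h2, tupleMinor, ← Matrix.det_transpose (W.submatrix _ _)]
  rfl

lemma det_mul_transpose_ne_zero {p n : ℕ} {Z : Matrix (Fin p) (Fin n) ℝ}
    (h : ∀ φ, φ ᵥ* Z = 0 → φ = 0) : (Z * Zᵀ).det ≠ 0 := by
  rw [ne_eq, ← Matrix.exists_vecMul_eq_zero_iff]
  rintro ⟨φ, h0, h1⟩
  apply h0
  apply h
  rw [← Matrix.vecMul_vecMul, Matrix.vecMul_transpose] at h1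
  have h2 : (φ ᵥ* Z) ⬝ᵥ (φ ᵥ* Z) = 0 := by
    rw [← Matrix.dotProduct_mulVec, h1, dotProduct_zero]
  exact dotProduct_self_eq_zero.1 h2

lemma exists_posMinors_one {k n : ℕ} {e : ℝ} {A : Matrix (Fin k) (Fin n) ℝ} (h : PosMinors e A) :
    ∃ g : Matrix (Fin k) (Fin k) ℝ, PosMinors 1 (g * A) ∧ (e ≠ 0 → g.det ≠ 0) := by
  obtain _ | k := k
  · exact ⟨1, fun t _ => by simp [tupleMinor, vdm], fun _ => by simp⟩
  · refine ⟨Matrix.diagonal (Function.update 1 0 e), fun t ht => ?_, fun he => ?_⟩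
    · rw [tupleMinor_mul, Matrix.det_diagonal, Finset.prod_update_of_mem (Finset.mem_univ _)]
      simp only [Pi.one_apply, Finset.prod_const_one, mul_one, one_mul, mul_assoc]
      exact h t ht
    · rw [Matrix.det_diagonal, Finset.prod_update_of_mem (Finset.mem_univ _)]
      simpa using he

/-- The `N`-th finite difference of a polynomial of degree less than `N` vanishes. -/
lemma sum_alternating_choose_pow {N j : ℕ} (h : j < N) :
    ∑ i ∈ Finset.range (N + 1), (-1 : ℝ) ^ i * N.choose i * (i : ℝ) ^ j = 0 := by
  have h1 := congrFun (fwdDiff_iter_pow_eq_zero_of_lt (R := ℝ) h) 0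
  rw [fwdDiff_iter_eq_sum_shift] at h1
  have h2 : ∑ i ∈ Finset.range (N + 1), (-1 : ℝ) ^ i * N.choose i * (i : ℝ) ^ j =
      (-1) ^ N * ∑ x ∈ Finset.range (N + 1),
        ((-1 : ℤ) ^ (N - x) * (N.choose x : ℤ)) • ((0 : ℝ) + x • (1 : ℝ)) ^ j := by
    rw [Finset.mul_sum]
    refine Finset.sum_congr rfl fun i hi => ?_
    have hi' : i ≤ N := Nat.lt_succ_iff.1 (Finset.mem_range.1 hi)
    obtain ⟨d, rfl⟩ := Nat.exists_eq_add_of_le hi'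
    simp only [Nat.add_sub_cancel_left, zsmul_eq_mul, nsmul_eq_mul, mul_one, zero_add]
    push_cast
    have : ((-1 : ℝ) ^ d) * (-1) ^ d = 1 := by rw [← mul_pow]; simp
    rw [pow_add]
    linear_combination (-(-1 : ℝ) ^ i * ((i + d).choose i : ℝ) * (i : ℝ) ^ j) * this
  rw [h2, h1]; simp

/-- If `xi` is totally positive, then the orthogonal complement of `altSign xi` is spanned by a
totally positive matrix. -/
theorem exists_posMinors_orthogonal {p l n : ℕ} (hn : p + l = n) {e : ℝ}
    {ξ : Matrix (Fin l) (Fin n) ℝ} (hξ : PosMinors e ξ) :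
    ∃ Z : Matrix (Fin p) (Fin n) ℝ, PosMinors 1 Z ∧ IsKernelMatrix Z (altSign ξ) := by
  have hli : ∀ β, β ᵥ* altSign ξ = 0 → β = 0 := by
    intro β h
    apply hξ.eq_zero_of_vecMul (by omega)
    ext j
    have h1 := congrFun h j
    have h2 : (β ᵥ* altSign ξ) j = (-1) ^ (j : ℕ) * (β ᵥ* ξ) j := by
      simp only [Matrix.vecMul, dotProduct, altSign_apply, Finset.mul_sum]
      exact Finset.sum_congr rfl fun a _ => by ring
    rw [h2] at h1
    simpa using h1
  -- a matrix with the right row space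
  obtain ⟨Z, hZli, hZW⟩ : ∃ Z : Matrix (Fin p) (Fin n) ℝ, (∀ φ, φ ᵥ* Z = 0 → φ = 0) ∧
      Z * (altSign ξ)ᵀ = 0 := by
    let L := (altSign ξ).mulVecLin
    have hsurj : LinearMap.range L = ⊤ := by
      by_contra hne
      obtain ⟨f, hf0, hf⟩ := Submodule.exists_le_ker_of_lt_top _ (lt_top_iff_ne_top.2 hne)
      obtain ⟨ψ, rfl⟩ := (dotProductEquiv ℝ (Fin l)).surjective f
      apply hf0
      have : ψ = 0 := by
        apply hli
        have h1 : ∀ x, (ψ ᵥ* altSign ξ) ⬝ᵥ x = 0 := by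
          intro x
          rw [← Matrix.dotProduct_mulVec]
          exact hf ⟨x, rfl⟩
        exact dotProduct_self_eq_zero.1 (h1 _)
      simp [this]
    have hdim : Module.finrank ℝ (LinearMap.ker L) = p := by
      have := LinearMap.finrank_range_add_finrank_ker L
      rw [hsurj, finrank_top] at this
      simp only [Module.finrank_fintype_fun_eq_card, Fintype.card_fin] at this
      omega
    let b := (Module.finBasisOfFinrankEq ℝ (LinearMap.ker L) hdim)
    refine ⟨Matrix.of fun a => (b a : Fin n → ℝ), fun φ hφ => ?_, ?_⟩
    · have h1 : ∑ a, φ a • b a = 0 := by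
        apply Subtype.ext
        rw [Submodule.coe_sum]
        ext j
        have := congrFun hφ j
        simpa [Matrix.vecMul, dotProduct, Finset.sum_apply] using this
      ext a
      exact Fintype.linearIndependent_iff.1 b.linearIndependent φ h1 a
    · ext a c
      have := (b a).2
      rw [LinearMap.mem_ker] at this
      have := congrFun this c
      simp only [Matrix.mul_apply, Matrix.transpose_apply, Matrix.of_apply, Matrix.zero_apply]
      refine Eq.trans ?_ this
      simp only [L, Matrix.mulVecLin_apply, Matrix.mulVec, dotProduct]
      exact Finset.sum_congr rfl fun j _ => mul_comm _ _
  -- the reference pair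
  let Z₀ : Matrix (Fin p) (Fin n) ℝ := Matrix.of fun a i => ((i : ℕ) : ℝ) ^ (a : ℕ)
  let ξ₀ : Matrix (Fin l) (Fin n) ℝ :=
    Matrix.of fun b i => ((n - 1).choose i : ℝ) * ((i : ℕ) : ℝ) ^ (b : ℕ)
  have hZ₀ : PosMinors 1 Z₀ := by
    intro t ht
    have h1 : tupleMinor Z₀ t = vdm t := by
      rw [tupleMinor, vdm, ← Matrix.det_transpose]; rfl
    rw [h1, one_mul]
    exact mul_self_pos.2 (vdm_ne_zero_iff.2 ht)
  have hξ₀ : PosMinors 1 ξ₀ := by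
    intro t ht
    have h1 : tupleMinor ξ₀ t = (∏ b, ((n - 1).choose (t b) : ℝ)) * vdm t := by
      rw [vdm, ← Matrix.det_transpose (vandermonde _)]
      exact Matrix.det_mul_row (fun b => ((n - 1).choose (t b) : ℝ))
        (vandermonde fun a => ((t a : ℕ) : ℝ))ᵀ
    rw [h1, one_mul, mul_assoc]
    refine mul_pos (Finset.prod_pos fun b _ => ?_) (mul_self_pos.2 (vdm_ne_zero_iff.2 ht))
    have := (t b).isLt
    exact_mod_cast Nat.choose_pos (by omega)
  -- Each entry is an alternating binomial sum of `i ^ (a + b)` with `a + b ≤ p + l - 2 < n - 1`.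
  have hort : Z₀ * (altSign ξ₀)ᵀ = 0 := by
    ext a b
    simp only [Matrix.mul_apply, Matrix.transpose_apply, altSign_apply, Z₀, ξ₀, Matrix.of_apply,
      Matrix.zero_apply]
    obtain ⟨N, rfl⟩ : ∃ N, n = N + 1 := ⟨n - 1, by have := a.isLt; omega⟩
    have h1 := sum_alternating_choose_pow (N := N) (j := a + b) (by
      have := a.isLt; have := b.isLt; omega)
    rw [← Fin.sum_univ_eq_sum_range (fun i => (-1 : ℝ) ^ i * N.choose i * (i : ℝ) ^ (a + b : ℕ))] at h1
    rw [← h1]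
    refine Finset.sum_congr rfl fun i _ => ?_
    simp only [Nat.add_sub_cancel]
    rw [pow_add]; ring
  have hg := det_mul_transpose_ne_zero hZli
  have hg₀ := det_mul_transpose_ne_zero fun φ h => hZ₀.eq_zero_of_vecMul (by omega) h
  let τ₀ : Fin p ⊕ Fin l ≃ Fin n := finSumFinEquiv.trans (finCongr hn)
  set K : ℝ := e * (Z * Zᵀ).det * (Z₀ * Z₀ᵀ).det * stackDet Z (altSign ξ) τ₀ *
    stackDet Z₀ (altSign ξ₀) τ₀
  -- In the complementary minor identity, the sign of the permutation and the alternating signs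
  -- depend only on `t`, not on the matrices. Multiplying the identities for `Z` and for `Z₀`
  -- cancels them, so the known positivity of the reference pair replaces a sign computation.
  have hpos : PosMinors K Z := by
    intro t ht
    obtain ⟨t', ht', h1, h2⟩ := exists_complement_tuple ht (p := l) (by omega)
    let τ : Fin p ⊕ Fin l ≃ Fin n := Equiv.ofBijective (Sum.elim t t') (by
      constructor
      · exact Function.Injective.sumElim ht ht' fun a b h => h1 b ⟨a, h⟩
      · intro c
        rcases h2 c with ⟨a, ha⟩ | ⟨a, ha⟩
        · exact ⟨Sum.inr a, ha⟩
        · exact ⟨Sum.inl a, ha⟩)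
    have e1 := tupleMinor_mul_stackDet hZW τ
    have e2 := tupleMinor_mul_stackDet hort τ
    rw [stackDet_eq _ _ τ τ₀] at e1 e2
    have hl : τ ∘ Sum.inl = t := rfl
    have hr : τ ∘ Sum.inr = t' := rfl
    rw [hl, hr, tupleMinor_altSign] at e1 e2
    have e3 : (∏ a, (-1 : ℝ) ^ (t' a : ℕ)) * (∏ a, (-1 : ℝ) ^ (t' a : ℕ)) = 1 := by
      rw [← Finset.prod_mul_distrib]
      exact Finset.prod_eq_one fun a _ => by rw [← mul_pow]; simp
    have p1 := hξ t' ht'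
    have p2 := hξ₀ t' ht'
    have p3 := hZ₀ t ht
    have hv := vdm_ne_zero_iff.2 ht
    have hv' := vdm_ne_zero_iff.2 ht'
    set G := (Z * Zᵀ).det
    set G₀ := (Z₀ * Z₀ᵀ).det
    set S := stackDet Z (altSign ξ) τ₀
    set S₀ := stackDet Z₀ (altSign ξ₀) τ₀
    set s : ℝ := ((Perm.sign (τ.trans τ₀.symm) : ℤ) : ℝ)
    set π : ℝ := ∏ a, (-1 : ℝ) ^ (t' a : ℕ)
    have hs : s * s = 1 := by
      simp only [s]
      rcases Int.units_eq_one_or (Perm.sign (τ.trans τ₀.symm)) with h | h <;> simp [h]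
    have e4 : (tupleMinor Z t * S) * (tupleMinor Z₀ t * S₀) =
        G * G₀ * (tupleMinor ξ t' * tupleMinor ξ₀ t') := by
      have : (tupleMinor Z t * (s * S)) * (tupleMinor Z₀ t * (s * S₀)) =
        (G * (π * tupleMinor ξ t')) * (G₀ * (π * tupleMinor ξ₀ t')) := by rw [e1, e2]
      calc _ = (tupleMinor Z t * (s * S)) * (tupleMinor Z₀ t * (s * S₀)) := by
            linear_combination (-(tupleMinor Z t * S) * (tupleMinor Z₀ t * S₀)) * hs
        _ = _ := by
            rw [this]
            linear_combination (G * G₀ * (tupleMinor ξ t' * tupleMinor ξ₀ t')) * e3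
    have p4 : 0 < (e * (tupleMinor ξ t' * vdm t')) * (1 * (tupleMinor ξ₀ t' * vdm t')) *
        (G * G₀) ^ 2 := mul_pos (mul_pos p1 p2) (sq_pos_of_ne_zero (mul_ne_zero hg hg₀))
    have e5 : (e * (tupleMinor ξ t' * vdm t')) * (1 * (tupleMinor ξ₀ t' * vdm t')) *
        (G * G₀) ^ 2 * vdm t ^ 2 =
        (K * (tupleMinor Z t * vdm t)) * (1 * (tupleMinor Z₀ t * vdm t)) * vdm t' ^ 2 := by
      simp only [K]
      linear_combination (-(e * G * G₀ * vdm t' ^ 2 * vdm t ^ 2)) * e4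
    have p5 := mul_pos p4 (sq_pos_of_ne_zero hv)
    rw [e5, mul_assoc] at p5
    exact (pos_iff_pos_of_mul_pos p5).2 (mul_pos p3 (sq_pos_of_ne_zero hv'))
  have hK : K ≠ 0 := by
    intro h0
    have := hpos _ (Fin.castLE_injective (show p ≤ n by omega))
    rw [h0] at this; simp at this
  obtain ⟨g, hg1, hg2⟩ := exists_posMinors_one hpos
  exact ⟨g * Z, hg1, by rw [Matrix.mul_assoc, hZW, Matrix.mul_zero], hli⟩

end Amplituhedron

namespace Amplituhedron
open Matrix Equiv Filter Topology

/-! ## Columns indexed by the integers -/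

/-- The column index of an integer: `t` and `t + n` have the same column, and the column of
`c + 1` is `c`. -/
def idx (n : ℕ) [NeZero n] (t : ℤ) : Fin n :=
  ⟨((t - 1) % n).toNat, by
    have h1 : (n : ℤ) ≠ 0 := by exact_mod_cast NeZero.ne n
    have h2 := Int.emod_nonneg (t - 1) h1
    have h3 := Int.emod_lt_of_pos (t - 1) (b := n) (by have := NeZero.pos n; omega)
    omega⟩

section idx
variable {n : ℕ} [NeZero n]

lemma coe_idx (t : ℤ) : ((idx n t : ℕ) : ℤ) = (t - 1) % n := by
  have h1 : (n : ℤ) ≠ 0 := by exact_mod_cast NeZero.ne n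
  exact Int.toNat_of_nonneg (Int.emod_nonneg (t - 1) h1)

lemma idx_eq_iff {t t' : ℤ} : idx n t = idx n t' ↔ ∃ q : ℤ, t' = t + q * n := by
  rw [Fin.ext_iff, ← Nat.cast_inj (R := ℤ), coe_idx, coe_idx]
  constructor
  · intro h
    obtain ⟨q, hq⟩ := Int.ModEq.dvd (show t - 1 ≡ t' - 1 [ZMOD n] from h)
    exact ⟨q, by linarith⟩
  · rintro ⟨q, rfl⟩
    rw [show t + q * n - 1 = t - 1 + q * n by ring, Int.add_mul_emod_self_right]

@[simp] lemma idx_coe_add_one (c : Fin n) : idx n ((c : ℤ) + 1) = c := by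
  rw [Fin.ext_iff, ← Nat.cast_inj (R := ℤ), coe_idx, add_sub_cancel_right]
  exact Int.emod_eq_of_lt (by positivity) (by exact_mod_cast c.isLt)

lemma idx_add_mul (t q : ℤ) : idx n (t + q * n) = idx n t :=
  (idx_eq_iff.2 ⟨q, rfl⟩).symm

lemma idx_eq_of_lt {t t' : ℤ} (h : idx n t = idx n t') (h1 : t' < t + n) (h2 : t < t' + n) :
    t = t' := by
  obtain ⟨q, rfl⟩ := idx_eq_iff.1 h
  have hn : 0 < (n : ℤ) := by exact_mod_cast NeZero.pos n
  have : q = 0 := by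
    have h3 : q * n < 1 * n := by linarith
    have h4 : (-1) * n < q * n := by linarith
    have := lt_of_mul_lt_mul_right h3 hn.le
    have := lt_of_mul_lt_mul_right h4 hn.le
    omega
  simp [this]

lemma exists_idx_window (c : Fin n) (i : ℤ) : ∃ t, i ≤ t ∧ t < i + n ∧ idx n t = c := by
  have hn : 0 < (n : ℤ) := by exact_mod_cast NeZero.pos n
  refine ⟨i + ((c : ℤ) + 1 - i) % n, ?_, ?_, ?_⟩
  · have := Int.emod_nonneg ((c : ℤ) + 1 - i) hn.ne'; omega
  · have := Int.emod_lt_of_pos ((c : ℤ) + 1 - i) hn; omega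
  · conv_rhs => rw [← idx_coe_add_one c]
    rw [idx_eq_iff]
    refine ⟨((c : ℤ) + 1 - i) / n, ?_⟩
    have := Int.emod_add_mul_ediv ((c : ℤ) + 1 - i) n
    linarith

/-- The column at an integer position. -/
abbrev ucol {ι : Type*} (U : Matrix ι (Fin n) ℝ) (t : ℤ) : ι → ℝ := colv U (idx n t)

/-- The rank of the columns at the positions in `[i, b)`. -/
noncomputable def ivlRank {ι : Type*} (A : Matrix ι (Fin n) ℝ) (i b : ℤ) : ℕ :=
  Module.finrank ℝ (Submodule.span ℝ (ucol A '' Set.Ico i b))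

/-- The columns of every cyclic window of length `r` span. -/
def Nondeg {ι : Type*} [Fintype ι] (r : ℕ) (U : Matrix ι (Fin n) ℝ) : Prop :=
  ∀ (j : ℤ) (φ : ι → ℝ), (∀ t, j ≤ t → t < j + r → φ ⬝ᵥ ucol U t = 0) → φ = 0

/-- The columns of `T` are normal to windows of columns of `U`. -/
def IsTwist {ι : Type*} [Fintype ι] (k l : ℕ) (U T : Matrix ι (Fin n) ℝ) : Prop :=
  (∀ j t : ℤ, j - l < t → t < j + k → ucol T j ⬝ᵥ ucol U t = 0) ∧ ∀ j, ucol T j ≠ 0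

variable {ι : Type*}

/-- The matrix formed by the window of `r` columns that starts at position `i`. -/
def windowMatrix {r : ℕ} (e : ι ≃ Fin r) (U : Matrix ι (Fin n) ℝ) (i : ℤ) : Matrix ι ι ℝ :=
  Matrix.of fun a c => ucol U (i + (e c : ℕ)) a

lemma windowMatrix_congr {r : ℕ} (e : ι ≃ Fin r) (U : Matrix ι (Fin n) ℝ) {i j : ℤ}
    (h : idx n i = idx n j) : windowMatrix e U i = windowMatrix e U j := by
  obtain ⟨q, rfl⟩ := idx_eq_iff.1 h
  ext a c
  simp only [windowMatrix, Matrix.of_apply]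
  rw [show i + q * n + (e c : ℕ) = i + (e c : ℕ) + q * n by ring]
  simp only [ucol, idx_add_mul]

variable [Fintype ι]

lemma dotProduct_eq_zero_of_mem_span {S : Set (ι → ℝ)} {φ q : ι → ℝ}
    (h : ∀ v ∈ S, φ ⬝ᵥ v = 0) (hq : q ∈ Submodule.span ℝ S) : φ ⬝ᵥ q = 0 := by
  have : Submodule.span ℝ S ≤ LinearMap.ker (dotProductBilin ℝ ℝ φ) := by
    rw [Submodule.span_le]
    exact fun v hv => h v hv
  exact this hq

lemma span_eq_top_of_dotProduct {S : Set (ι → ℝ)}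
    (h : ∀ φ : ι → ℝ, (∀ v ∈ S, φ ⬝ᵥ v = 0) → φ = 0) : Submodule.span ℝ S = ⊤ := by
  classical
  by_contra hne
  obtain ⟨f, hf0, hf⟩ := Submodule.exists_le_ker_of_lt_top _ (lt_top_iff_ne_top.2 hne)
  obtain ⟨ψ, rfl⟩ := (dotProductEquiv ℝ ι).surjective f
  apply hf0
  rw [h ψ fun v hv => hf (Submodule.subset_span hv)]
  simp

lemma Nondeg.span_eq_top {r : ℕ} {U : Matrix ι (Fin n) ℝ} (h : Nondeg r U) (j : ℤ) :
    Submodule.span ℝ (ucol U '' Set.Ico j (j + r)) = ⊤ :=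
  span_eq_top_of_dotProduct fun φ hφ => h j φ fun t h1 h2 => hφ _ ⟨t, ⟨h1, h2⟩, rfl⟩

/-- Column `j` of `T` is normal to all but the first column of the window of `U` starting at `j -
l`. That window spans, so a zero pairing would force the column to vanish. -/
lemma IsTwist.ne_zero {k l : ℕ} {U T : Matrix ι (Fin n) ℝ} (hU : Nondeg (k + l) U)
    (h : IsTwist k l U T) (j : ℤ) : ucol T j ⬝ᵥ ucol U (j - l) ≠ 0 := by
  intro h0
  apply h.2 j
  refine hU (j - l) _ fun t h1 h2 => ?_
  rcases h1.eq_or_lt with rfl | h1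
  · exact h0
  · exact h.1 j t h1 (by push_cast at h2; linarith)

/-- The vectors normal to an interval of columns of `T` are spanned by the complementary part of a
window of columns of `U`. -/
lemma IsTwist.mem_span {k l : ℕ} {U T : Matrix ι (Fin n) ℝ} (hU : Nondeg (k + l) U)
    (h : IsTwist k l U T) (i : ℤ) {s : ℕ} (hs : s ≤ k + l) {q : ι → ℝ}
    (hq : ∀ j, i ≤ j → j < i + s → ucol T j ⬝ᵥ q = 0) :
    q ∈ Submodule.span ℝ (ucol U '' Set.Ico (i - l + s) (i + k)) := by
  induction s with
  | zero =>
    have := hU.span_eq_top (i - l)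
    rw [show i - (l : ℤ) + ((k + l : ℕ) : ℤ) = i + k by push_cast; ring] at this
    simp [this]
  | succ s ih =>
    have h1 := ih (by omega) fun j hj1 hj2 => hq j hj1 (by push_cast; omega)
    have h2 : Set.Ico (i - l + s) (i + k) =
        insert (i - (l : ℤ) + s) (Set.Ico (i - l + (s + 1 : ℕ)) (i + k)) := by
      ext t
      simp only [Set.mem_Ico, Set.mem_insert_iff]
      push_cast
      omega
    rw [h2, Set.image_insert_eq, Submodule.mem_span_insert] at h1
    -- Among the remaining columns, the new condition at `i + s` pairs nontrivially only with the
    -- first one, at `i + s - l`, so it kills exactly that coefficient.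
    obtain ⟨c, z, hz, rfl⟩ := h1
    have h3 := hq (i + s) (by omega) (by push_cast; omega)
    have h4 : ucol T (i + s) ⬝ᵥ z = 0 := by
      refine dotProduct_eq_zero_of_mem_span ?_ hz
      rintro _ ⟨t, ⟨ht1, ht2⟩, rfl⟩
      push_cast at ht1
      exact h.1 _ _ (by omega) (by omega)
    rw [dotProduct_add, h4, add_zero, dotProduct_smul, smul_eq_mul,
      show i - (l : ℤ) + s = (i + s) - l by ring] at h3
    have h5 : c = 0 := (mul_eq_zero.1 h3).resolve_right (h.ne_zero hU (i + s))
    rw [h5]; simpa using hz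

lemma IsTwist.nondeg {k l : ℕ} {U T : Matrix ι (Fin n) ℝ} (hU : Nondeg (k + l) U)
    (h : IsTwist k l U T) : Nondeg (k + l) T := by
  intro j φ hφ
  have := h.mem_span hU j le_rfl (q := φ) fun t h1 h2 => by
    rw [dotProduct_comm]; exact hφ t h1 h2
  have h1 : Set.Ico (j - (l : ℤ) + ((k + l : ℕ) : ℤ)) (j + k) = ∅ := by
    rw [Set.Ico_eq_empty]; push_cast; omega
  rw [h1] at this
  simpa using this

/-- The orthogonality relations are symmetric once `k` and `l` are exchanged; this makes the twist
an involution up to column scaling. -/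
lemma IsTwist.symm {k l : ℕ} {U T : Matrix ι (Fin n) ℝ}
    (hU : Nondeg (k + l) U) (h : IsTwist k l U T) : IsTwist l k T U := by
  refine ⟨fun j t h1 h2 => ?_, fun j h0 => ?_⟩
  · rw [dotProduct_comm]; exact h.1 t j (by omega) (by omega)
  · have := h.ne_zero hU (j + l)
    rw [add_sub_cancel_right, h0] at this
    simp at this

/-- Both columns are normal to the same `k + l - 1` independent vectors. The factor is found by
pairing with the missing vector of the window. -/
lemma IsTwist.exists_smul {k l : ℕ} {U T T' : Matrix ι (Fin n) ℝ} (hU : Nondeg (k + l) U)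
    (h : IsTwist k l U T) (h' : IsTwist k l U T') (j : ℤ) :
    ∃ c : ℝ, c ≠ 0 ∧ ucol T' j = c • ucol T j := by
  have h1 := h.ne_zero hU j
  have h2 := h'.ne_zero hU j
  set x := ucol T j ⬝ᵥ ucol U (j - l)
  set x' := ucol T' j ⬝ᵥ ucol U (j - l)
  refine ⟨x' / x, div_ne_zero h2 h1, ?_⟩
  rw [← sub_eq_zero]
  refine hU (j - l) _ fun t h3 h4 => ?_
  rw [sub_dotProduct, smul_dotProduct, smul_eq_mul]
  rcases h3.eq_or_lt with rfl | h3
  · change x' - x' / x * x = 0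
    field_simp
    ring
  · push_cast at h4
    rw [h.1 j t h3 (by omega), h'.1 j t h3 (by omega)]; simp

lemma ivlRank_eq_rank {κ : Type*} [Fintype κ] (A : Matrix κ (Fin n) ℝ) (i : ℤ) (s : ℕ) :
    ivlRank A i (i + s) = (Matrix.of fun (a : κ) (c : Fin s) => ucol A (i + c) a).rank := by
  suffices h : ucol A '' Set.Ico i (i + s) =
      Set.range (Matrix.of fun (a : κ) (c : Fin s) => ucol A (i + c) a).col by
    rw [Matrix.rank_eq_finrank_span_cols, ivlRank, h]
  ext v
  constructor
  · rintro ⟨t, ⟨h1, h2⟩, rfl⟩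
    refine ⟨⟨(t - i).toNat, by omega⟩, ?_⟩
    ext a
    simp only [Matrix.col_apply, Matrix.of_apply]
    congr 2
    have : ((t - i).toNat : ℤ) = t - i := Int.toNat_of_nonneg (by omega)
    simp [this]
  · rintro ⟨c, rfl⟩
    exact ⟨i + c, ⟨by omega, by have := c.isLt; omega⟩, rfl⟩

lemma finrank_annihilator {κ : Type*} [Fintype κ] (A : Matrix κ (Fin n) ℝ) (i : ℤ) (s : ℕ)
    (P : Submodule ℝ (κ → ℝ)) (hP : ∀ p, p ∈ P ↔ ∀ j, i ≤ j → j < i + s → ucol A j ⬝ᵥ p = 0) :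
    ivlRank A i (i + s) + Module.finrank ℝ P = Fintype.card κ := by
  set M := Matrix.of fun (a : κ) (c : Fin s) => ucol A (i + c) a
  have h1 : P = LinearMap.ker Mᵀ.mulVecLin := by
    ext p
    rw [hP, LinearMap.mem_ker, Matrix.mulVecLin_apply, funext_iff]
    constructor
    · intro h c
      exact h (i + c) (by omega) (by have := c.isLt; omega)
    · intro h j h2 h3
      have := h ⟨(j - i).toNat, by omega⟩
      have h4 : ((j - i).toNat : ℤ) = j - i := Int.toNat_of_nonneg (by omega)
      simpa [M, Matrix.mulVec, dotProduct, h4] using this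
  classical
  rw [ivlRank_eq_rank, ← Matrix.rank_transpose, h1, Matrix.rank,
    LinearMap.finrank_range_add_finrank_ker, Module.finrank_fintype_fun_eq_card]

/-- A full window has rank `r`, and rank is subadditive when the window is cut in two, so neither
part can lose rank. -/
lemma Nondeg.finrank_span {r : ℕ} {U : Matrix ι (Fin n) ℝ} (hU : Nondeg r U)
    (hr : Fintype.card ι = r) {i : ℤ} {s : ℕ} (hs : s ≤ r) : ivlRank U i (i + s) = s := by
  have hle : ∀ (i : ℤ) (s : ℕ), ivlRank U i (i + s) ≤ s := fun i s => by
    rw [ivlRank_eq_rank]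
    simpa using Matrix.rank_le_card_width (Matrix.of fun (a : ι) (c : Fin s) => ucol U (i + c) a)
  refine le_antisymm (hle i s) ?_
  have h1 : ivlRank U i (i + r) = r := by
    rw [ivlRank, hU.span_eq_top, finrank_top, Module.finrank_fintype_fun_eq_card, hr]
  have h2 : ivlRank U i (i + r) ≤ ivlRank U i (i + s) + ivlRank U (i + s) (i + s + (r - s : ℕ)) := by
    have : Set.Ico i (i + r) = Set.Ico i (i + s) ∪ Set.Ico (i + s) (i + s + (r - s : ℕ)) := by
      ext t; simp only [Set.mem_Ico, Set.mem_union]; omega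
    rw [ivlRank, this, Set.image_union, Submodule.span_union]
    exact Submodule.finrank_add_le_finrank_add_finrank _ _
  have h3 := hle (i + s) (r - s)
  omega

/-- The rank of an interval of columns of the lower part of the twist. -/
lemma IsTwist.ivlRank_eq {k l k' l' : ℕ} (hkl : k' + l' = k + l) {V X : Matrix (Fin k') (Fin n) ℝ}
    {W Y : Matrix (Fin l') (Fin n) ℝ}
    (hU : Nondeg (k + l) (fromRows V W)) (h : IsTwist k l (fromRows V W) (fromRows X Y)) (i : ℤ)
    {s : ℕ} (hs : s ≤ k + l) :
    ivlRank Y i (i + s) + k' = s + ivlRank V (i - l + s) (i + k) := by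
  set U := fromRows V W
  -- Rank–nullity for the projection of `S` to the upper coordinates. The image is spanned by
  -- columns of `V`. The kernel consists of the vectors `(0, p)` in `S`, and by `IsTwist.mem_span`
  -- these are given by the `p` normal to the columns of `Y` in `[i, i + s)`.
  set S := Submodule.span ℝ (ucol U '' Set.Ico (i - l + s) (i + k)) with hS
  have hSr : Module.finrank ℝ S + s = k + l := by
    obtain ⟨d, hd⟩ := Nat.exists_eq_add_of_le hs
    have h1 := hU.finrank_span (r := k + l) (by simp [hkl]) (i := i - l + s) (s := d) (by omega)
    rw [show i - (l : ℤ) + s + d = i + k by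
      have : ((k + l : ℕ) : ℤ) = ((s + d : ℕ) : ℤ) := by rw [hd]
      push_cast at this; linarith] at h1
    rw [ivlRank] at h1
    rw [hS, h1]; omega
  let π : (Fin k' ⊕ Fin l' → ℝ) →ₗ[ℝ] (Fin k' → ℝ) := LinearMap.funLeft ℝ ℝ Sum.inl
  have hrange : Module.finrank ℝ (LinearMap.range (π.domRestrict S)) =
      ivlRank V (i - l + s) (i + k) := by
    rw [LinearMap.range_domRestrict, hS, Submodule.map_span, ivlRank, ← Set.image_comp]
    rfl
  let incl : (Fin l' → ℝ) →ₗ[ℝ] (Fin k' ⊕ Fin l' → ℝ) :=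
    { toFun := fun p => Sum.elim 0 p
      map_add' := by intro p q; ext (a | a) <;> simp
      map_smul' := by intro c q; ext (a | a) <;> simp }
  let P : Submodule ℝ (Fin l' → ℝ) := S.comap incl
  have hP : ∀ p, p ∈ P ↔ ∀ j, i ≤ j → j < i + s → ucol Y j ⬝ᵥ p = 0 := by
    intro p
    have hdot : ∀ j, ucol (fromRows X Y) j ⬝ᵥ incl p = ucol Y j ⬝ᵥ p := by
      intro j
      simp [dotProduct, Fintype.sum_sum_type, incl]
    constructor
    · intro hp j h1 h2
      rw [← hdot]
      refine dotProduct_eq_zero_of_mem_span ?_ hp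
      rintro _ ⟨t, ⟨h3, h4⟩, rfl⟩
      exact h.1 j t (by omega) (by omega)
    · intro hp
      exact h.mem_span hU i hs fun j h1 h2 => by rw [hdot]; exact hp j h1 h2
  have hker : Module.finrank ℝ (LinearMap.ker (π.domRestrict S)) = Module.finrank ℝ P := by
    symm
    let f : P →ₗ[ℝ] LinearMap.ker (π.domRestrict S) :=
      LinearMap.codRestrict _ (LinearMap.codRestrict S (incl.comp P.subtype) fun p => p.2)
        (by intro p; rw [LinearMap.mem_ker]; ext a; rfl)
    refine LinearEquiv.finrank_eq (LinearEquiv.ofBijective f ⟨?_, ?_⟩)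
    · intro p q hpq
      apply Subtype.ext
      have h1 := congrArg (fun z : LinearMap.ker (π.domRestrict S) =>
        ((z : S) : Fin k' ⊕ Fin l' → ℝ) ∘ Sum.inr) hpq
      exact h1
    · rintro ⟨⟨z, hz⟩, hz0⟩
      rw [LinearMap.mem_ker] at hz0
      have h1 : incl (z ∘ Sum.inr) = z := by
        ext (a | a)
        · exact (congrFun hz0 a).symm
        · rfl
      refine ⟨⟨z ∘ Sum.inr, ?_⟩, ?_⟩
      · change incl (z ∘ Sum.inr) ∈ S
        rw [h1]; exact hz
      · apply Subtype.ext; apply Subtype.ext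
        exact h1
  have h1 := LinearMap.finrank_range_add_finrank_ker (π.domRestrict S)
  rw [hrange, hker] at h1
  have h2 := finrank_annihilator Y i s P hP
  rw [Fintype.card_fin] at h2
  omega

/-! ## The twist map -/

variable [DecidableEq ι]

/-- The twist of a matrix, with prescribed column scaling factors. -/
noncomputable def twist {r : ℕ} [NeZero r] (e : ι ≃ Fin r) (l : ℕ) (s : Fin n → ℝ)
    (U : Matrix ι (Fin n) ℝ) : Matrix ι (Fin n) ℝ :=
  Matrix.of fun a c => s c * (windowMatrix e U ((c : ℤ) + 1 - l)).adjugate (e.symm 0) a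

lemma ucol_twist {r : ℕ} [NeZero r] (e : ι ≃ Fin r) (l : ℕ) (s : Fin n → ℝ)
    (U : Matrix ι (Fin n) ℝ) (j : ℤ) : ucol (twist e l s U) j =
      s (idx n j) • (windowMatrix e U (j - l)).adjugate (e.symm 0) := by
  ext a
  simp only [ucol, twist, Matrix.of_apply, Pi.smul_apply, smul_eq_mul]
  rw [windowMatrix_congr e U (i := ((idx n j : ℕ) : ℤ) + 1 - l) (j := j - l)]
  have h1 := idx_coe_add_one (idx n j)
  obtain ⟨q, hq⟩ := idx_eq_iff.1 h1
  rw [idx_eq_iff]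
  exact ⟨q, by linarith⟩

lemma Nondeg.det_windowMatrix_ne_zero {r : ℕ} (e : ι ≃ Fin r) {U : Matrix ι (Fin n) ℝ}
    (hU : Nondeg r U) (i : ℤ) : (windowMatrix e U i).det ≠ 0 := by
  rw [ne_eq, ← Matrix.exists_vecMul_eq_zero_iff]
  rintro ⟨φ, h0, h1⟩
  apply h0
  refine hU i φ fun t h2 h3 => ?_
  have := congrFun h1 (e.symm ⟨(t - i).toNat, by omega⟩)
  have h4 : ((t - i).toNat : ℤ) = t - i := Int.toNat_of_nonneg (by omega)
  simpa [windowMatrix, Matrix.vecMul, dotProduct, h4] using this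

/-- The adjugate times the window matrix is a scalar matrix, so the adjugate row of the first window
position is normal to all other columns of the window and pairs with the first one to a nonzero
determinant. -/
lemma Nondeg.isTwist_twist {k l : ℕ} [NeZero (k + l)] (e : ι ≃ Fin (k + l)) {s : Fin n → ℝ}
    (hs : ∀ c, s c ≠ 0) {U : Matrix ι (Fin n) ℝ} (hU : Nondeg (k + l) U) :
    IsTwist k l U (twist e l s U) := by
  have hdet := fun i => hU.det_windowMatrix_ne_zero e i
  have hmul : ∀ j t : ℤ, j - l ≤ t → t < j + k → (windowMatrix e U (j - l)).adjugate (e.symm 0) ⬝ᵥ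
      ucol U t = if t = j - l then (windowMatrix e U (j - l)).det else 0 := by
    intro j t h1 h2
    have h3 := congrFun (congrFun (Matrix.adjugate_mul (windowMatrix e U (j - l))) (e.symm 0))
      (e.symm ⟨(t - (j - l)).toNat, by omega⟩)
    have h4 : ((t - (j - l)).toNat : ℤ) = t - (j - l) := Int.toNat_of_nonneg (by omega)
    have h5 : (windowMatrix e U (j - l)).adjugate (e.symm 0) ⬝ᵥ ucol U t =
        ((windowMatrix e U (j - l)).adjugate * windowMatrix e U (j - l)) (e.symm 0)
        (e.symm ⟨(t - (j - l)).toNat, by omega⟩) := by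
      simp only [Matrix.mul_apply, dotProduct, windowMatrix, Matrix.of_apply,
        Equiv.apply_symm_apply, h4]
      simp
    rw [h5, h3, Matrix.smul_apply, Matrix.one_apply, smul_eq_mul]
    have h6 : e.symm 0 = e.symm ⟨(t - (j - l)).toNat, by omega⟩ ↔ t = j - l := by
      rw [e.symm.injective.eq_iff, Fin.ext_iff]
      simp only [Fin.val_zero]
      omega
    simp [h6]
  refine ⟨fun j t h1 h2 => ?_, fun j h0 => ?_⟩
  · rw [ucol_twist, smul_dotProduct, hmul j t h1.le h2, if_neg h1.ne', smul_zero]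
  · have h1 := hmul j (j - l) le_rfl (by
      have := NeZero.pos (k + l); omega)
    rw [if_pos rfl] at h1
    rw [ucol_twist] at h0
    have h2 := (smul_eq_zero.1 h0).resolve_left (hs _)
    rw [h2, zero_dotProduct] at h1
    exact hdet _ h1.symm

/-- The twist is contragredient under row operations because the adjugate reverses products. Being
polynomial, it needs no invertibility of `g`. -/
lemma twist_mul {r : ℕ} [NeZero r] (e : ι ≃ Fin r) (l : ℕ) (s : Fin n → ℝ) (g : Matrix ι ι ℝ)
    (U : Matrix ι (Fin n) ℝ) : twist e l s (g * U) = g.adjugateᵀ * twist e l s U := by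
  ext a c
  have h1 : windowMatrix e (g * U) ((c : ℤ) + 1 - l) = g * windowMatrix e U ((c : ℤ) + 1 - l) := by
    ext b d
    simp [windowMatrix, Matrix.mul_apply]
  simp only [twist, Matrix.of_apply, h1, Matrix.adjugate_mul_distrib, Matrix.mul_apply,
    Matrix.transpose_apply, Finset.mul_sum]
  exact Finset.sum_congr rfl fun b _ => by ring

lemma continuous_twist {r : ℕ} [NeZero r] (e : ι ≃ Fin r) (l : ℕ) (s : Fin n → ℝ) :
    Continuous (twist (n := n) e l s) := by
  refine continuous_pi fun a => continuous_pi fun c => ?_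
  have h1 : Continuous fun U : Matrix ι (Fin n) ℝ => windowMatrix e U ((c : ℤ) + 1 - l) := by
    refine continuous_pi fun b => continuous_pi fun d => ?_
    simp only [windowMatrix, Matrix.of_apply]
    fun_prop
  simp only [twist, Matrix.of_apply]
  exact continuous_const.mul (h1.matrix_adjugate.matrix_elem _ _)

end idx

end Amplituhedron

namespace Amplituhedron
open Matrix Equiv Filter Topology

lemma exists_tupleMinor_ne_zero {k n : ℕ} {A : Matrix (Fin k) (Fin n) ℝ} {I : Finset (Fin n)}
    (h : k ≤ colRank A I) : ∃ t, tupleMinor A t ≠ 0 ∧ ∀ a, t a ∈ I := by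
  obtain ⟨B, hBI, hB, hli⟩ := exists_independent_of_le_rank A I h
  refine ⟨B.orderEmbOfFin hB, ?_, fun a => hBI (Finset.orderEmbOfFin_mem B hB a)⟩
  rw [tupleMinor_ne_zero_iff]
  intro ψ hψ
  have h1 : Submodule.span ℝ (colv A '' (B : Set (Fin n))) = ⊤ := by
    apply Submodule.eq_top_of_finrank_eq
    rw [finrank_span_image_eq hli, hB]; simp
  have h2 : ψ ⬝ᵥ ψ = 0 := by
    refine dotProduct_eq_zero_of_mem_span (S := colv A '' (B : Set (Fin n))) ?_ (by rw [h1]; trivial)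
    rintro _ ⟨j, hj, rfl⟩
    have : j ∈ Set.range (B.orderEmbOfFin hB) := by rw [Finset.range_orderEmbOfFin]; exact hj
    obtain ⟨a, rfl⟩ := this
    exact hψ a
  exact dotProduct_self_eq_zero.1 h2

section windows
variable {n : ℕ} [NeZero n]

/-! ## Ranks of cyclic intervals -/

lemma mem_cycIvl_iff {i b : ℤ} {c : Fin n} :
    c ∈ cycIvl n i b ↔ ∃ t, i ≤ t ∧ t ≤ b ∧ idx n t = c := by
  rw [mem_cycIvl]
  constructor
  · rintro ⟨q, h1, h2⟩
    exact ⟨_, h1, h2, by rw [idx_add_mul, idx_coe_add_one]⟩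
  · rintro ⟨t, h1, h2, h3⟩
    rw [← idx_coe_add_one c] at h3
    obtain ⟨q, hq⟩ := idx_eq_iff.1 h3.symm
    exact ⟨q, by omega, by omega⟩

lemma ivlRank_eq_colRank {k : ℕ} (A : Matrix (Fin k) (Fin n) ℝ) (i b : ℤ) :
    ivlRank A i b = colRank A (cycIvl n i (b - 1)) := by
  rw [ivlRank, colRank]
  have : ucol A '' Set.Ico i b = colv A '' ((cycIvl n i (b - 1) : Finset (Fin n)) : Set (Fin n)) := by
    ext v
    simp only [Set.mem_image, Set.mem_Ico, Finset.mem_coe, mem_cycIvl_iff]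
    constructor
    · rintro ⟨t, ⟨h1, h2⟩, rfl⟩
      exact ⟨_, ⟨t, h1, by omega, rfl⟩, rfl⟩
    · rintro ⟨_, ⟨t, h1, h2, rfl⟩, rfl⟩
      exact ⟨t, ⟨h1, by omega⟩, rfl⟩
  rw [this]

lemma nondeg_iff {ι : Type*} [Fintype ι] {r : ℕ} {U : Matrix ι (Fin n) ℝ} :
    Nondeg r U ↔ ∀ j, ivlRank U j (j + r) = Fintype.card ι := by
  classical
  constructor
  · intro h j
    rw [ivlRank, h.span_eq_top, finrank_top, Module.finrank_fintype_fun_eq_card]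
  · intro h j φ hφ
    have h1 : Submodule.span ℝ (ucol U '' Set.Ico j (j + r)) = ⊤ := by
      apply Submodule.eq_top_of_finrank_eq
      rw [Module.finrank_fintype_fun_eq_card]; exact h j
    have h2 : φ ⬝ᵥ φ = 0 := by
      refine dotProduct_eq_zero_of_mem_span (S := ucol U '' Set.Ico j (j + r)) ?_
        (by rw [h1]; trivial)
      rintro _ ⟨t, ⟨h1, h2⟩, rfl⟩
      exact hφ t h1 h2
    exact dotProduct_self_eq_zero.1 h2

lemma ivlRank_mono {ι : Type*} [Finite ι] (A : Matrix ι (Fin n) ℝ) {i b i' b' : ℤ} (h : i' ≤ i)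
    (h' : b ≤ b') : ivlRank A i b ≤ ivlRank A i' b' :=
  Submodule.finrank_mono (Submodule.span_mono (Set.image_mono (Set.Ico_subset_Ico h h')))

lemma ivlRank_le {ι : Type*} [Fintype ι] (A : Matrix ι (Fin n) ℝ) (i b : ℤ) :
    ivlRank A i b ≤ Fintype.card ι := by
  classical
  rw [← Module.finrank_fintype_fun_eq_card (R := ℝ) (η := ι)]
  exact Submodule.finrank_le _

/-- A totally nonnegative matrix all of whose cyclically consecutive maximal minors are nonzero
is totally positive. -/
lemma NonnegMinors.posMinors {k : ℕ} {e : ℝ} (he : e ≠ 0) {A : Matrix (Fin k) (Fin n) ℝ}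
    (hA : NonnegMinors e A) (h : Nondeg k A) : PosMinors e A := by
  rw [posMinors_iff]
  intro J hJ
  refine (nonnegMinors_iff.1 hA J hJ).lt_of_ne' (mul_ne_zero he ?_)
  refine minor_ne_zero_of_cyclic_rank hA he J hJ fun i b => ?_
  have h0 := ivlRank_eq_colRank A i (b + 1)
  rw [add_sub_cancel_right] at h0
  rw [← h0]
  -- Intervals of length at least `k` have full rank; shorter ones have independent columns, so
  -- their rank is their length.
  by_cases hb : i + k ≤ b + 1
  · refine (Finset.card_le_card Finset.inter_subset_left).trans ?_
    rw [hJ]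
    have := (nondeg_iff.1 h) i
    rw [Fintype.card_fin] at this
    exact this.ge.trans (ivlRank_mono A le_rfl hb)
  · by_cases hib : b + 1 ≤ i
    · have : cycIvl n i b = ∅ := by
        ext c
        simp only [mem_cycIvl_iff, Finset.notMem_empty, iff_false]
        rintro ⟨t, h1, h2, -⟩
        omega
      rw [this]; simp
    · have h1 := h.finrank_span (by simp) (i := i) (s := (b + 1 - i).toNat) (by omega)
      have h2 : ((b + 1 - i).toNat : ℤ) = b + 1 - i := Int.toNat_of_nonneg (by omega)
      rw [h2, show i + (b + 1 - i) = b + 1 by ring] at h1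
      rw [h1]
      refine (Finset.card_le_card Finset.inter_subset_right).trans ?_
      have h3 : cycIvl n i b ⊆ (Finset.Icc i b).image (idx n) := by
        intro c hc
        obtain ⟨t, h1, h2, h3⟩ := mem_cycIvl_iff.1 hc
        exact Finset.mem_image.2 ⟨t, Finset.mem_Icc.2 ⟨h1, h2⟩, h3⟩
      refine (Finset.card_le_card h3).trans (Finset.card_image_le.trans ?_)
      simp

/-! ## Nondegenerate windows -/

lemma coe_idx_add (i : ℤ) (b : ℕ) (hb : b < n) : (idx n (i + b) : ℕ) =
    if (idx n i : ℕ) + b < n then (idx n i : ℕ) + b else (idx n i : ℕ) + b - n := by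
  have hn : 0 < (n : ℤ) := by exact_mod_cast NeZero.pos n
  have h1 : idx n (i + b) = idx n (((idx n i : ℕ) : ℤ) + 1 + b) := by
    have h2 := idx_coe_add_one (idx n i)
    obtain ⟨q, hq⟩ := idx_eq_iff.1 h2
    rw [idx_eq_iff]
    exact ⟨-q, by linarith⟩
  have h3 := (idx n i).isLt
  have h4 : ((idx n (i + b) : ℕ) : ℤ) = (((idx n i : ℕ) : ℤ) + b) % n := by
    rw [h1, coe_idx]; congr 1; ring
  split_ifs with h
  · rw [Int.emod_eq_of_lt (by positivity) (by exact_mod_cast h)] at h4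
    exact_mod_cast h4
  · have h5 : (((idx n i : ℕ) : ℤ) + b) % n = ((idx n i : ℕ) : ℤ) + b - n := by
      rw [← Int.sub_emod_right, Int.emod_eq_of_lt (by omega) (by omega)]
    rw [h5] at h4
    omega

/-- If the window does not wrap around, the product is positive for columns to the left and has sign
`(-1) ^ m` for columns to the right; here `m` must be even. If it wraps, every outside column lies
between its two ends, and the sign of each factor is fixed. -/
lemma exists_window_sign {m : ℕ} (hm : Even m) (hmn : m ≤ n) (i : ℤ) :
    ∃ ε : ℝ, ∀ s : Fin n, s ∉ Set.range (fun b : Fin m => idx n (i + (b : ℕ))) →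
      0 < ε * ∏ b : Fin m, (((idx n (i + (b : ℕ)) : ℕ) : ℝ) - (s : ℕ)) := by
  have hval : ∀ b : Fin m, (idx n (i + (b : ℕ)) : ℕ) =
    if (idx n i : ℕ) + b < n then (idx n i : ℕ) + b else (idx n i : ℕ) + b - n :=
    fun b => coe_idx_add i b (by omega)
  have hlt := (idx n i).isLt
  by_cases h : (idx n i : ℕ) + m ≤ n
  · refine ⟨1, fun s hs => ?_⟩
    rw [one_mul]
    by_cases hsi : (s : ℕ) < idx n i
    · refine Finset.prod_pos fun b _ => ?_
      have : (s : ℕ) < (idx n (i + (b : ℕ)) : ℕ) := by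
        rw [hval]; split_ifs <;> omega
      have : ((s : ℕ) : ℝ) < (idx n (i + (b : ℕ)) : ℕ) := by exact_mod_cast this
      linarith
    · have hsm : (idx n i : ℕ) + m ≤ s := by
        by_contra hcon
        apply hs
        refine ⟨⟨s - idx n i, by omega⟩, ?_⟩
        ext
        rw [hval, if_pos]
        · simp only; omega
        · simp only; have := s.isLt; omega
      have h1 : ∏ b : Fin m, (((idx n (i + (b : ℕ)) : ℕ) : ℝ) - (s : ℕ)) =
          (-1) ^ m * ∏ b : Fin m, (((s : ℕ) : ℝ) - (idx n (i + (b : ℕ)) : ℕ)) := by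
        have : (-1 : ℝ) ^ m = ∏ _b : Fin m, (-1 : ℝ) := by simp
        rw [this, ← Finset.prod_mul_distrib]
        exact Finset.prod_congr rfl fun b _ => by ring
      rw [h1, hm.neg_one_pow, one_mul]
      refine Finset.prod_pos fun b _ => ?_
      have : (idx n (i + (b : ℕ)) : ℕ) < s := by
        rw [hval]; have := b.isLt; split_ifs <;> omega
      have : (((idx n (i + (b : ℕ)) : ℕ)) : ℝ) < (s : ℕ) := by exact_mod_cast this
      linarith
  · refine ⟨∏ b : Fin m, if (idx n i : ℕ) + b < n then 1 else -1, fun s hs => ?_⟩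
    rw [← Finset.prod_mul_distrib]
    have h1 : (s : ℕ) < idx n i := by
      by_contra hcon
      apply hs
      refine ⟨⟨s - idx n i, by omega⟩, ?_⟩
      ext
      rw [hval, if_pos]
      · simp only; omega
      · simp only; have := s.isLt; omega
    have h2 : (idx n i : ℕ) + m ≤ s + n := by
      by_contra hcon
      apply hs
      refine ⟨⟨s + n - idx n i, by omega⟩, ?_⟩
      ext
      rw [hval, if_neg]
      · simp only; omega
      · simp only; omega
    refine Finset.prod_pos fun b _ => ?_
    have hb := b.isLt
    rw [hval]
    split_ifs with h3
    · have : ((s : ℕ) : ℝ) < ((idx n i + b : ℕ) : ℝ) := by exact_mod_cast (by omega)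
      linarith
    · have : ((idx n i + b - n : ℕ) : ℝ) < ((s : ℕ) : ℝ) := by exact_mod_cast (by omega)
      linarith

lemma fromRows_dotProduct {k l : ℕ} (V : Matrix (Fin k) (Fin n) ℝ) (W : Matrix (Fin l) (Fin n) ℝ)
    (φ : Fin k ⊕ Fin l → ℝ) (t : ℤ) : φ ⬝ᵥ ucol (fromRows V W) t =
      ((φ ∘ Sum.inl) ᵥ* V + (φ ∘ Sum.inr) ᵥ* W) (idx n t) := by
  simp [dotProduct, Fintype.sum_sum_type, Matrix.vecMul]

/-- If all long windows of columns of `V` have full rank, then stacking `V` with the kernel of a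
totally positive matrix gives a matrix with nondegenerate windows. -/
lemma nondeg_fromRows {k l m : ℕ} (hn : k + l + m = n) (hm : Even m) {e : ℝ} (he : e ≠ 0)
    {V : Matrix (Fin k) (Fin n) ℝ} (hV : NonnegMinors e V)
    (hr : ∀ j, ivlRank V j (j + (k + l : ℕ)) = k) {Z : Matrix (Fin (k + m)) (Fin n) ℝ}
    (hZ : PosMinors 1 Z) {W : Matrix (Fin l) (Fin n) ℝ} (hW : IsKernelMatrix Z W) :
    Nondeg (k + l) (fromRows V W) := by
  intro j φ hφ
  -- The complement of a window of `k + l` columns is a window of `m` columns, which serves as the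
  -- tuple `y`.
  obtain ⟨ε, hε⟩ := exists_window_sign (n := n) hm (by omega) (j + (k + l : ℕ))
  have hrange : ∀ t, j ≤ t → t < j + (k + l : ℕ) →
      idx n t ∉ Set.range (fun b : Fin m => idx n (j + (k + l : ℕ) + (b : ℕ))) := by
    rintro t h1 h2 ⟨b, hb⟩
    have := b.isLt
    have := idx_eq_of_lt hb (by omega) (by omega)
    omega
  have h1 := stacked_eq_zero_of_vanish hV he hZ hW
    (y := fun b : Fin m => idx n (j + (k + l : ℕ) + (b : ℕ))) (ε := ε)
    (φ := φ ∘ Sum.inl) (β := φ ∘ Sum.inr) ?_ hε ?_ ?_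
  · ext (a | a)
    · exact congrFun h1.1 a
    · exact congrFun h1.2 a
  · intro a b hab
    have := idx_eq_of_lt hab (by omega) (by omega)
    ext; omega
  · have h2 : k ≤ colRank V (cycIvl n j (j + (k + l : ℕ) - 1)) := by
      rw [← ivlRank_eq_colRank, hr]
    obtain ⟨t, ht, htI⟩ := exists_tupleMinor_ne_zero h2
    refine ⟨t, ht, fun a => ?_⟩
    obtain ⟨x, hx1, hx2, hx3⟩ := mem_cycIvl_iff.1 (htI a)
    rw [← hx3]
    exact hrange x hx1 (by omega)
  · intro c hc
    obtain ⟨t, ht1, ht2, rfl⟩ := exists_idx_window c j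
    rw [← fromRows_dotProduct]
    refine hφ t ht1 ?_
    by_contra hcon
    apply hc
    refine ⟨⟨(t - (j + (k + l : ℕ))).toNat, by omega⟩, ?_⟩
    simp only
    congr 1
    omega

lemma PosMinors.nondeg {k : ℕ} (hkn : k ≤ n) {e : ℝ} {A : Matrix (Fin k) (Fin n) ℝ}
    (h : PosMinors e A) : Nondeg k A := by
  intro j φ hφ
  have h1 := h.tupleMinor_ne_zero (t := fun a : Fin k => idx n (j + (a : ℕ))) ?_
  · rw [tupleMinor_ne_zero_iff] at h1
    exact h1 φ fun a => hφ _ (by omega) (by omega)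
  · intro a b hab
    have := idx_eq_of_lt hab (by omega) (by omega)
    ext; omega

lemma Nondeg.ivlRank_of_le {k r : ℕ} {A : Matrix (Fin k) (Fin n) ℝ} (h : Nondeg k A) (hkr : k ≤ r)
    (j : ℤ) : ivlRank A j (j + r) = k := by
  have h1 := nondeg_iff.1 h j
  have h2 := ivlRank_le A j (j + r)
  rw [Fintype.card_fin] at h1 h2
  exact le_antisymm h2 (h1.ge.trans (ivlRank_mono A le_rfl (by omega)))

lemma IsKernelMatrix.nondeg {p l : ℕ} (hn : p + l = n) {Z : Matrix (Fin p) (Fin n) ℝ}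
    {W : Matrix (Fin l) (Fin n) ℝ} (h : IsKernelMatrix Z W) (hZ : PosMinors 1 Z) : Nondeg l W := by
  intro j φ hφ
  refine h.eq_zero_of_vanish hn hZ (y := fun b : Fin l => idx n (j + (b : ℕ))) ?_ fun b => ?_
  · intro a b hab
    have := idx_eq_of_lt hab (by omega) (by omega)
    ext; omega
  · exact hφ _ (by omega) (by omega)

/-- Rank duality for intervals of length `l`, whose complementary intervals are windows of `k`
columns of `V`. -/
lemma IsTwist.nondeg_lower {k l : ℕ} {V X : Matrix (Fin k) (Fin n) ℝ}
    {W Y : Matrix (Fin l) (Fin n) ℝ} (hU : Nondeg (k + l) (fromRows V W))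
    (h : IsTwist k l (fromRows V W) (fromRows X Y)) (hV : Nondeg k V) : Nondeg l Y := by
  rw [nondeg_iff] at hV ⊢
  intro j
  have h1 := h.ivlRank_eq rfl hU j (s := l) (by omega)
  rw [show j - (l : ℤ) + l = j by ring, hV] at h1
  simp only [Fintype.card_fin] at h1 ⊢
  omega

/-- Exchanging the two row blocks preserves the twist relation, so rank duality also links `W` and
`X`. -/
lemma IsTwist.nondeg_upper {k l : ℕ} {V X : Matrix (Fin k) (Fin n) ℝ}
    {W Y : Matrix (Fin l) (Fin n) ℝ} (hU : Nondeg (k + l) (fromRows V W))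
    (h : IsTwist k l (fromRows V W) (fromRows X Y)) (hW : Nondeg l W) : Nondeg k X := by
  have hdot : ∀ {A B : Matrix (Fin k) (Fin n) ℝ} {C D : Matrix (Fin l) (Fin n) ℝ} (j t : ℤ),
      ucol (fromRows C A) j ⬝ᵥ ucol (fromRows D B) t =
        ucol (fromRows A C) j ⬝ᵥ ucol (fromRows B D) t := by
    intro A B C D j t
    simp [dotProduct, Fintype.sum_sum_type, add_comm]
  have hU' : Nondeg (k + l) (fromRows W V) := by
    intro j φ hφ
    have := hU j (φ ∘ Sum.swap) fun t h1 h2 => by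
      rw [← hφ t h1 h2]
      simp [dotProduct, Fintype.sum_sum_type, add_comm]
    ext a
    have := congrFun this a.swap
    simpa using this
  have h' : IsTwist k l (fromRows W V) (fromRows Y X) := by
    refine ⟨fun j t h1 h2 => by rw [hdot]; exact h.1 j t h1 h2, fun j h0 => h.2 j ?_⟩
    ext a
    have := congrFun h0 a.swap
    rcases a with a | a <;> simpa using this
  rw [nondeg_iff] at hW ⊢
  intro j
  have h1 := h'.ivlRank_eq (add_comm l k) hU' j (s := k) (by omega)
  have h2 := hW (j - l + k)
  rw [show j - (l : ℤ) + k + l = j + k by ring] at h2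
  rw [h2] at h1
  simp only [Fintype.card_fin] at h1 ⊢
  omega

end windows
end Amplituhedron

namespace Amplituhedron
open Matrix Equiv Filter Topology

/-! ## The trigonometric base point -/

/-- The trigonometric moment curve at the angle `π x / n`. -/
noncomputable def trigVec (n d : ℕ) (x : ℤ) : Fin d → ℝ := fun a =>
  Real.sin (Real.pi * x / n) ^ (a : ℕ) * Real.cos (Real.pi * x / n) ^ (d - 1 - (a : ℕ))

/-- The matrix whose columns lie on the trigonometric moment curve. -/
noncomputable def trig (d n : ℕ) : Matrix (Fin d) (Fin n) ℝ :=
  Matrix.of fun a c => trigVec n d ((c : ℕ) : ℤ) a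

/-- The minors are homogeneous Vandermonde determinants, that is, products of sines of differences
of angles in `[0, π)`. -/
lemma posMinors_trig (d n : ℕ) : PosMinors 1 (trig d n) := by
  refine posMinors_of_strictMono fun t ht => ?_
  have h1 : tupleMinor (trig d n) t = (projVandermonde
      (fun a => Real.sin (Real.pi * ((t a : ℕ) : ℝ) / n))
      (fun a => Real.cos (Real.pi * ((t a : ℕ) : ℝ) / n))).det := by
    rw [tupleMinor, ← Matrix.det_transpose]
    congr 1
    ext a b
    simp only [Matrix.transpose_apply, Matrix.submatrix_apply, id, trig, trigVec, Matrix.of_apply,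
      projVandermonde_apply, Int.cast_natCast, Fin.val_rev]
    congr 2
    omega
  have h2 : 0 < tupleMinor (trig d n) t := by
    rw [h1, det_projVandermonde]
    refine Finset.prod_pos fun a _ => Finset.prod_pos fun b hb => ?_
    have hab : (t a : ℕ) < t b := ht (Finset.mem_Ioi.1 hb)
    have hn : (0 : ℝ) < n := by exact_mod_cast (by have := (t b).isLt; omega : 0 < n)
    have hab' : ((t a : ℕ) : ℝ) < (t b : ℕ) := by exact_mod_cast hab
    have hbn : ((t b : ℕ) : ℝ) < n := by exact_mod_cast (t b).isLt
    have ha0 : (0 : ℝ) ≤ (t a : ℕ) := by positivity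
    rw [show ∀ x y z w : ℝ, x * y - z * w = x * y - w * z from fun _ _ _ _ => by ring,
      ← Real.sin_sub]
    have hpi := Real.pi_pos
    apply Real.sin_pos_of_pos_of_lt_pi
    · rw [sub_pos]; gcongr
    · rw [div_sub_div_same, div_lt_iff₀ hn, ← mul_sub]
      exact mul_lt_mul_of_pos_left (by linarith) hpi
  simpa using h2

/-- A shift by `n` turns the angle by `π`, and the entries are homogeneous of degree `d - 1`. The
exponent `d + 1` has the same parity and avoids a subtraction. -/
lemma trigVec_add_mul {n : ℕ} (hn : n ≠ 0) (d : ℕ) (x q : ℤ) :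
    trigVec n d (x + q * n) = ((-1 : ℝ) ^ (q * (d + 1))) • trigVec n d x := by
  ext a
  have ha := a.isLt
  have hn' : (n : ℝ) ≠ 0 := by exact_mod_cast hn
  have h0 : Real.pi * ((x + q * n : ℤ) : ℝ) / n = Real.pi * x / n + q * Real.pi := by
    push_cast; field_simp
  have h1 : ((-1 : ℝ) ^ (q * (d + 1))) = ((-1 : ℝ) ^ q) ^ (d - 1) := by
    rw [← zpow_natCast, ← _root_.zpow_mul]
    rw [show q * ((d : ℤ) + 1) = q * ((d - 1 : ℕ) : ℤ) + 2 * q by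
      rw [Nat.cast_sub (by omega)]; push_cast; ring, zpow_add₀ (by norm_num), _root_.zpow_mul _ 2]
    norm_num
  simp only [trigVec, Pi.smul_apply, smul_eq_mul, h0, Real.sin_add_int_mul_pi,
    Real.cos_add_int_mul_pi, mul_pow, h1]
  rw [show (((-1 : ℝ) ^ q) ^ (d - 1)) = ((-1 : ℝ) ^ q) ^ (a : ℕ) * ((-1 : ℝ) ^ q) ^ (d - 1 - (a : ℕ)) by
    rw [← pow_add]; congr 1; omega]
  ring

/-- The bihomogeneous monomials in the sines and cosines of two angles. -/
noncomputable def trigMonomial (d : ℕ) (p : Fin (d + 1) × Fin (d + 1)) : ℝ × ℝ → ℝ := fun z =>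
  Real.sin z.1 ^ (p.1 : ℕ) * Real.cos z.1 ^ (d - (p.1 : ℕ)) *
    (Real.sin z.2 ^ (p.2 : ℕ) * Real.cos z.2 ^ (d - (p.2 : ℕ)))

lemma mul_mem_span_trigMonomial {d : ℕ} {f : ℝ × ℝ → ℝ}
    (hf : f ∈ Submodule.span ℝ (Set.range (trigMonomial d))) (u v : Bool) :
    (fun z => (if u then Real.sin z.1 else Real.cos z.1) * (if v then Real.sin z.2 else Real.cos z.2)
      * f z) ∈ Submodule.span ℝ (Set.range (trigMonomial (d + 1))) := by
  let L : (ℝ × ℝ → ℝ) →ₗ[ℝ] (ℝ × ℝ → ℝ) := LinearMap.mulLeft ℝ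
    (fun z => (if u then Real.sin z.1 else Real.cos z.1) * (if v then Real.sin z.2 else Real.cos z.2))
  suffices h : Submodule.span ℝ (Set.range (trigMonomial d)) ≤
      (Submodule.span ℝ (Set.range (trigMonomial (d + 1)))).comap L from h hf
  rw [Submodule.span_le]
  rintro _ ⟨⟨b, e⟩, rfl⟩
  apply Submodule.subset_span
  refine ⟨⟨if u then b.succ else b.castSucc, if v then e.succ else e.castSucc⟩, ?_⟩
  have hb : d + 1 - (b : ℕ) = d - b + 1 := by have := b.isLt; omega
  have he : d + 1 - (e : ℕ) = d - e + 1 := by have := e.isLt; omega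
  ext z
  rcases u <;> rcases v <;>
    simp [trigMonomial, L, hb, he, pow_succ] <;> ring

/-- Induction on the degree with the addition formulas: each further sine or cosine of the
difference is bilinear in the sines and cosines of the two angles. -/
lemma trig_sub_mem_span (a b : ℕ) :
    (fun z : ℝ × ℝ => Real.sin (z.1 - z.2) ^ a * Real.cos (z.1 - z.2) ^ b) ∈
      Submodule.span ℝ (Set.range (trigMonomial (a + b))) := by
  induction a with
  | zero =>
    induction b with
    | zero =>
      apply Submodule.subset_span
      exact ⟨0, by ext z; simp [trigMonomial]⟩
    | succ b ih =>
      have h1 := Submodule.add_mem _ (mul_mem_span_trigMonomial ih false false)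
        (mul_mem_span_trigMonomial ih true true)
      change _ ∈ Submodule.span ℝ (Set.range (trigMonomial (0 + b + 1)))
      convert h1 using 1
      ext z
      simp [Real.cos_sub, pow_succ]
      ring
  | succ a ih =>
    have h1 := Submodule.sub_mem _ (mul_mem_span_trigMonomial ih true false)
      (mul_mem_span_trigMonomial ih false true)
    rw [show a + 1 + b = a + b + 1 by omega]
    convert h1 using 1
    ext z
    simp [Real.sin_sub, pow_succ]
    ring

lemma exists_trigVec_sub (n d : ℕ) (a : Fin d) : ∃ K : Matrix (Fin d) (Fin d) ℝ, ∀ x y : ℤ,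
    trigVec n d (x - y) a = trigVec n d x ⬝ᵥ (K *ᵥ trigVec n d y) := by
  obtain ⟨D, rfl⟩ : ∃ D, d = D + 1 := ⟨d - 1, by have := a.isLt; omega⟩
  have h1 := trig_sub_mem_span a (D - a)
  rw [show (a : ℕ) + (D - a) = D by have := a.isLt; omega,
    Submodule.mem_span_range_iff_exists_fun] at h1
  obtain ⟨K, hK⟩ := h1
  refine ⟨Matrix.of fun b e => K (b, e), fun x y => ?_⟩
  have h2 := congrFun hK (Real.pi * x / n, Real.pi * y / n)
  simp only [trigVec, dotProduct, Matrix.mulVec, Matrix.of_apply, Finset.mul_sum, add_tsub_cancel_right]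
  rw [Int.cast_sub, mul_sub, sub_div]
  rw [← h2]
  simp only [Finset.sum_apply, Pi.smul_apply, smul_eq_mul, trigMonomial, Fintype.sum_prod_type]
  exact Finset.sum_congr rfl fun b _ => Finset.sum_congr rfl fun e _ => by ring

/-- Translating the curve acts linearly: a fixed functional evaluated on a translate is again a
functional on the curve, depending linearly on the curve vector at `y`. This makes the twist of the
trigonometric matrix explicit enough to have known signs. -/
lemma exists_dotProduct_trigVec_sub (n d : ℕ) (q : Fin d → ℝ) :
    ∃ N : Matrix (Fin d) (Fin d) ℝ, ∀ x y : ℤ,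
      q ⬝ᵥ trigVec n d (x - y) = (N *ᵥ trigVec n d y) ⬝ᵥ trigVec n d x := by
  choose K hK using exists_trigVec_sub n d
  refine ⟨∑ a, q a • K a, fun x y => ?_⟩
  rw [dotProduct_comm _ (trigVec n d x), Matrix.sum_mulVec, dotProduct_sum]
  refine Finset.sum_congr rfl fun a _ => ?_
  rw [hK, Matrix.smul_mulVec, dotProduct_smul, smul_eq_mul]

/-- The matrix is totally positive up to a common sign of its maximal minors. -/
def ProjPos {k n : ℕ} (A : Matrix (Fin k) (Fin n) ℝ) : Prop :=
  ∃ e : ℝ, e ≠ 0 ∧ PosMinors e A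

lemma ProjPos.mul {k n : ℕ} {A : Matrix (Fin k) (Fin n) ℝ} (h : ProjPos A)
    {g : Matrix (Fin k) (Fin k) ℝ} (hg : g.det ≠ 0) : ProjPos (g * A) := by
  obtain ⟨e, he, h⟩ := h
  refine ⟨e / g.det, div_ne_zero he hg, fun t ht => ?_⟩
  rw [tupleMinor_mul]
  convert h t ht using 1
  field_simp

lemma altSign_mul {k n : ℕ} (g : Matrix (Fin k) (Fin k) ℝ) (A : Matrix (Fin k) (Fin n) ℝ) :
    altSign (g * A) = g * altSign A := by
  ext a c
  simp only [altSign_apply, Matrix.mul_apply, Finset.mul_sum]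
  exact Finset.sum_congr rfl fun b _ => by ring

/-! ### The twist of the trigonometric matrix -/

section base
variable {n : ℕ} [NeZero n]

/-- The extension of the stacked trigonometric columns to all integers. -/
noncomputable def trigStack (n k l : ℕ) (x : ℤ) : Fin k ⊕ Fin l → ℝ :=
  Sum.elim (trigVec n k x) (((-1 : ℝ) ^ x) • trigVec n l x)

/-- A shift by `n` changes the upper block by `(-1) ^ (k - 1)` and the lower one by `(-1) ^ (l - 1 +
n)`. Since `n = k + l + m` and `m` is even, the signs agree, and the periodic columns are multiples
of one curve. -/
lemma exists_ucol_trig {k l m : ℕ} (hn : k + l + m = n) (hm : Even m) (t : ℤ) :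
    ∃ c : ℝ, c ≠ 0 ∧
      ucol (fromRows (trig k n) (altSign (trig l n))) t = c • trigStack n k l (t - 1) := by
  obtain ⟨q, hq⟩ := idx_eq_iff.1 (idx_coe_add_one (idx n t))
  have ht : t - 1 = ((idx n t : ℕ) : ℤ) + q * n := by linarith
  have hn0 : n ≠ 0 := NeZero.ne n
  obtain ⟨m', rfl⟩ := hm
  have h1 : (-1 : ℝ) ^ (t - 1) * (-1 : ℝ) ^ (q * ((l : ℤ) + 1)) =
      (-1) ^ ((idx n t : ℕ) : ℤ) * (-1) ^ (q * ((k : ℤ) + 1)) := by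
    rw [ht, ← zpow_add₀ (by norm_num), ← zpow_add₀ (by norm_num)]
    have : ((idx n t : ℕ) : ℤ) + q * n + q * ((l : ℤ) + 1) =
        ((idx n t : ℕ) : ℤ) + q * ((k : ℤ) + 1) + 2 * (q * (l + m')) := by
      have h2 : (n : ℤ) = k + l + (m' + m') := by exact_mod_cast hn.symm
      linear_combination q * h2
    rw [this, zpow_add₀ (by norm_num), _root_.zpow_mul (-1 : ℝ) 2]
    norm_num
  have h2 : ((-1 : ℝ) ^ (q * ((k : ℤ) + 1))) * ((-1 : ℝ) ^ (q * ((k : ℤ) + 1))) = 1 := by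
    rw [← mul_zpow]; norm_num
  refine ⟨(-1) ^ (q * ((k : ℤ) + 1)), zpow_ne_zero _ (by norm_num), ?_⟩
  have h3 : ∀ d, trigVec n d (t - 1) = ((-1 : ℝ) ^ (q * ((d : ℤ) + 1))) •
      trigVec n d ((idx n t : ℕ) : ℤ) := fun d => by rw [ht, trigVec_add_mul hn0]
  ext (a | a)
  · simp only [trigStack, h3, Pi.smul_apply, Sum.elim_inl, smul_eq_mul, fromRows_apply_inl]
    rw [← mul_assoc, h2, one_mul]
    rfl
  · simp only [trigStack, h3, Pi.smul_apply, Sum.elim_inr, smul_eq_mul, fromRows_apply_inr,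
      altSign_apply]
    rw [← mul_assoc _ _ (trigVec n l _ a), h1]
    rw [show ∀ x y z : ℝ, x * (y * x * z) = (x * x) * (y * z) from fun _ _ _ => by ring, h2,
      one_mul, zpow_natCast]
    rfl

lemma neg_one_zpow_sub_mul (x y : ℤ) : (-1 : ℝ) ^ y * (-1) ^ (x - y) = (-1) ^ x := by
  rw [← zpow_add₀ (by norm_num)]; congr 1; ring

/-- There is a choice of scaling factors and a base point at which the twist has the expected
positivity. -/
theorem exists_twist_base {k l m : ℕ} [NeZero (k + l)] (hn : k + l + m = n) (hm : Even m)
    (e : Fin k ⊕ Fin l ≃ Fin (k + l)) :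
    ∃ (s : Fin n → ℝ) (V X : Matrix (Fin k) (Fin n) ℝ) (W Y : Matrix (Fin l) (Fin n) ℝ)
      (Z : Matrix (Fin (k + m)) (Fin n) ℝ), (∀ c, s c ≠ 0) ∧ PosMinors 1 V ∧ PosMinors 1 Z ∧
      IsKernelMatrix Z W ∧ twist e l s (fromRows V W) = fromRows X Y ∧
      ProjPos (altSign X) ∧ ProjPos Y := by
  obtain ⟨Z, hZ, hW⟩ := exists_posMinors_orthogonal (p := k + m) (l := l) (n := n) (by omega)
    (posMinors_trig l n)
  have hV := posMinors_trig k n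
  set W := altSign (trig l n) with hWdef
  set V := trig k n with hVdef
  have hVn : Nondeg k V := hV.nondeg (by omega)
  have hWn : Nondeg l W := hW.nondeg (by omega) hZ
  have hU : Nondeg (k + l) (fromRows V W) :=
    nondeg_fromRows hn hm one_ne_zero hV.nonneg (fun j => hVn.ivlRank_of_le (by omega) j) hZ hW
  have h1 := hU.isTwist_twist (k := k) (l := l) e (s := fun _ => 1) (fun _ => one_ne_zero)
  -- The twist column at position `1` determines all others by translation along the curve; position
  -- `t` corresponds to the parameter `t - 1`.
  set q : Fin k ⊕ Fin l → ℝ := ucol (twist e l (fun _ => 1) (fromRows V W)) 1 with hq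
  have hq0 : ∀ x : ℤ, -l < x → x < k → q ⬝ᵥ trigStack n k l x = 0 := by
    intro x h2 h3
    obtain ⟨c, hc, h4⟩ := exists_ucol_trig hn hm (x + 1)
    have h5 := h1.1 1 (x + 1) (by omega) (by omega)
    rw [h4, dotProduct_smul, smul_eq_mul, add_sub_cancel_right] at h5
    exact (mul_eq_zero.1 h5).resolve_left hc
  have hq1 : q ⬝ᵥ trigStack n k l (-l) ≠ 0 := by
    intro h0
    obtain ⟨c, hc, h4⟩ := exists_ucol_trig hn hm (1 - l)
    have h5 := h1.ne_zero hU 1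
    rw [h4, dotProduct_smul, show (1 - l - 1 : ℤ) = -l by ring, h0] at h5
    simp at h5
  obtain ⟨N, hN⟩ := exists_dotProduct_trigVec_sub n k (q ∘ Sum.inl)
  obtain ⟨N', hN'⟩ := exists_dotProduct_trigVec_sub n l (q ∘ Sum.inr)
  set X := altSign (N * V) with hX
  set Y := N' * trig l n with hY
  -- Up to sign, column `c` of the candidate pairs with the curve as the translate of `q` by `c`
  -- does, so the normality of `q` carries over to it.
  have hT : ∀ (c : Fin n) (x : ℤ), colv (fromRows X Y) c ⬝ᵥ trigStack n k l x =
      (-1) ^ ((c : ℕ) : ℤ) * (q ⬝ᵥ trigStack n k l (x - (c : ℕ))) := by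
    intro c x
    have e1 : ∀ (f : Fin k ⊕ Fin l → ℝ) (y : ℤ), f ⬝ᵥ trigStack n k l y =
        (f ∘ Sum.inl) ⬝ᵥ trigVec n k y + (-1) ^ y * ((f ∘ Sum.inr) ⬝ᵥ trigVec n l y) := by
      intro f y
      simp only [dotProduct, Fintype.sum_sum_type, trigStack, Sum.elim_inl, Sum.elim_inr,
        Pi.smul_apply, smul_eq_mul, Function.comp, Finset.mul_sum]
      congr 1
      exact Finset.sum_congr rfl fun b _ => by ring
    have e2 : colv (fromRows X Y) c ∘ Sum.inl =
        ((-1 : ℝ) ^ ((c : ℕ) : ℤ)) • (N *ᵥ trigVec n k ((c : ℕ) : ℤ)) := by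
      ext a
      simp only [Function.comp, fromRows_apply_inl, hX, altSign_apply, Pi.smul_apply, smul_eq_mul,
        zpow_natCast]
      rfl
    have e3 : colv (fromRows X Y) c ∘ Sum.inr = N' *ᵥ trigVec n l ((c : ℕ) : ℤ) := by
      ext a
      simp only [Function.comp, fromRows_apply_inr, hY]
      rfl
    rw [e1, e1, hN, hN', e2, e3, smul_dotProduct, smul_eq_mul, mul_add, ← mul_assoc ((-1) ^ _) _ (_ ⬝ᵥ _),
      neg_one_zpow_sub_mul]
  have hTw : IsTwist k l (fromRows V W) (fromRows X Y) := by
    refine ⟨fun j t h2 h3 => ?_, fun j h0 => ?_⟩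
    · obtain ⟨p, hp⟩ := idx_eq_iff.1 (idx_coe_add_one (idx n j))
      obtain ⟨c, hc, h4⟩ := exists_ucol_trig hn hm (t - p * n)
      have h5 : ucol (fromRows V W) t = ucol (fromRows V W) (t - p * n) := by
        have : idx n (t - p * n) = idx n t := by rw [idx_eq_iff]; exact ⟨p, by ring⟩
        rw [ucol, ucol, this]
      rw [h5, h4, dotProduct_smul, hT, hq0 _ (by linarith) (by linarith)]
      simp
    · have h2 := hT (idx n j) (-l + (idx n j : ℕ))
      rw [show colv (fromRows X Y) (idx n j) = 0 from h0, zero_dotProduct,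
        add_sub_cancel_right] at h2
      exact mul_ne_zero (zpow_ne_zero _ (by norm_num)) hq1 h2.symm
  -- The candidate and the unscaled twist satisfy the same normality conditions; the scaling factors
  -- are the ratios of their columns.
  choose s hs0 hs using fun c : Fin n => h1.exists_smul hU hTw ((c : ℤ) + 1)
  refine ⟨s, V, X, W, Y, Z, hs0, hV, hZ, hW, ?_, ?_, ?_⟩
  · ext a c
    have h2 := congrFun (hs c) a
    rw [ucol, ucol, idx_coe_add_one] at h2
    rw [show fromRows X Y a c = colv (fromRows X Y) c a from rfl, h2]
    simp [twist]
  -- The upper block with alternated signs is `N * V`. A singular `N` would contradict its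
  -- nondegeneracy, so it is a row operation on a totally positive matrix. The lower block is
  -- treated alike.
  · have h2 := hTw.nondeg_upper hU hWn
    rw [hX, altSign_altSign]
    refine ProjPos.mul ⟨1, one_ne_zero, hV⟩ fun h0 => ?_
    rw [← Matrix.exists_vecMul_eq_zero_iff] at h0
    obtain ⟨φ, hφ, h3⟩ := h0
    refine hφ (h2 0 φ fun t _ _ => ?_)
    change (φ ᵥ* X) (idx n t) = 0
    rw [hX, altSign_mul, ← Matrix.vecMul_vecMul, h3, Matrix.zero_vecMul]; rfl
  · have h2 := hTw.nondeg_lower hU hVn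
    refine ProjPos.mul ⟨1, one_ne_zero, posMinors_trig l n⟩ fun h0 => ?_
    rw [← Matrix.exists_vecMul_eq_zero_iff] at h0
    obtain ⟨φ, hφ, h3⟩ := h0
    refine hφ (h2 0 φ fun t _ _ => ?_)
    change (φ ᵥ* Y) (idx n t) = 0
    rw [hY, ← Matrix.vecMul_vecMul, h3, Matrix.zero_vecMul]; rfl

end base
end Amplituhedron

namespace Amplituhedron
open Matrix Equiv Filter Topology

/-! ## Change of basis -/

/-- The matrix is totally nonnegative up to a common sign of its maximal minors. -/
def ProjNonneg {k n : ℕ} (A : Matrix (Fin k) (Fin n) ℝ) : Prop :=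
  ∃ e : ℝ, e ≠ 0 ∧ NonnegMinors e A

lemma PosMinors.of_sign {k n : ℕ} {e e' : ℝ} (h : 0 < e * e') {A : Matrix (Fin k) (Fin n) ℝ}
    (hA : PosMinors e A) : PosMinors e' A := fun t ht => by
  have h1 := mul_pos h (hA t ht)
  have he : 0 < e ^ 2 := by
    have : e ≠ 0 := by rintro rfl; simp at h
    positivity
  refine pos_of_mul_pos_right (?_ : 0 < e ^ 2 * _) he.le
  linarith [h1]

lemma NonnegMinors.of_sign {k n : ℕ} {e e' : ℝ} (h : 0 < e * e') {A : Matrix (Fin k) (Fin n) ℝ}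
    (hA : NonnegMinors e A) : NonnegMinors e' A := fun t => by
  have h1 := mul_nonneg h.le (hA t)
  have he : 0 < e ^ 2 := by
    have : e ≠ 0 := by rintro rfl; simp at h
    positivity
  refine nonneg_of_mul_nonneg_right (?_ : 0 ≤ e ^ 2 * _) he
  linarith [h1]

lemma projPos_iff {k n : ℕ} {A : Matrix (Fin k) (Fin n) ℝ} :
    ProjPos A ↔ PosMinors 1 A ∨ PosMinors (-1) A := by
  constructor
  · rintro ⟨e, he, h⟩
    rcases he.lt_or_gt with he | he
    · exact Or.inr (h.of_sign (by linarith))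
    · exact Or.inl (h.of_sign (by linarith))
  · rintro (h | h)
    · exact ⟨1, by norm_num, h⟩
    · exact ⟨-1, by norm_num, h⟩

lemma projNonneg_iff {k n : ℕ} {A : Matrix (Fin k) (Fin n) ℝ} :
    ProjNonneg A ↔ NonnegMinors 1 A ∨ NonnegMinors (-1) A := by
  constructor
  · rintro ⟨e, he, h⟩
    rcases he.lt_or_gt with he | he
    · exact Or.inr (h.of_sign (by linarith))
    · exact Or.inl (h.of_sign (by linarith))
  · rintro (h | h)
    · exact ⟨1, by norm_num, h⟩
    · exact ⟨-1, by norm_num, h⟩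

lemma isOpen_projPos (k n : ℕ) : IsOpen {A : Matrix (Fin k) (Fin n) ℝ | ProjPos A} := by
  simp only [projPos_iff, Set.ofPred_or]
  exact (isOpen_posMinors _ _ _).union (isOpen_posMinors _ _ _)

lemma isClosed_projNonneg (k n : ℕ) : IsClosed {A : Matrix (Fin k) (Fin n) ℝ | ProjNonneg A} := by
  simp only [projNonneg_iff, Set.ofPred_or]
  exact (isClosed_nonnegMinors _ _ _).union (isClosed_nonnegMinors _ _ _)

lemma ProjPos.projNonneg {k n : ℕ} {A : Matrix (Fin k) (Fin n) ℝ} (h : ProjPos A) :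
    ProjNonneg A := by
  obtain ⟨e, he, h⟩ := h
  exact ⟨e, he, h.nonneg⟩

lemma ProjPos.exists_mul {k n : ℕ} {A : Matrix (Fin k) (Fin n) ℝ} (h : ProjPos A) :
    ∃ g : Matrix (Fin k) (Fin k) ℝ, g.det ≠ 0 ∧ PosMinors 1 (g * A) := by
  obtain ⟨e, he, h⟩ := h
  obtain ⟨g, h1, h2⟩ := exists_posMinors_one h
  exact ⟨g, h2 he, h1⟩

/-- Row operations turn the first columns of a totally positive matrix into the identity. -/
lemma PosMinors.exists_normalized {p n : ℕ} (hpn : p ≤ n) {A : Matrix (Fin p) (Fin n) ℝ}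
    (h : PosMinors 1 A) : ∃ g : Matrix (Fin p) (Fin p) ℝ, g.det ≠ 0 ∧ g * A ∈ normalizedTP p n := by
  have h0 := h.pos (Fin.strictMono_castLE hpn)
  rw [one_mul] at h0
  set B := A.submatrix id (Fin.castLE hpn) with hB
  have h1 : 0 < B.det := h0
  have hu : IsUnit B.det := h1.ne'.isUnit
  refine ⟨B⁻¹, ?_, ?_, ?_⟩
  · rw [Matrix.det_nonsing_inv]; simpa using h1.ne'
  · intro a b hb
    rw [← Matrix.nonsing_inv_mul B hu]
    rfl
  · intro t ht
    rw [tupleMinor_mul, Matrix.det_nonsing_inv, Ring.inverse_eq_inv', one_mul, mul_assoc]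
    have := h t ht
    rw [one_mul] at this
    positivity

/-- The explicit kernel matrix of a matrix whose first columns form the identity. -/
def kernelMatrix {p l n : ℕ} (hn : p + l = n) (Z : Matrix (Fin p) (Fin n) ℝ) :
    Matrix (Fin l) (Fin n) ℝ :=
  Matrix.of fun b c => if h : (c : ℕ) < p then -Z ⟨c, h⟩ ⟨p + b, by omega⟩
    else if (c : ℕ) = p + b then 1 else 0

lemma continuous_kernelMatrix {p l n : ℕ} (hn : p + l = n) : Continuous (kernelMatrix hn) := by
  refine continuous_pi fun b => continuous_pi fun c => ?_
  simp only [kernelMatrix, Matrix.of_apply]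
  split_ifs <;> fun_prop

lemma isKernelMatrix_kernelMatrix {p l n : ℕ} (hn : p + l = n) {Z : Matrix (Fin p) (Fin n) ℝ}
    (hZ : ∀ a b : Fin p, ∀ h : (b : ℕ) < n, Z a ⟨b, h⟩ = (1 : Matrix (Fin p) (Fin p) ℝ) a b) :
    IsKernelMatrix Z (kernelMatrix hn Z) := by
  subst hn
  constructor
  · ext a b
    rw [Matrix.mul_apply, Fin.sum_univ_add]
    have h1 : ∀ c : Fin p, Z a (Fin.castAdd l c) = (1 : Matrix (Fin p) (Fin p) ℝ) a c :=
      fun c => hZ a c (by omega)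
    simp only [h1, Matrix.transpose_apply, kernelMatrix, Matrix.of_apply, Fin.val_castAdd,
      Fin.val_natAdd, Fin.is_lt, dif_pos]
    simp only [Matrix.one_apply, ite_mul, one_mul, zero_mul, Finset.sum_ite_eq, Finset.mem_univ,
      if_true, Nat.not_lt.2 (Nat.le_add_right p _), dif_neg, not_false_eq_true, Fin.eta,
      Nat.add_left_cancel_iff, mul_ite, mul_one, mul_zero, Fin.val_inj, Finset.sum_ite_eq]
    simp [Fin.natAdd]
  · intro β h
    ext b
    have h1 := congrFun h (Fin.natAdd p b)
    simpa [Matrix.vecMul, dotProduct, kernelMatrix, Fin.val_inj] using h1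

lemma IsKernelMatrix.exists_vecMul {p l n : ℕ} (hn : p + l = n) {Z : Matrix (Fin p) (Fin n) ℝ}
    {W : Matrix (Fin l) (Fin n) ℝ} (h : IsKernelMatrix Z W) (hZ : PosMinors 1 Z) {x : Fin n → ℝ}
    (hx : Z *ᵥ x = 0) : ∃ β, x = β ᵥ* W := by
  set y : Fin l → Fin n := Fin.castLE (by omega)
  have hy : Function.Injective y := Fin.castLE_injective _
  set B := W.submatrix id y
  have hB : ∀ β, β ᵥ* B = 0 → β = 0 := fun β hβ =>
    h.eq_zero_of_vanish hn hZ hy fun b => congrFun hβ b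
  have hu : IsUnit B.det := by
    rw [isUnit_iff_ne_zero, ne_eq, ← Matrix.exists_vecMul_eq_zero_iff]
    rintro ⟨β, h0, h1⟩
    exact h0 (hB β h1)
  refine ⟨(x ∘ y) ᵥ* B⁻¹, ?_⟩
  rw [← sub_eq_zero]
  refine hZ.eq_zero_of_mulVec hn (y := y) ?_ hy fun b => ?_
  · rw [Matrix.mulVec_sub, hx, h.mulVec, sub_zero]
  · have h1 : ((x ∘ y) ᵥ* B⁻¹) ᵥ* B = x ∘ y := by
      rw [Matrix.vecMul_vecMul, Matrix.nonsing_inv_mul _ hu, Matrix.vecMul_one]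
    have h2 := congrFun h1 b
    rw [Pi.sub_apply, sub_eq_zero]
    exact h2.symm

lemma IsKernelMatrix.exists_mul {p l n : ℕ} (hn : p + l = n) {Z : Matrix (Fin p) (Fin n) ℝ}
    {W W' : Matrix (Fin l) (Fin n) ℝ} (h : IsKernelMatrix Z W) (h' : IsKernelMatrix Z W')
    (hZ : PosMinors 1 Z) : ∃ g : Matrix (Fin l) (Fin l) ℝ, g.det ≠ 0 ∧ W' = g * W := by
  have h1 : ∀ b, ∃ β, W' b = β ᵥ* W := fun b => by
    have h2 := h'.mulVec (Pi.single b 1)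
    rw [Matrix.single_one_vecMul] at h2
    exact h.exists_vecMul hn hZ h2
  choose g hg using h1
  refine ⟨Matrix.of g, fun h0 => ?_, ?_⟩
  · rw [← Matrix.exists_vecMul_eq_zero_iff] at h0
    obtain ⟨β, hβ, h0⟩ := h0
    refine hβ (h'.2 β ?_)
    have : W' = Matrix.of g * W := by ext b c; rw [hg]; rfl
    rw [this, ← Matrix.vecMul_vecMul, h0, Matrix.zero_vecMul]
  · ext b c; rw [hg]; rfl

lemma IsKernelMatrix.mul_left {p l n : ℕ} {Z : Matrix (Fin p) (Fin n) ℝ}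
    {W : Matrix (Fin l) (Fin n) ℝ} (h : IsKernelMatrix Z W) (g : Matrix (Fin p) (Fin p) ℝ) :
    IsKernelMatrix (g * Z) W :=
  ⟨by rw [Matrix.mul_assoc, h.1, Matrix.mul_zero], h.2⟩

lemma continuous_toRows₁ {k l n : ℕ} :
    Continuous fun A : Matrix (Fin k ⊕ Fin l) (Fin n) ℝ => A.toRows₁ :=
  continuous_pi fun a => continuous_pi fun c => by simp only [toRows₁_apply]; fun_prop

lemma continuous_toRows₂ {k l n : ℕ} :
    Continuous fun A : Matrix (Fin k ⊕ Fin l) (Fin n) ℝ => A.toRows₂ :=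
  continuous_pi fun a => continuous_pi fun c => by simp only [toRows₂_apply]; fun_prop

lemma continuous_altSign {k n : ℕ} :
    Continuous fun A : Matrix (Fin k) (Fin n) ℝ => altSign A :=
  continuous_pi fun a => continuous_pi fun c => by simp only [altSign_apply]; fun_prop

/-! ### Positivity of the two blocks of the twist -/

section twist
variable {n : ℕ} [NeZero n]

/-- The effect of a block triangular change of basis on the twist. -/
lemma twist_fromBlocks {k l r : ℕ} [NeZero r] (e : Fin k ⊕ Fin l ≃ Fin r) {s : Fin n → ℝ}
    {V X : Matrix (Fin k) (Fin n) ℝ} {W Y : Matrix (Fin l) (Fin n) ℝ} {a : Matrix (Fin k) (Fin k) ℝ}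
    (b : Matrix (Fin k) (Fin l) ℝ) {h : Matrix (Fin l) (Fin l) ℝ} (ha : a.det ≠ 0) (hh : h.det ≠ 0)
    (hT : twist e l s (fromRows V W) = fromRows X Y) :
    twist e l s (fromRows (a * V + b * W) (h * W)) =
      fromRows (((a.det * h.det) • a⁻¹)ᵀ * X)
        (((a.det * h.det) • h⁻¹)ᵀ * Y - ((a.det * h.det) • (a⁻¹ * b * h⁻¹))ᵀ * X) := by
  have hua : IsUnit a := by rw [Matrix.isUnit_iff_isUnit_det]; exact ha.isUnit
  have huh : IsUnit h := by rw [Matrix.isUnit_iff_isUnit_det]; exact hh.isUnit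
  have h1 : fromRows (a * V + b * W) (h * W) = fromBlocks a b 0 h * fromRows V W := by
    rw [fromBlocks_mul_fromRows, Matrix.zero_mul, zero_add]
  -- The transpose of this block upper triangular matrix is block lower triangular: `X` changes by
  -- an invertible factor only, while `Y` also acquires a multiple of `X`.
  have h2 : (fromBlocks a b 0 h).adjugate = (a.det * h.det) • fromBlocks a⁻¹ (-(a⁻¹ * b * h⁻¹)) 0 h⁻¹ := by
    rw [← inv_fromBlocks_zero₂₁_of_isUnit_iff _ _ _ (iff_of_true hua huh), Matrix.inv_def,
      Matrix.det_fromBlocks_zero₂₁, smul_smul, Ring.inverse_eq_inv',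
      mul_inv_cancel₀ (mul_ne_zero ha hh), one_smul]
  rw [h1, twist_mul, h2, hT, Matrix.fromBlocks_smul, Matrix.fromBlocks_transpose,
    fromBlocks_mul_fromRows, smul_zero, Matrix.transpose_zero, Matrix.zero_mul, add_zero]
  congr 1
  rw [smul_neg, Matrix.transpose_neg, Matrix.neg_mul, neg_add_eq_sub]

lemma Nondeg.altSign {k : ℕ} {X : Matrix (Fin k) (Fin n) ℝ} (h : Nondeg k X) :
    Nondeg k (altSign X) := by
  intro j φ hφ
  refine h j φ fun t h1 h2 => ?_
  have h3 := hφ t h1 h2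
  have h4 : ucol (Amplituhedron.altSign X) t = ((-1 : ℝ) ^ (idx n t : ℕ)) • ucol X t := rfl
  rw [h4, dotProduct_smul, smul_eq_mul] at h3
  exact (mul_eq_zero.1 h3).resolve_left (pow_ne_zero _ (by norm_num))

lemma ProjNonneg.projPos {k : ℕ} {A : Matrix (Fin k) (Fin n) ℝ} (h : ProjNonneg A)
    (hA : Nondeg k A) : ProjPos A := by
  obtain ⟨e, he, h⟩ := h
  exact ⟨e, he, h.posMinors he hA⟩

/-- Both parts of the twist have the expected positivity. -/
def TwistPos {k l r : ℕ} [NeZero r] (e : Fin k ⊕ Fin l ≃ Fin r) (s : Fin n → ℝ)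
    (V : Matrix (Fin k) (Fin n) ℝ) (W : Matrix (Fin l) (Fin n) ℝ) : Prop :=
  ProjPos (altSign (twist e l s (fromRows V W)).toRows₁) ∧
    ProjPos (twist e l s (fromRows V W)).toRows₂

lemma TwistPos.mul {k l r : ℕ} [NeZero r] {e : Fin k ⊕ Fin l ≃ Fin r} {s : Fin n → ℝ}
    {V : Matrix (Fin k) (Fin n) ℝ} {W : Matrix (Fin l) (Fin n) ℝ} (h : TwistPos e s V W)
    {a : Matrix (Fin k) (Fin k) ℝ} {g : Matrix (Fin l) (Fin l) ℝ} (ha : a.det ≠ 0)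
    (hg : g.det ≠ 0) : TwistPos e s (a * V) (g * W) := by
  have h1 := twist_fromBlocks e (s := s) (V := V) (W := W) 0 ha hg (fromRows_toRows _).symm
  rw [Matrix.zero_mul, add_zero] at h1
  have hd := mul_ne_zero ha hg
  rw [TwistPos, h1, toRows₁_fromRows, toRows₂_fromRows, altSign_mul]
  simp only [Matrix.mul_zero, Matrix.zero_mul, smul_zero, Matrix.transpose_zero, sub_zero]
  refine ⟨h.1.mul ?_, h.2.mul ?_⟩
  · rw [Matrix.det_transpose, Matrix.det_smul, Matrix.det_nonsing_inv, Ring.inverse_eq_inv']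
    exact mul_ne_zero (pow_ne_zero _ hd) (inv_ne_zero ha)
  · rw [Matrix.det_transpose, Matrix.det_smul, Matrix.det_nonsing_inv, Ring.inverse_eq_inv']
    exact mul_ne_zero (pow_ne_zero _ hd) (inv_ne_zero hg)

lemma twistPos_mul_iff {k l r : ℕ} [NeZero r] {e : Fin k ⊕ Fin l ≃ Fin r} {s : Fin n → ℝ}
    {V : Matrix (Fin k) (Fin n) ℝ} {W : Matrix (Fin l) (Fin n) ℝ}
    {a : Matrix (Fin k) (Fin k) ℝ} {g : Matrix (Fin l) (Fin l) ℝ} (ha : a.det ≠ 0)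
    (hg : g.det ≠ 0) : TwistPos e s (a * V) (g * W) ↔ TwistPos e s V W := by
  refine ⟨fun h => ?_, fun h => h.mul ha hg⟩
  have h1 := h.mul (a := a⁻¹) (g := g⁻¹)
    (by rw [Matrix.det_nonsing_inv]; simpa using ha) (by rw [Matrix.det_nonsing_inv]; simpa using hg)
  rwa [← Matrix.mul_assoc, ← Matrix.mul_assoc, Matrix.nonsing_inv_mul _ ha.isUnit,
    Matrix.nonsing_inv_mul _ hg.isUnit, Matrix.one_mul, Matrix.one_mul] at h1

lemma continuous_twist_kernelMatrix {k l m r : ℕ} [NeZero r] (hn : k + m + l = n)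
    (e : Fin k ⊕ Fin l ≃ Fin r) (s : Fin n → ℝ) :
    Continuous fun p : Matrix (Fin k) (Fin n) ℝ × Matrix (Fin (k + m)) (Fin n) ℝ =>
      twist e l s (fromRows p.1 (kernelMatrix hn p.2)) := by
  refine (continuous_twist e l s).comp ?_
  refine continuous_pi fun a => continuous_pi fun c => ?_
  have := continuous_kernelMatrix hn
  rcases a with a | a
  · simp only [fromRows_apply_inl]; fun_prop
  · simp only [fromRows_apply_inr]
    exact (this.comp continuous_snd).matrix_elem a c

lemma nondeg_twist {k l m : ℕ} [NeZero (k + l)] (hn : k + l + m = n)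
    (e : Fin k ⊕ Fin l ≃ Fin (k + l)) {s : Fin n → ℝ} (hs : ∀ c, s c ≠ 0)
    {V : Matrix (Fin k) (Fin n) ℝ} {W : Matrix (Fin l) (Fin n) ℝ}
    {Z : Matrix (Fin (k + m)) (Fin n) ℝ} (hU : Nondeg (k + l) (fromRows V W)) (hZ : PosMinors 1 Z)
    (hW : IsKernelMatrix Z W) :
    Nondeg k (altSign (twist e l s (fromRows V W)).toRows₁) ∧
      (Nondeg k V → Nondeg l (twist e l s (fromRows V W)).toRows₂) := by
  have h1 := hU.isTwist_twist (k := k) (l := l) e hs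
  rw [← fromRows_toRows (twist e l s (fromRows V W))] at h1
  exact ⟨(h1.nondeg_upper hU (hW.nondeg (by omega) hZ)).altSign, fun hV => h1.nondeg_lower hU hV⟩

lemma isOpen_twistPos {k l m r : ℕ} [NeZero r] (hn : k + m + l = n) (e : Fin k ⊕ Fin l ≃ Fin r)
    (s : Fin n → ℝ) : IsOpen {p : Matrix (Fin k) (Fin n) ℝ × Matrix (Fin (k + m)) (Fin n) ℝ |
      TwistPos e s p.1 (kernelMatrix hn p.2)} := by
  have hc := continuous_twist_kernelMatrix hn e s
  exact IsOpen.and ((isOpen_projPos k n).preimage (continuous_altSign.comp (continuous_toRows₁.comp hc)))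
    ((isOpen_projPos l n).preimage (continuous_toRows₂.comp hc))

lemma projNonneg_of_mem_closure {k l m r : ℕ} [NeZero r] (hn : k + m + l = n)
    (e : Fin k ⊕ Fin l ≃ Fin r) (s : Fin n → ℝ)
    {p : Matrix (Fin k) (Fin n) ℝ × Matrix (Fin (k + m)) (Fin n) ℝ}
    (hp : p ∈ closure {p : Matrix (Fin k) (Fin n) ℝ × Matrix (Fin (k + m)) (Fin n) ℝ |
      TwistPos e s p.1 (kernelMatrix hn p.2)}) :
    ProjNonneg (altSign (twist e l s (fromRows p.1 (kernelMatrix hn p.2))).toRows₁) ∧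
      ProjNonneg (twist e l s (fromRows p.1 (kernelMatrix hn p.2))).toRows₂ := by
  have hc := continuous_twist_kernelMatrix hn e s
  have h1 := (isClosed_projNonneg k n).preimage (continuous_altSign.comp (continuous_toRows₁.comp hc))
  have h2 := (isClosed_projNonneg l n).preimage (continuous_toRows₂.comp hc)
  exact ⟨closure_minimal (fun p hp => hp.1.projNonneg) h1 hp,
    closure_minimal (fun p hp => hp.2.projNonneg) h2 hp⟩

/-- The condition is invariant under row operations on `V` and on `W`, and `W` is determined by `Z`
up to such operations. It can therefore be tested on normalized pairs, which form a connected set.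
-/
lemma TwistPos.exists_normalized {k l m r : ℕ} [NeZero r] (hn : k + m + l = n)
    (e : Fin k ⊕ Fin l ≃ Fin r) (s : Fin n → ℝ) {V : Matrix (Fin k) (Fin n) ℝ}
    {W : Matrix (Fin l) (Fin n) ℝ} {Z : Matrix (Fin (k + m)) (Fin n) ℝ} (hV : PosMinors 1 V)
    (hZ : PosMinors 1 Z) (hW : IsKernelMatrix Z W) :
    ∃ V' ∈ normalizedTP k n, ∃ Z' ∈ normalizedTP (k + m) n,
      (TwistPos e s V' (kernelMatrix hn Z') ↔ TwistPos e s V W) := by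
  obtain ⟨g, hg, hgV⟩ := hV.exists_normalized (by omega)
  obtain ⟨h, hh, hhZ⟩ := hZ.exists_normalized (by omega)
  have h1 := isKernelMatrix_kernelMatrix hn hhZ.1
  obtain ⟨f, hf, hfW⟩ := (hW.mul_left h).exists_mul hn h1 hhZ.2
  exact ⟨_, hgV, _, hhZ, by rw [hfW, twistPos_mul_iff hg hf]⟩

/-- For a suitable choice of scaling factors, the twist of a totally positive matrix stacked with a
kernel matrix of a totally positive matrix has the expected positivity. -/
theorem exists_twistPos {k l m : ℕ} [NeZero (k + l)] (hn : k + l + m = n) (hm : Even m)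
    (e : Fin k ⊕ Fin l ≃ Fin (k + l)) :
    ∃ s : Fin n → ℝ, (∀ c, s c ≠ 0) ∧ ∀ (V : Matrix (Fin k) (Fin n) ℝ) (W : Matrix (Fin l) (Fin n) ℝ)
      (Z : Matrix (Fin (k + m)) (Fin n) ℝ), ProjPos V → PosMinors 1 Z → IsKernelMatrix Z W →
      TwistPos e s V W := by
  obtain ⟨s, V₀, X₀, W₀, Y₀, Z₀, hs, hV₀, hZ₀, hW₀, hT₀, hX₀, hY₀⟩ := exists_twist_base hn hm e
  have hn' : k + m + l = n := by omega
  refine ⟨s, hs, ?_⟩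
  have h0 : TwistPos e s V₀ W₀ := by
    rw [TwistPos, hT₀, toRows₁_fromRows, toRows₂_fromRows]; exact ⟨hX₀, hY₀⟩
  have hS : IsPreconnected (normalizedTP k n ×ˢ normalizedTP (k + m) n) :=
    (isPreconnected_normalizedTP (by omega)).prod (isPreconnected_normalizedTP (by omega))
  -- The good pairs form an open set. In a limit the blocks are totally nonnegative up to sign, and
  -- still nondegenerate, hence totally positive: the good pairs are also relatively closed.
  have hSG := hS.subset_of_closure_inter_subset (isOpen_twistPos hn' e s) (by
      obtain ⟨V', hV', Z', hZ', h⟩ := TwistPos.exists_normalized hn' e s hV₀ hZ₀ hW₀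
      exact ⟨(V', Z'), ⟨hV', hZ'⟩, h.2 h0⟩) (by
      rintro ⟨V, Z⟩ ⟨hcl, hV, hZ⟩
      obtain ⟨h1, h1'⟩ := projNonneg_of_mem_closure hn' e s hcl
      have hW := isKernelMatrix_kernelMatrix hn' hZ.1
      have hVn : Nondeg k V := hV.2.nondeg (by omega)
      have hU := nondeg_fromRows hn hm one_ne_zero hV.2.nonneg
        (fun j => hVn.ivlRank_of_le (by omega) j) hZ.2 hW
      have h2 := nondeg_twist hn e hs hU hZ.2 hW
      exact ⟨h1.projPos h2.1, h1'.projPos (h2.2 hVn)⟩)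
  intro V W Z hV hZ hW
  obtain ⟨g, hg, hgV⟩ := hV.exists_mul
  obtain ⟨V', hV', Z', hZ', h⟩ := TwistPos.exists_normalized hn' e s hgV hZ hW
  have h3 : ((V', Z') : Matrix (Fin k) (Fin n) ℝ × Matrix (Fin (k + m)) (Fin n) ℝ) ∈
      {p : Matrix (Fin k) (Fin n) ℝ × Matrix (Fin (k + m)) (Fin n) ℝ |
        TwistPos e s p.1 (kernelMatrix hn' p.2)} := hSG ⟨hV', hZ'⟩
  have h4 : TwistPos e s V' (kernelMatrix hn' Z') := h3
  have h1 := h.1 h4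
  have h2 := twistPos_mul_iff (e := e) (s := s) (V := V) (W := W) (g := 1) hg (by simp)
  rw [Matrix.one_mul] at h2
  exact h2.1 h1

/-- The totally nonnegative version of `exists_twistPos`. -/
theorem exists_twist_nonneg {k l m : ℕ} [NeZero (k + l)] (hn : k + l + m = n) (hm : Even m)
    (e : Fin k ⊕ Fin l ≃ Fin (k + l)) :
    ∃ s : Fin n → ℝ, (∀ c, s c ≠ 0) ∧ ∀ (V : Matrix (Fin k) (Fin n) ℝ) (W : Matrix (Fin l) (Fin n) ℝ)
      (Z : Matrix (Fin (k + m)) (Fin n) ℝ), ProjNonneg V →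
      (∀ j, ivlRank V j (j + (k + l : ℕ)) = k) → PosMinors 1 Z → IsKernelMatrix Z W →
      ProjPos (altSign (twist e l s (fromRows V W)).toRows₁) ∧
      ProjNonneg (twist e l s (fromRows V W)).toRows₂ := by
  obtain ⟨s, hs, h⟩ := exists_twistPos hn hm e
  refine ⟨s, hs, ?_⟩
  rintro V W Z ⟨ε, hε, hV⟩ hr hZ hW
  have hU := nondeg_fromRows hn hm hε hV hr hZ hW
  have h2 := nondeg_twist hn e hs hU hZ hW
  have hex : ∃ t, tupleMinor V t ≠ 0 := by
    have h3 := hr 0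
    rw [ivlRank_eq_colRank] at h3
    obtain ⟨t, ht, -⟩ := exists_tupleMinor_ne_zero h3.ge
    exact ⟨t, ht⟩
  -- Perturb `V` to a totally positive matrix while keeping `W` fixed, and let `q` tend to zero.
  have h3 : ∀ᶠ q in 𝓝[>] (0 : ℝ), TwistPos e s (V * gaussMatrix n q) W := by
    filter_upwards [eventually_posMinors_mul_gaussMatrix hV hε hex] with q hq
    exact h _ W Z ⟨ε, hε, hq⟩ hZ hW
  have hc : Continuous fun q : ℝ => twist e l s (fromRows (V * gaussMatrix n q) W) := by
    refine (continuous_twist e l s).comp ?_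
    have h4 : Continuous fun q : ℝ => V * gaussMatrix n q :=
      continuous_const.matrix_mul (continuous_gaussMatrix n)
    refine continuous_pi fun a => continuous_pi fun c => ?_
    rcases a with a | a
    · simp only [fromRows_apply_inl]; exact h4.matrix_elem a c
    · simp only [fromRows_apply_inr]; fun_prop
  have hlim : Tendsto (fun q : ℝ => twist e l s (fromRows (V * gaussMatrix n q) W)) (𝓝[>] 0)
      (𝓝 (twist e l s (fromRows V W))) := by
    have h4 := (hc.tendsto 0).mono_left (nhdsWithin_le_nhds (s := Set.Ioi 0))
    simpa [gaussMatrix_zero] using h4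
  constructor
  -- Nondegeneracy of the upper block only uses `W`, so here the limit stays strictly positive; the
  -- lower block may degenerate together with `V`.
  · refine ProjNonneg.projPos ?_ h2.1
    exact (isClosed_projNonneg k n).mem_of_tendsto
      (((continuous_altSign.comp continuous_toRows₁).tendsto _).comp hlim)
      (h3.mono fun q hq => hq.1.projNonneg)
  · exact (isClosed_projNonneg l n).mem_of_tendsto ((continuous_toRows₂.tendsto _).comp hlim)
      (h3.mono fun q hq => hq.2.projNonneg)

end twist
end Amplituhedron

namespace Amplituhedron
open Matrix Equiv Filter Topology

/-! ## Affine permutations -/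

section perm

lemma perm_apply_inv (f : Perm ℤ) (x : ℤ) : f (f⁻¹ x) = x := f.apply_symm_apply x

lemma perm_inv_apply (f : Perm ℤ) (x : ℤ) : f⁻¹ (f x) = x := f.symm_apply_apply x

variable {n : ℕ} {f : Perm ℤ}

lemma IsAffinePerm.apply_add_mul (hf : IsAffinePerm n f) (i q : ℤ) : f (i + q * n) = f i + q * n := by
  induction q using Int.induction_on with
  | zero => simp
  | succ q ih =>
    rw [show i + ((q : ℤ) + 1) * n = i + q * n + n by ring, hf.1, ih]; ring
  | pred q ih =>
    have := hf.1 (i + (-(q : ℤ) - 1) * n)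
    rw [show i + (-(q : ℤ) - 1) * n + n = i + -(q : ℤ) * n by ring, ih] at this
    linarith

lemma IsAffinePerm.symm_add_mul (hf : IsAffinePerm n f) (i q : ℤ) :
    f⁻¹ (i + q * n) = f⁻¹ i + q * n := by
  rw [Perm.inv_eq_iff_eq, hf.apply_add_mul, perm_apply_inv]

lemma sum_Icc_eq_sum_fin (F : ℤ → ℤ) :
    ∑ i ∈ Finset.Icc (1 : ℤ) n, F i = ∑ c : Fin n, F ((c : ℤ) + 1) := by
  symm
  refine Finset.sum_bij (fun c _ => (c : ℤ) + 1) ?_ ?_ ?_ ?_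
  · intro c _
    have := c.isLt
    rw [Finset.mem_Icc]; omega
  · intro a _ b _ h
    ext; omega
  · intro i hi
    rw [Finset.mem_Icc] at hi
    exact ⟨⟨(i - 1).toNat, by omega⟩, Finset.mem_univ _, by simp; omega⟩
  · intro c _; rfl

variable [NeZero n]

/-- The permutation of the residues induced by an affine permutation. -/
def IsAffinePerm.residuePerm (hf : IsAffinePerm n f) : Perm (Fin n) where
  toFun c := idx n (f ((c : ℤ) + 1))
  invFun c := idx n (f⁻¹ ((c : ℤ) + 1))
  left_inv c := by
    obtain ⟨q, hq⟩ := idx_eq_iff.1 (idx_coe_add_one (idx n (f ((c : ℤ) + 1))))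
    have h1 : ((idx n (f ((c : ℤ) + 1)) : ℕ) : ℤ) + 1 = f ((c : ℤ) + 1) + (-q) * n := by linarith
    change idx n (f⁻¹ (((idx n (f ((c : ℤ) + 1)) : ℕ) : ℤ) + 1)) = c
    rw [h1, hf.symm_add_mul, perm_inv_apply, idx_add_mul, idx_coe_add_one]
  right_inv c := by
    obtain ⟨q, hq⟩ := idx_eq_iff.1 (idx_coe_add_one (idx n (f⁻¹ ((c : ℤ) + 1))))
    have h1 : ((idx n (f⁻¹ ((c : ℤ) + 1)) : ℕ) : ℤ) + 1 = f⁻¹ ((c : ℤ) + 1) + (-q) * n := by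
      linarith
    change idx n (f (((idx n (f⁻¹ ((c : ℤ) + 1)) : ℕ) : ℤ) + 1)) = c
    rw [h1, hf.apply_add_mul, perm_apply_inv, idx_add_mul, idx_coe_add_one]

/-- The displacement of the inverse at `f i` is minus that of `f` at `i`; reindex the sum by the
induced permutation of residues. -/
lemma IsAffinePerm.inv (hf : IsAffinePerm n f) : IsAffinePerm n f⁻¹ := by
  refine ⟨fun i => by simpa using hf.symm_add_mul i 1, ?_⟩
  have h1 := hf.2
  rw [sum_Icc_eq_sum_fin] at h1 ⊢
  rw [← Equiv.sum_comp hf.residuePerm]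
  rw [← neg_eq_zero, ← Finset.sum_neg_distrib, ← h1]
  refine Finset.sum_congr rfl fun c _ => ?_
  obtain ⟨q, hq⟩ := idx_eq_iff.1 (idx_coe_add_one (idx n (f ((c : ℤ) + 1))))
  have h2 : ((idx n (f ((c : ℤ) + 1)) : ℕ) : ℤ) + 1 = f ((c : ℤ) + 1) + (-q) * n := by linarith
  change -(f⁻¹ (((idx n (f ((c : ℤ) + 1)) : ℕ) : ℤ) + 1) - (((idx n (f ((c : ℤ) + 1)) : ℕ) : ℤ) + 1)) = _
  rw [h2, hf.symm_add_mul, perm_inv_apply]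
  ring

lemma inv_mem_affinePerms {a b : ℕ} (hf : f ∈ affinePerms n a b) : f⁻¹ ∈ affinePerms n b a := by
  refine ⟨hf.1.inv, fun i => ?_⟩
  have := hf.2 (f⁻¹ i)
  rw [perm_apply_inv] at this
  constructor <;> linarith [this.1, this.2]

/-- The map `(i, j) ↦ (f j, f i)` exchanges the inversions of `f` and of its inverse; a common shift
by a multiple of `n` brings the first entry back to `{1, …, n}`. -/
lemma inv_inv_eq (hf : IsAffinePerm n f) : Amplituhedron.inv n f⁻¹ = Amplituhedron.inv n f := by
  have hn : 0 < (n : ℤ) := by exact_mod_cast NeZero.pos n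
  have hdiv : ∀ x : ℤ, 1 ≤ x - (x - 1) / n * n ∧ x - (x - 1) / n * n ≤ n := fun x => by
    have h1 := Int.emod_add_mul_ediv (x - 1) n
    have h2 := Int.emod_nonneg (x - 1) hn.ne'
    have h3 := Int.emod_lt_of_pos (x - 1) hn
    have h4 : (x - 1) / n * n = n * ((x - 1) / n) := mul_comm _ _
    constructor <;> linarith
  symm
  refine Set.ncard_congr (fun p _ => (f p.2 - (f p.2 - 1) / n * n, f p.1 - (f p.2 - 1) / n * n))
    ?_ ?_ ?_
  · rintro ⟨i, j⟩ ⟨h1, h2, h3, h4⟩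
    refine ⟨(hdiv _).1, (hdiv _).2, by simp only at h4 ⊢; linarith, ?_⟩
    simp only [sub_eq_add_neg, ← neg_mul, hf.symm_add_mul, perm_inv_apply]
    simp only at h3; linarith
  · rintro ⟨i, j⟩ ⟨i', j'⟩ ⟨h1, h2, -, -⟩ ⟨h1', h2', -, -⟩ h
    simp only [Prod.mk.injEq] at h h1 h2 h1' h2'
    set q := (f j - 1) / n
    set q' := (f j' - 1) / n
    have e1 : f j = f (j' + (q - q') * n) := by rw [hf.apply_add_mul]; linarith [h.1]
    have e2 : f i = f (i' + (q - q') * n) := by rw [hf.apply_add_mul]; linarith [h.2]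
    have e3 := f.injective e1
    have e4 := f.injective e2
    have : q - q' = 0 := by
      have h3 : (q - q') * n < 1 * n := by linarith
      have h4 : (-1) * n < (q - q') * n := by linarith
      have := lt_of_mul_lt_mul_right h3 hn.le
      have := lt_of_mul_lt_mul_right h4 hn.le
      omega
    rw [this] at e3 e4
    simp at e3 e4
    rw [e3, e4]
  · rintro ⟨x, y⟩ ⟨h1, h2, h3, h4⟩
    simp only at h1 h2 h3 h4
    set q := (f⁻¹ y - 1) / n
    refine ⟨(f⁻¹ y + (-q) * n, f⁻¹ x + (-q) * n), ⟨?_, ?_, by simp only; linarith, ?_⟩, ?_⟩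
    · have := (hdiv (f⁻¹ y)).1; simp only; linarith
    · have := (hdiv (f⁻¹ y)).2; simp only; linarith
    · simp only [hf.apply_add_mul, perm_apply_inv]; linarith
    · simp only [hf.apply_add_mul, perm_apply_inv, Prod.mk.injEq]
      have h5 : (x + -q * n - 1) / n = -q := by
        rw [show x + -q * n - 1 = x - 1 + -q * n by ring, Int.add_mul_ediv_right _ _ hn.ne',
          Int.ediv_eq_zero_of_lt (by linarith) (by linarith), zero_add]
      rw [h5]
      constructor <;> ring

end perm

/-! ## Gale order and counts -/

/-- Comparing the `r`-th smallest elements for all `r` amounts to comparing the numbers of elements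
below every threshold. -/
lemma forall₂_sort_iff {S T : Finset ℤ} :
    List.Forall₂ (· ≤ ·) (S.sort (· ≤ ·)) (T.sort (· ≤ ·)) ↔ S.card = T.card ∧
      ∀ b, (T.filter (· < b)).card ≤ (S.filter (· < b)).card := by
  have hcount : ∀ {U : Finset ℤ} {k : ℕ} (hU : U.card = k) (b : ℤ),
      (U.filter (· < b)).card = (Finset.univ.filter fun r : Fin k => U.orderEmbOfFin hU r < b).card := by
    intro U k hU b
    rw [← Finset.card_map (U.orderEmbOfFin hU).toEmbedding]
    congr 1
    ext x
    simp only [Finset.mem_filter, Finset.mem_map, Finset.mem_univ, true_and,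
      RelEmbedding.coe_toEmbedding]
    constructor
    · rintro ⟨h1, h2⟩
      have : x ∈ Set.range (U.orderEmbOfFin hU) := by rw [Finset.range_orderEmbOfFin]; exact h1
      obtain ⟨r, rfl⟩ := this
      exact ⟨r, h2, rfl⟩
    · rintro ⟨r, h2, rfl⟩
      exact ⟨Finset.orderEmbOfFin_mem U hU r, h2⟩
  rw [List.forall₂_iff_get]
  simp only [Finset.length_sort]
  refine and_congr_right fun hST => ?_
  have hle : (∀ i (h₁ : i < (S.sort (· ≤ ·)).length) (h₂ : i < (T.sort (· ≤ ·)).length),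
      (S.sort (· ≤ ·)).get ⟨i, h₁⟩ ≤ (T.sort (· ≤ ·)).get ⟨i, h₂⟩) ↔
      ∀ r : Fin T.card, S.orderEmbOfFin hST r ≤ T.orderEmbOfFin rfl r := by
    constructor
    · intro h r
      exact h r (by simp [hST]) (by simp)
    · intro h i h₁ h₂
      exact h ⟨i, by simpa using h₂⟩
  simp only [Finset.length_sort] at hle
  rw [hle]
  constructor
  · intro h b
    rw [hcount hST, hcount rfl]
    exact Finset.card_le_card fun r hr => by
      rw [Finset.mem_filter] at hr ⊢
      exact ⟨hr.1, (h r).trans_lt hr.2⟩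
  · intro h r
    by_contra hlt
    rw [not_le] at hlt
    have h1 := h (S.orderEmbOfFin hST r)
    rw [hcount hST, hcount rfl] at h1
    have h2 : (Finset.univ.filter fun r' : Fin T.card =>
        S.orderEmbOfFin hST r' < S.orderEmbOfFin hST r) = Finset.Iio r := by
      ext r'; simp
    have h3 : Finset.Iic r ⊆ (Finset.univ.filter fun r' : Fin T.card =>
        T.orderEmbOfFin rfl r' < S.orderEmbOfFin hST r) := by
      intro r' hr'
      rw [Finset.mem_Iic] at hr'
      rw [Finset.mem_filter]
      exact ⟨Finset.mem_univ _, ((T.orderEmbOfFin rfl).monotone hr').trans_lt hlt⟩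
    have h4 := Finset.card_le_card h3
    rw [h2] at h1
    simp at h1 h4
    omega

lemma card_filter_Ico_add (p : ℤ → Prop) [DecidablePred p] {i b c : ℤ} (h : i ≤ b) (h' : b ≤ c) :
    ((Finset.Ico i b).filter p).card + ((Finset.Ico b c).filter p).card =
      ((Finset.Ico i c).filter p).card := by
  rw [← Finset.Ico_union_Ico_eq_Ico h h', Finset.filter_union, Finset.card_union_of_disjoint]
  exact Finset.disjoint_filter_filter (Finset.Ico_disjoint_Ico_consecutive _ _ _)

lemma card_filter_Ico_shift (p : ℤ → Prop) [DecidablePred p] (i b d : ℤ) :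
    ((Finset.Ico (i + d) (b + d)).filter p).card =
      ((Finset.Ico i b).filter fun t => p (t + d)).card := by
  symm
  rw [← Finset.card_map (addRightEmbedding d)]
  congr 1
  ext x
  simp only [Finset.mem_filter, Finset.mem_Ico, Finset.mem_map, addRightEmbedding_apply]
  constructor
  · rintro ⟨y, ⟨⟨h1, h2⟩, h3⟩, rfl⟩
    exact ⟨⟨by omega, by omega⟩, h3⟩
  · rintro ⟨⟨h1, h2⟩, h3⟩
    exact ⟨x - d, ⟨⟨by omega, by omega⟩, by simpa using h3⟩, by ring⟩

/-! ### Counting functions of bounded affine permutations -/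

section count
variable {n k l : ℕ} {f : Perm ℤ}

/-- The rank that a matrix in the cell of `f` has on the columns at the positions in `[i, b)`. -/
noncomputable def rankCount (k : ℕ) (f : Perm ℤ) (i b : ℤ) : ℕ :=
  ((Finset.Ico i b).filter fun t => f⁻¹ (t - k) < i).card

lemma rankCount_shift (hf : IsAffinePerm n f) (i b q : ℤ) :
    rankCount k f (i + q * n) (b + q * n) = rankCount k f i b := by
  rw [rankCount, card_filter_Ico_shift, rankCount]
  congr 1
  refine Finset.filter_congr fun t _ => ?_
  rw [show t + q * n - k = t - k + q * n by ring, hf.symm_add_mul, add_lt_add_iff_right]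

/-- A position `t ≥ i + k + l` is never counted, because its preimage is at least `t - k - l`. -/
lemma rankCount_eq_of_le (hf : f ∈ affinePerms n k l) {i b : ℤ} (h : i + (k + l : ℕ) ≤ b) :
    rankCount k f i b = rankCount k f i (i + (k + l : ℕ)) := by
  rw [rankCount, ← card_filter_Ico_add _ (b := i + (k + l : ℕ)) (by omega) h]
  rw [Finset.filter_false_of_mem (s := Finset.Ico (i + (k + l : ℕ)) b), Finset.card_empty, add_zero]
  · rfl
  · intro t ht
    rw [Finset.mem_Ico] at ht
    have := (hf.2 (f⁻¹ (t - k))).2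
    rw [perm_apply_inv] at this
    push_cast at ht
    omega

/-- The duality between the rank functions of `f` and `f⁻¹`. -/
lemma rankCount_inv (hf : f ∈ affinePerms n k l) (hkl : k + l ≤ n)
    (hk : ∀ i : ℤ, rankCount k f i (i + n) = k) (i : ℤ) {s : ℕ} (hs : s ≤ k + l) :
    rankCount l f⁻¹ i (i + s) + k = s + rankCount k f (i - l + s) (i + k) := by
  have h1 : rankCount k f (i - l + s) (i + k) + ((Finset.Ico (i + k) (i - l + s + n)).filter
      fun t => f⁻¹ (t - k) < i - l + s).card = k := by
    rw [rankCount, card_filter_Ico_add _ (by omega) (by omega)]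
    exact hk _
  have h2 : rankCount l f⁻¹ i (i + s) =
      ((Finset.Ico (i - l) (i - l + s)).filter fun u => f u < i).card := by
    have := card_filter_Ico_shift (fun t => f⁻¹⁻¹ (t - l) < i) (i - l) (i - l + s) l
    rw [show i - l + l = i by ring, show i - l + s + l = i + s by ring] at this
    rw [rankCount, this]
    simp
  have h3 : ((Finset.Ico (i - l) (i - l + s)).filter fun u => f u < i).card +
      ((Finset.Ico (i - l) (i - l + s)).filter fun u => ¬ f u < i).card = s := by
    rw [Finset.card_filter_add_card_filter_not]
    simp
  -- The substitution `t = f u + k` matches the two counts: the bounds on `f` and `k + l ≤ n` ensure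
  -- that neither range cuts anything off.
  have h4 : ((Finset.Ico (i + k) (i - l + s + n)).filter fun t => f⁻¹ (t - k) < i - l + s).card =
      ((Finset.Ico (i - l) (i - l + s)).filter fun u => ¬ f u < i).card := by
    symm
    refine Finset.card_bij (fun u _ => f u + k) ?_ ?_ ?_
    · intro u hu
      rw [Finset.mem_filter, Finset.mem_Ico] at hu ⊢
      have := hf.2 u
      rw [add_sub_cancel_right, perm_inv_apply]
      omega
    · intro u _ u' _ h
      exact f.injective (by simpa using h)
    · intro t ht
      rw [Finset.mem_filter, Finset.mem_Ico] at ht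
      refine ⟨f⁻¹ (t - k), ?_, by simp⟩
      have := hf.2 (f⁻¹ (t - k))
      rw [perm_apply_inv] at this
      rw [Finset.mem_filter, Finset.mem_Ico, perm_apply_inv]
      omega
  omega

variable [NeZero n]

/-- The number of positions in `[i, b)` whose column belongs to `S`. -/
noncomputable def posCount (S : Finset (Fin n)) (i b : ℤ) : ℕ :=
  ((Finset.Ico i b).filter fun t => idx n t ∈ S).card

lemma posCount_add (S : Finset (Fin n)) {i b c : ℤ} (h : i ≤ b) (h' : b ≤ c) :
    posCount S i b + posCount S b c = posCount S i c :=
  card_filter_Ico_add _ h h'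

lemma posCount_shift (S : Finset (Fin n)) (i b q : ℤ) :
    posCount S (i + q * n) (b + q * n) = posCount S i b := by
  rw [posCount, card_filter_Ico_shift]
  simp only [idx_add_mul]
  rfl

lemma posCount_eq_card_filter (S : Finset (Fin n)) {i b : ℤ} (h : b ≤ i + n) (p : Fin n → Prop)
    [DecidablePred p] (hp : ∀ t, i ≤ t → t < i + n → (p (idx n t) ↔ t < b)) :
    posCount S i b = (S.filter p).card := by
  refine Finset.card_bij (fun t _ => idx n t) ?_ ?_ ?_
  · intro t ht
    rw [Finset.mem_filter, Finset.mem_Ico] at ht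
    rw [Finset.mem_filter]
    exact ⟨ht.2, (hp t ht.1.1 (by omega)).2 ht.1.2⟩
  · intro t ht t' ht' h1
    rw [Finset.mem_filter, Finset.mem_Ico] at ht ht'
    exact idx_eq_of_lt h1 (by omega) (by omega)
  · intro c hc
    rw [Finset.mem_filter] at hc
    obtain ⟨t, h1, h2, rfl⟩ := exists_idx_window c i
    refine ⟨t, ?_, rfl⟩
    rw [Finset.mem_filter, Finset.mem_Ico]
    exact ⟨⟨h1, (hp t h1 h2).1 hc.2⟩, hc.1⟩

lemma posCount_full (S : Finset (Fin n)) (i : ℤ) : posCount S i (i + n) = S.card := by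
  rw [posCount_eq_card_filter S le_rfl (fun _ => True) (by simp)]
  simp

lemma posCount_eq_card_inter (S : Finset (Fin n)) {i b : ℤ} (h : b ≤ i + n) :
    posCount S i b = (S ∩ cycIvl n i (b - 1)).card := by
  rw [posCount_eq_card_filter S h (fun c => c ∈ cycIvl n i (b - 1)), Finset.filter_mem_eq_inter]
  intro t h1 h2
  rw [mem_cycIvl_iff]
  constructor
  · rintro ⟨t', h3, h4, h5⟩
    have := idx_eq_of_lt h5 (by omega) (by omega)
    omega
  · intro h3
    exact ⟨t, h1, by omega, rfl⟩

lemma cyclicPos_idx {i t : ℤ} (h : i ≤ t) (h' : t < i + n) : cyclicPos i (idx n t) = t - i := by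
  rw [cyclicPos, coe_idx]
  have h1 : (t - 1) % n + 1 - i ≡ t - i [ZMOD n] := by
    have := Int.mod_modEq (t - 1) n
    have := (this.add_right 1).sub_right i
    rwa [sub_add_cancel] at this
  rw [h1.eq]
  exact Int.emod_eq_of_lt (by omega) (by omega)

lemma cyclicPos_injective (i : ℤ) : Function.Injective (cyclicPos (n := n) i) := by
  intro c c' h
  obtain ⟨t, h1, h2, rfl⟩ := exists_idx_window c i
  obtain ⟨t', h3, h4, rfl⟩ := exists_idx_window c' i
  rw [cyclicPos_idx h1 h2, cyclicPos_idx h3 h4] at h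
  congr 1; omega

lemma galeLE_iff {i : ℤ} {S T : Finset (Fin n)} : GaleLE i S T ↔
    S.card = T.card ∧ ∀ b, i ≤ b → b ≤ i + n → posCount T i b ≤ posCount S i b := by
  have h0 : ∀ (U : Finset (Fin n)) (d : ℤ), ((U.image (cyclicPos i)).filter (· < d)).card =
      posCount U i (i + max 0 (min d n)) := by
    intro U d
    rw [Finset.filter_image, Finset.card_image_of_injective _ (cyclicPos_injective i),
      posCount_eq_card_filter U (by omega) (fun c => cyclicPos i c < d)]
    intro t h1 h2
    rw [cyclicPos_idx h1 h2]
    omega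
  rw [GaleLE, forall₂_sort_iff, Finset.card_image_of_injective _ (cyclicPos_injective i),
    Finset.card_image_of_injective _ (cyclicPos_injective i)]
  refine and_congr_right fun _ => ?_
  simp only [h0]
  constructor
  · intro h b h1 h2
    have := h (b - i)
    rwa [show i + max 0 (min (b - i) n) = b by omega] at this
  · intro h d
    exact h _ (by omega) (by omega)

/-- Since `k + l ≤ n`, the values `f j + k` that enter the necklace lie in one period starting at
`i`, so residues can be replaced by positions. -/
lemma idx_mem_necklace (hf : f ∈ affinePerms n k l) (hkl : k + l ≤ n) {i t : ℤ} (h : i ≤ t)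
    (h' : t < i + n) : idx n t ∈ necklace k n f i ↔ f⁻¹ (t - k) < i := by
  simp only [necklace, Finset.mem_filter, Finset.mem_univ, true_and]
  constructor
  · rintro ⟨j, h1, h2, h3⟩
    have h4 : idx n (f j + k) = idx n t := by
      rw [← idx_coe_add_one (idx n t)]
      obtain ⟨q, hq⟩ := h3.dvd
      rw [idx_eq_iff]
      exact ⟨q, by linarith⟩
    have h5 := hf.2 j
    have h6 := idx_eq_of_lt h4 (by omega) (by omega)
    rw [← h6, add_sub_cancel_right, perm_inv_apply]
    exact h1
  · intro h1
    refine ⟨f⁻¹ (t - k), h1, ?_, ?_⟩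
    · rw [perm_apply_inv]; omega
    · rw [perm_apply_inv, sub_add_cancel, coe_idx]
      have := (Int.mod_modEq (t - 1) n).add_right 1
      rw [sub_add_cancel] at this
      exact this.symm

lemma posCount_necklace (hf : f ∈ affinePerms n k l) (hkl : k + l ≤ n) {i i' b : ℤ} (h : i ≤ i')
    (h' : b ≤ i + n) : posCount (necklace k n f i) i' b =
      ((Finset.Ico i' b).filter fun t => f⁻¹ (t - k) < i).card := by
  rw [posCount]
  congr 1
  refine Finset.filter_congr fun t ht => ?_
  rw [Finset.mem_Ico] at ht
  exact idx_mem_necklace hf hkl (by omega) (by omega)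

lemma necklace_shift (hf : f ∈ affinePerms n k l) (hkl : k + l ≤ n) (i q : ℤ) :
    necklace k n f (i + q * n) = necklace k n f i := by
  ext c
  obtain ⟨t, h1, h2, rfl⟩ := exists_idx_window c i
  rw [idx_mem_necklace hf hkl h1 h2, ← idx_add_mul t q,
    idx_mem_necklace hf hkl (by omega) (by omega),
    show t + q * n - k = t - k + q * n by ring, hf.1.symm_add_mul, add_lt_add_iff_right]

/-- In terms of counts, the Gale inequalities bound the number of elements of `J` in each cyclic
interval. The condition on full windows says that every necklace member has `k` elements. -/
lemma mem_positroid_iff (hf : f ∈ affinePerms n k l) (hkl : k + l ≤ n) {J : Finset (Fin n)} :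
    J ∈ positroid k n f ↔ J.card = k ∧ (∀ i : ℤ, rankCount k f i (i + n) = k) ∧
      ∀ i b : ℤ, i ≤ b → b ≤ i + n → posCount J i b ≤ rankCount k f i b := by
  have hneck : ∀ i b : ℤ, b ≤ i + n → posCount (necklace k n f i) i b = rankCount k f i b :=
    fun i b h => posCount_necklace hf hkl le_rfl h
  rw [positroid]
  refine and_congr_right fun hJ => ?_
  simp only [galeLE_iff]
  constructor
  · intro h
    have hi : ∀ i : ℤ, ∃ i₀ q : ℤ, i₀ ∈ Finset.Icc (1 : ℤ) n ∧ i = i₀ + q * n := by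
      intro i
      obtain ⟨q, hq⟩ := idx_eq_iff.1 (idx_coe_add_one (idx n i))
      refine ⟨_, q, ?_, hq⟩
      have := (idx n i).isLt
      rw [Finset.mem_Icc]; omega
    constructor
    · intro i
      obtain ⟨i₀, q, h0, rfl⟩ := hi i
      rw [show i₀ + q * n + n = i₀ + n + q * n by ring, rankCount_shift hf.1, ← hneck _ _ le_rfl,
        posCount_full, (h i₀ h0).1, hJ]
    · intro i b h1 h2
      obtain ⟨i₀, q, h0, rfl⟩ := hi i
      have := (h i₀ h0).2 (b - q * n) (by linarith) (by linarith)
      rwa [← posCount_shift J _ _ q, ← posCount_shift (necklace k n f i₀) _ _ q, sub_add_cancel,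
        ← necklace_shift hf hkl _ q, hneck _ _ h2] at this
  · rintro ⟨h1, h2⟩ i -
    constructor
    · rw [hJ, ← posCount_full _ i, hneck i _ le_rfl, h1 i]
    · intro b h3 h4
      rw [hneck i b h4]
      exact h2 i b h3 h4

/-- These members attain the bounds, which later identifies `rankCount` with the interval ranks of a
matrix in the cell. For `i ≤ i'`, whatever is counted for `i` is also counted for `i'`. -/
lemma necklace_mem_positroid (hf : f ∈ affinePerms n k l) (hkl : k + l ≤ n)
    (hk : ∀ i : ℤ, rankCount k f i (i + n) = k) (i : ℤ) : necklace k n f i ∈ positroid k n f := by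
  have hneck : ∀ i b : ℤ, b ≤ i + n → posCount (necklace k n f i) i b = rankCount k f i b :=
    fun i b h => posCount_necklace hf hkl le_rfl h
  have hcard : ∀ i : ℤ, (necklace k n f i).card = k := fun i => by
    rw [← posCount_full _ i, hneck i _ le_rfl, hk i]
  rw [mem_positroid_iff hf hkl]
  refine ⟨hcard i, hk, ?_⟩
  have main : ∀ i' b : ℤ, i ≤ i' → i' < i + n → i' ≤ b → b ≤ i' + n →
      posCount (necklace k n f i) i' b ≤ rankCount k f i' b := by
    intro i' b h1 h2 h3 h4
    by_cases hb : b ≤ i + n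
    · rw [posCount_necklace hf hkl h1 hb, rankCount]
      refine Finset.card_le_card fun t ht => ?_
      rw [Finset.mem_filter] at ht ⊢
      exact ⟨ht.1, by omega⟩
    -- The interval runs past the period starting at `i`. As both sets have `k` elements, compare
    -- instead the complementary interval, shifted back by `n`.
    · rw [← hneck i' b h4]
      have e1 := posCount_add (necklace k n f i) h3 h4
      have e2 := posCount_add (necklace k n f i') h3 h4
      rw [posCount_full, hcard] at e1 e2
      suffices h5 : posCount (necklace k n f i') b (i' + n) ≤
          posCount (necklace k n f i) b (i' + n) by omega
      rw [posCount_necklace hf hkl h3 le_rfl]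
      have e3 := posCount_shift (necklace k n f i) (b - n) i' 1
      rw [one_mul, sub_add_cancel] at e3
      rw [e3, posCount_necklace hf hkl (by omega) (by omega)]
      have e4 := card_filter_Ico_shift (fun t => f⁻¹ (t - k) < i') (b - n) i' n
      rw [sub_add_cancel] at e4
      rw [e4]
      refine Finset.card_le_card fun t ht => ?_
      rw [Finset.mem_filter] at ht ⊢
      refine ⟨ht.1, ?_⟩
      have := hf.1.symm_add_mul (t - k) 1
      rw [one_mul, show t - k + n = t + n - k by ring] at this
      omega
  intro i' b h1 h2
  obtain ⟨t, h3, h4, h5⟩ := exists_idx_window (idx n i') i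
  obtain ⟨q, hq⟩ := idx_eq_iff.1 h5
  subst hq
  have := main t (b - q * n) h3 h4 (by linarith) (by linarith)
  rwa [← posCount_shift _ _ _ q, sub_add_cancel, ← rankCount_shift hf.1 _ _ q, sub_add_cancel] at this

end count
end Amplituhedron

namespace Amplituhedron
open Matrix Equiv Filter Topology

/-! ## Matrices representing points of positroid cells -/

lemma linearIndependent_row_iff {k n : ℕ} {A : Matrix (Fin k) (Fin n) ℝ} :
    LinearIndependent ℝ A.row ↔ ∀ φ, φ ᵥ* A = 0 → φ = 0 := by
  rw [← Matrix.vecMul_injective_iff]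
  exact injective_iff_map_eq_zero A.vecMulLinear

lemma mem_rowSpan_iff {k n : ℕ} {A : FullRankMatrix k n} {x : Fin n → ℝ} :
    x ∈ (rowSpan A).1 ↔ ∃ φ, φ ᵥ* A.1 = x := by
  change x ∈ Submodule.span ℝ (Set.range A.1.row) ↔ _
  rw [← _root_.range_vecMulLinear, LinearMap.mem_range]
  rfl

lemma linearIndependent_row_mul {k n : ℕ} {g : Matrix (Fin k) (Fin k) ℝ} (hg : g.det ≠ 0)
    {A : Matrix (Fin k) (Fin n) ℝ} (hA : LinearIndependent ℝ A.row) :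
    LinearIndependent ℝ (g * A).row := by
  rw [linearIndependent_row_iff] at hA ⊢
  intro φ hφ
  rw [← Matrix.vecMul_vecMul] at hφ
  by_contra h0
  exact hg (Matrix.exists_vecMul_eq_zero_iff.1 ⟨φ, h0, hA _ hφ⟩)

lemma rowSpan_mul {k n : ℕ} {g : Matrix (Fin k) (Fin k) ℝ} (hg : g.det ≠ 0)
    (A : FullRankMatrix k n) (h : LinearIndependent ℝ (g * A.1).row) :
    rowSpan ⟨g * A.1, h⟩ = rowSpan A := by
  apply Subtype.ext
  ext x
  rw [mem_rowSpan_iff, mem_rowSpan_iff]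
  constructor
  · rintro ⟨φ, rfl⟩
    exact ⟨φ ᵥ* g, by rw [Matrix.vecMul_vecMul]⟩
  · rintro ⟨φ, rfl⟩
    refine ⟨φ ᵥ* g⁻¹, ?_⟩
    rw [Matrix.vecMul_vecMul, ← Matrix.mul_assoc, Matrix.nonsing_inv_mul _ hg.isUnit,
      Matrix.one_mul]

lemma exists_mul_of_forall_row {j k n : ℕ} {A : Matrix (Fin k) (Fin n) ℝ}
    {B : Matrix (Fin j) (Fin n) ℝ} (h : ∀ b, ∃ φ, φ ᵥ* A = B b) : ∃ g : Matrix (Fin j) (Fin k) ℝ, B = g * A := by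
  choose g hg using h
  exact ⟨Matrix.of g, by ext b c; rw [← hg]; rfl⟩

lemma exists_mul_of_rowSpan_eq {k n : ℕ} {A B : FullRankMatrix k n} (h : rowSpan A = rowSpan B) :
    ∃ g : Matrix (Fin k) (Fin k) ℝ, g.det ≠ 0 ∧ B.1 = g * A.1 := by
  obtain ⟨g, hg⟩ := exists_mul_of_forall_row (A := A.1) (B := B.1) fun b => by
    rw [← mem_rowSpan_iff, h, mem_rowSpan_iff]
    exact ⟨Pi.single b 1, Matrix.single_one_vecMul b B.1⟩
  refine ⟨g, fun h0 => ?_, hg⟩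
  obtain ⟨φ, hφ, h1⟩ := Matrix.exists_vecMul_eq_zero_iff.2 h0
  refine hφ (linearIndependent_row_iff.1 B.2 φ ?_)
  rw [hg, ← Matrix.vecMul_vecMul, h1, Matrix.zero_vecMul]

lemma ProjNonneg.exists_mul {k n : ℕ} {A : Matrix (Fin k) (Fin n) ℝ} (h : ProjNonneg A) :
    ∃ g : Matrix (Fin k) (Fin k) ℝ, g.det ≠ 0 ∧ NonnegMinors 1 (g * A) := by
  obtain ⟨e, he, h⟩ := h
  obtain _ | k := k
  · exact ⟨1, by simp, fun t => by simp [tupleMinor, vdm]⟩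
  · refine ⟨Matrix.diagonal (Function.update 1 0 e), ?_, fun t => ?_⟩
    · rw [Matrix.det_diagonal, Finset.prod_update_of_mem (Finset.mem_univ _)]
      simpa using he
    · rw [tupleMinor_mul, Matrix.det_diagonal, Finset.prod_update_of_mem (Finset.mem_univ _)]
      simp only [Pi.one_apply, Finset.prod_const_one, mul_one, one_mul, mul_assoc]
      exact h t

lemma ProjNonneg.mul {k n : ℕ} {A : Matrix (Fin k) (Fin n) ℝ} (h : ProjNonneg A)
    {g : Matrix (Fin k) (Fin k) ℝ} (hg : g.det ≠ 0) : ProjNonneg (g * A) := by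
  obtain ⟨e, he, h⟩ := h
  refine ⟨e / g.det, div_ne_zero he hg, fun t => ?_⟩
  rw [tupleMinor_mul]
  convert h t using 1
  field_simp

lemma exists_tupleMinor_of_linearIndependent {k n : ℕ} {A : Matrix (Fin k) (Fin n) ℝ}
    (hA : LinearIndependent ℝ A.row) : ∃ t, tupleMinor A t ≠ 0 := by
  rw [linearIndependent_row_iff] at hA
  by_contra! h
  have h1 : ∀ φ : Fin k → ℝ, (∀ v ∈ Set.range (colv A), φ ⬝ᵥ v = 0) → φ = 0 := fun φ hφ =>
    hA φ (by ext c; exact hφ _ ⟨c, rfl⟩)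
  obtain ⟨b, -, -, hli, hsp⟩ := exists_finset_linearIndepOn (colv A) ∅ Finset.univ (by simp) (by simp)
  have h2 := span_eq_top_of_dotProduct h1
  rw [Finset.coe_univ, Set.image_univ, h2] at hsp
  have h3 := finrank_span_image_eq hli
  rw [hsp, finrank_top, Module.finrank_fintype_fun_eq_card, Fintype.card_fin] at h3
  obtain ⟨φ, h4, h5⟩ : ∃ φ : Fin k → ℝ, (∀ a, φ ⬝ᵥ colv A (b.orderEmbOfFin h3.symm a) = 0) ∧ φ ≠ 0 := by
    have := h (b.orderEmbOfFin h3.symm)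
    by_contra! hcon
    exact (tupleMinor_ne_zero_iff.2 hcon) this
  refine h5 (dotProduct_self_eq_zero.1
    (dotProduct_eq_zero_of_mem_span (S := colv A '' (b : Set (Fin n))) ?_ (by rw [hsp]; trivial)))
  rintro _ ⟨c, hc, rfl⟩
  have : c ∈ Set.range (b.orderEmbOfFin h3.symm) := by rw [Finset.range_orderEmbOfFin]; exact hc
  obtain ⟨a, rfl⟩ := this
  exact h4 a

section cell
variable {n : ℕ} [NeZero n] {k l : ℕ} {f : Perm ℤ}

lemma ivlRank_mul_le (g : Matrix (Fin k) (Fin k) ℝ) (A : Matrix (Fin k) (Fin n) ℝ)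
    (i b : ℤ) : ivlRank (g * A) i b ≤ ivlRank A i b := by
  have h1 : ucol (g * A) '' Set.Ico i b = g.mulVecLin '' (ucol A '' Set.Ico i b) := by
    rw [← Set.image_comp]
    rfl
  rw [ivlRank, h1, ← Submodule.map_span, ivlRank]
  exact Submodule.finrank_map_le _ _

lemma ivlRank_mul {g : Matrix (Fin k) (Fin k) ℝ} (hg : g.det ≠ 0) (A : Matrix (Fin k) (Fin n) ℝ)
    (i b : ℤ) : ivlRank (g * A) i b = ivlRank A i b := by
  refine le_antisymm (ivlRank_mul_le g A i b) ?_
  have h1 := ivlRank_mul_le g⁻¹ (g * A) i b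
  rwa [← Matrix.mul_assoc, Matrix.nonsing_inv_mul _ hg.isUnit, Matrix.one_mul] at h1

lemma ivlRank_full {A : Matrix (Fin k) (Fin n) ℝ} (hA : LinearIndependent ℝ A.row) (i : ℤ) :
    ivlRank A i (i + n) = k := by
  have h1 : Nondeg n A := by
    intro j φ hφ
    refine linearIndependent_row_iff.1 hA φ ?_
    ext c
    obtain ⟨t, h1, h2, rfl⟩ := exists_idx_window c j
    exact hφ t h1 h2
  rw [nondeg_iff.1 h1 i, Fintype.card_fin]

lemma linearIndependent_of_ivlRank {A : Matrix (Fin k) (Fin n) ℝ} {i : ℤ} {r : ℕ}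
    (h : ivlRank A i (i + r) = k) : LinearIndependent ℝ A.row := by
  rw [linearIndependent_row_iff]
  intro φ hφ
  have h1 : Submodule.span ℝ (ucol A '' Set.Ico i (i + r)) = ⊤ := by
    apply Submodule.eq_top_of_finrank_eq
    rw [Module.finrank_fintype_fun_eq_card, Fintype.card_fin]; exact h
  refine dotProduct_self_eq_zero.1 (dotProduct_eq_zero_of_mem_span
    (S := ucol A '' Set.Ico i (i + r)) ?_ (by rw [h1]; trivial))
  rintro _ ⟨t, -, rfl⟩
  exact congrFun hφ _

lemma posCount_le_ivlRank {A : Matrix (Fin k) (Fin n) ℝ} {J : Finset (Fin n)} (hJ : J.card = k)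
    (h : minor A J hJ ≠ 0) {i b : ℤ} (hb : b ≤ i + n) : posCount J i b ≤ ivlRank A i b := by
  have h1 : LinearIndepOn ℝ (colv A) (J : Set (Fin n)) := by
    rw [← Finset.range_orderEmbOfFin J hJ, linearIndepOn_range_iff (J.orderEmbOfFin hJ).injective]
    exact Matrix.linearIndependent_cols_of_det_ne_zero h
  rw [posCount_eq_card_inter J hb, ivlRank_eq_colRank,
    ← finrank_span_image_eq (h1.mono (by simp : ((J ∩ cycIvl n i (b - 1) : Finset (Fin n)) :
      Set (Fin n)) ⊆ J)), colRank]
  exact Submodule.finrank_mono (Submodule.span_mono (Set.image_mono (by simp)))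

lemma exists_minor_ivlRank_le {A : Matrix (Fin k) (Fin n) ℝ} (hA : LinearIndependent ℝ A.row)
    {i b : ℤ} (hb : b ≤ i + n) : ∃ (J : Finset (Fin n)) (hJ : J.card = k), minor A J hJ ≠ 0 ∧
      ivlRank A i b ≤ posCount J i b := by
  obtain ⟨B, hBI, hB, hli⟩ := exists_independent_of_le_rank A (cycIvl n i (b - 1))
    (ivlRank_eq_colRank A i b).le
  obtain ⟨J, hBJ, -, hJli, hsp⟩ := exists_finset_linearIndepOn (colv A) B Finset.univ (by simp) hli
  have h1 : ∀ φ : Fin k → ℝ, (∀ v ∈ Set.range (colv A), φ ⬝ᵥ v = 0) → φ = 0 := fun φ hφ =>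
    linearIndependent_row_iff.1 hA φ (by ext c; exact hφ _ ⟨c, rfl⟩)
  rw [Finset.coe_univ, Set.image_univ, span_eq_top_of_dotProduct h1] at hsp
  have hJ := finrank_span_image_eq hJli
  rw [hsp, finrank_top, Module.finrank_fintype_fun_eq_card, Fintype.card_fin] at hJ
  refine ⟨J, hJ.symm, ?_, ?_⟩
  · rw [minor_eq_tupleMinor, tupleMinor_ne_zero_iff]
    intro φ h4
    refine dotProduct_self_eq_zero.1
      (dotProduct_eq_zero_of_mem_span (S := colv A '' (J : Set (Fin n))) ?_ (by rw [hsp]; trivial))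
    rintro _ ⟨c, hc, rfl⟩
    have : c ∈ Set.range (J.orderEmbOfFin hJ.symm) := by
      rw [Finset.range_orderEmbOfFin]; exact hc
    obtain ⟨a, rfl⟩ := this
    exact h4 a
  · rw [posCount_eq_card_inter J hb, ← hB]
    exact Finset.card_le_card (Finset.subset_inter hBJ hBI)

/-- The matrix represents a point of the positroid cell of `f`, described through the ranks of the
cyclic intervals of columns. -/
structure IsCellMatrix (f : Perm ℤ) (A : Matrix (Fin k) (Fin n) ℝ) : Prop where
  nonneg : ProjNonneg A
  linearIndependent : LinearIndependent ℝ A.row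
  rank : ∀ i b : ℤ, i ≤ b → b ≤ i + n → ivlRank A i b = rankCount k f i b

lemma IsCellMatrix.mul {A : Matrix (Fin k) (Fin n) ℝ} (h : IsCellMatrix f A)
    {g : Matrix (Fin k) (Fin k) ℝ} (hg : g.det ≠ 0) : IsCellMatrix f (g * A) :=
  ⟨h.nonneg.mul hg, linearIndependent_row_mul hg h.linearIndependent, fun i b h1 h2 => by
    rw [ivlRank_mul hg, h.rank i b h1 h2]⟩

lemma IsCellMatrix.rankCount_eq {A : Matrix (Fin k) (Fin n) ℝ} (h : IsCellMatrix f A) (i : ℤ) :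
    rankCount k f i (i + n) = k := by
  rw [← h.rank i _ (by omega) le_rfl, ivlRank_full h.linearIndependent]

/-- The rank of an interval is the maximal intersection of a basis with it. In the cell all bases
obey the bound `rankCount`, and a necklace member attains it. Conversely, prescribed interval ranks
force exactly the minors of the positroid to be nonzero, by `minor_ne_zero_of_cyclic_rank`. -/
lemma mem_cell_iff (hf : f ∈ affinePerms n k l) (hkl : k + l ≤ n) {X : Gr k n} :
    X ∈ cell k n f ↔ ∃ A : FullRankMatrix k n, rowSpan A = X ∧ IsCellMatrix f A.1 := by
  constructor
  · rintro ⟨A, hAX, hA⟩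
    refine ⟨A, hAX, ⟨1, one_ne_zero, nonnegMinors_iff.2 fun J hJ => ?_⟩, A.2, fun i b h1 h2 => ?_⟩
    · rw [one_mul]
      by_cases h : J ∈ positroid k n f
      · exact ((hA J hJ).1 h).le
      · exact ((hA J hJ).2 h).ge
    · have hmem : ∀ J hJ, minor A.1 J hJ ≠ 0 → J ∈ positroid k n f := fun J hJ h => by
        by_contra h3
        exact h ((hA J hJ).2 h3)
      obtain ⟨J, hJ, h3, h4⟩ := exists_minor_ivlRank_le A.2 h2
      have h5 := (mem_positroid_iff hf hkl).1 (hmem J hJ h3)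
      refine le_antisymm (h4.trans (h5.2.2 i b h1 h2)) ?_
      have h6 := necklace_mem_positroid hf hkl h5.2.1 i
      have h7 := ((mem_positroid_iff hf hkl).1 h6).1
      have h8 := posCount_le_ivlRank h7 ((hA _ h7).1 h6).ne' h2
      rwa [posCount_necklace hf hkl le_rfl h2] at h8
  · rintro ⟨A, rfl, hA⟩
    obtain ⟨g, hg, hpos⟩ := hA.nonneg.exists_mul
    have hA' := hA.mul hg
    refine ⟨⟨g * A.1, hA'.linearIndependent⟩, rowSpan_mul hg A _, fun J hJ => ?_⟩
    have hnn := nonnegMinors_iff.1 hpos J hJ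
    rw [one_mul] at hnn
    constructor
    · intro h
      rw [mem_positroid_iff hf hkl] at h
      refine hnn.lt_of_ne' (minor_ne_zero_of_cyclic_rank hpos one_ne_zero J hJ fun i b => ?_)
      rcases lt_or_ge b i with hb | hb
      · have : cycIvl n i b = ∅ := by
          ext c
          rw [mem_cycIvl_iff]
          constructor
          · rintro ⟨t, h1, h2, -⟩; omega
          · simp
        rw [this]; simp
      · have e1 := ivlRank_eq_colRank (g * A.1) i (b + 1)
        rw [add_sub_cancel_right] at e1
        rw [← e1]
        rcases le_total (b + 1) (i + n) with h1 | h1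
        · have e2 := posCount_eq_card_inter J h1
          rw [add_sub_cancel_right] at e2
          rw [← e2, hA'.rank i _ (by omega) h1]
          exact h.2.2 i _ (by omega) h1
        · calc (J ∩ cycIvl n i b).card ≤ J.card := Finset.card_le_card Finset.inter_subset_left
            _ = ivlRank (g * A.1) i (i + n) := by rw [hJ, ivlRank_full hA'.linearIndependent]
            _ ≤ _ := ivlRank_mono _ le_rfl h1
    · intro h
      by_contra h0
      refine h ((mem_positroid_iff hf hkl).2 ⟨hJ, hA.rankCount_eq, fun i b h1 h2 => ?_⟩)
      rw [← hA'.rank i b h1 h2]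
      exact posCount_le_ivlRank hJ h0 h2

lemma rowSpan_mem_cell_iff (hf : f ∈ affinePerms n k l) (hkl : k + l ≤ n) {A : FullRankMatrix k n} :
    rowSpan A ∈ cell k n f ↔ IsCellMatrix f A.1 := by
  rw [mem_cell_iff hf hkl]
  constructor
  · rintro ⟨B, hB, h⟩
    obtain ⟨g, hg, h1⟩ := exists_mul_of_rowSpan_eq hB
    rw [h1]; exact h.mul hg
  · exact fun h => ⟨A, rfl, h⟩

/-! ## The twist of a positroid cell -/

/-- The scaling factors for which the twist has the expected positivity. -/
def GoodScaling (k l m : ℕ) [NeZero (k + l)] (e : Fin k ⊕ Fin l ≃ Fin (k + l)) (s : Fin n → ℝ) :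
    Prop :=
  (∀ c, s c ≠ 0) ∧ ∀ (V : Matrix (Fin k) (Fin n) ℝ) (W : Matrix (Fin l) (Fin n) ℝ)
      (Z : Matrix (Fin (k + m)) (Fin n) ℝ), ProjNonneg V →
      (∀ j, ivlRank V j (j + (k + l : ℕ)) = k) → PosMinors 1 Z → IsKernelMatrix Z W →
      ProjPos (altSign (twist e l s (fromRows V W)).toRows₁) ∧
      ProjNonneg (twist e l s (fromRows V W)).toRows₂

lemma IsCellMatrix.ivlRank_window {A : Matrix (Fin k) (Fin n) ℝ} (h : IsCellMatrix f A)
    (hf : f ∈ affinePerms n k l) (hkl : k + l ≤ n) (j : ℤ) : ivlRank A j (j + (k + l : ℕ)) = k := by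
  rw [h.rank j _ (by omega) (by omega), ← rankCount_eq_of_le hf (b := j + n) (by omega),
    h.rankCount_eq]

lemma IsCellMatrix.nondeg_fromRows {m : ℕ} {V : Matrix (Fin k) (Fin n) ℝ} (hn : k + l + m = n) (hm : Even m)
    (hf : f ∈ affinePerms n k l) (hV : IsCellMatrix f V) {Z : Matrix (Fin (k + m)) (Fin n) ℝ}
    (hZ : PosMinors 1 Z) {W : Matrix (Fin l) (Fin n) ℝ} (hW : IsKernelMatrix Z W) :
    Nondeg (k + l) (fromRows V W) := by
  obtain ⟨ε, hε, hV'⟩ := hV.nonneg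
  exact Amplituhedron.nondeg_fromRows hn hm hε hV' (hV.ivlRank_window hf (by omega)) hZ hW

variable {m : ℕ} [NeZero (k + l)] {e : Fin k ⊕ Fin l ≃ Fin (k + l)} {s : Fin n → ℝ}

/-- The lower part of the twist maps the cell of `f` to the cell of `f⁻¹`. -/
theorem IsCellMatrix.twist (hs : GoodScaling k l m e s) (hn : k + l + m = n) (hm : Even m)
    (hf : f ∈ affinePerms n k l) {V : Matrix (Fin k) (Fin n) ℝ} (hV : IsCellMatrix f V)
    {Z : Matrix (Fin (k + m)) (Fin n) ℝ} (hZ : PosMinors 1 Z) {W : Matrix (Fin l) (Fin n) ℝ}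
    (hW : IsKernelMatrix Z W) : IsCellMatrix f⁻¹ (twist e l s (fromRows V W)).toRows₂ := by
  have hU := hV.nondeg_fromRows hn hm hf hZ hW
  have hT := hU.isTwist_twist (k := k) (l := l) e hs.1
  rw [← fromRows_toRows (Amplituhedron.twist e l s (fromRows V W))] at hT
  set Y := (Amplituhedron.twist e l s (fromRows V W)).toRows₂
  -- Rank duality for the twist and the counting identity for `f⁻¹` are the same linear relation, so
  -- agreement for `V` gives agreement for `Y`.
  have hrank : ∀ (i : ℤ) (t : ℕ), t ≤ k + l → ivlRank Y i (i + t) = rankCount l f⁻¹ i (i + t) := by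
    intro i t ht
    have h1 := hT.ivlRank_eq rfl hU i ht
    have h2 := rankCount_inv hf (by omega) hV.rankCount_eq i ht
    rw [hV.rank _ _ (by omega) (by omega)] at h1
    omega
  have hfull : ∀ i : ℤ, ivlRank Y i (i + (k + l : ℕ)) = l := by
    intro i
    have h2 := rankCount_inv hf (by omega) hV.rankCount_eq i le_rfl
    have h3 : rankCount k f (i - l + (k + l : ℕ)) (i + k) = 0 := by
      rw [rankCount, Finset.Ico_eq_empty (by push_cast; omega)]; simp
    rw [hrank i _ le_rfl]
    omega
  refine ⟨(hs.2 V W Z hV.nonneg (hV.ivlRank_window hf (by omega)) hZ hW).2,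
    linearIndependent_of_ivlRank (hfull 0), fun i b h1 h2 => ?_⟩
  obtain ⟨t, rfl⟩ : ∃ t : ℕ, b = i + t := ⟨(b - i).toNat, by omega⟩
  -- Beyond length `k + l`, both the rank and the count have reached their maximum `l`.
  rcases le_total t (k + l) with ht | ht
  · exact hrank i t ht
  · have h3 := rankCount_eq_of_le (inv_mem_affinePerms hf) (i := i) (b := i + t) (by push_cast; omega)
    rw [h3, add_comm l k, ← hrank i _ le_rfl, hfull]
    have h4 := ivlRank_le Y i (i + t)
    rw [Fintype.card_fin] at h4
    exact le_antisymm h4 ((hfull i).ge.trans (ivlRank_mono Y le_rfl (by omega)))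

/-- The upper part of the twist spans the kernel of a totally positive matrix. -/
theorem IsCellMatrix.exists_dual (hs : GoodScaling k l m e s) (hn : k + l + m = n)
    (hf : f ∈ affinePerms n k l) {V : Matrix (Fin k) (Fin n) ℝ} (hV : IsCellMatrix f V)
    {Z : Matrix (Fin (k + m)) (Fin n) ℝ} (hZ : PosMinors 1 Z) {W : Matrix (Fin l) (Fin n) ℝ}
    (hW : IsKernelMatrix Z W) : ∃ Z' : Matrix (Fin (l + m)) (Fin n) ℝ, PosMinors 1 Z' ∧
      IsKernelMatrix Z' (Amplituhedron.twist e l s (fromRows V W)).toRows₁ := by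
  obtain ⟨ε, -, h1⟩ := (hs.2 V W Z hV.nonneg (hV.ivlRank_window hf (by omega)) hZ hW).1
  obtain ⟨Z', hZ', h2⟩ := exists_posMinors_orthogonal (p := l + m) (by omega) h1
  rw [altSign_altSign] at h2
  exact ⟨Z', hZ', h2⟩

end cell
end Amplituhedron

namespace Amplituhedron
open Matrix Equiv Filter Topology

/-! ## Admissibility and compatibility -/

lemma mem_zMap_rowSpan_iff {k m n : ℕ} {Z : Matrix (Fin (k + m)) (Fin n) ℝ} {A : FullRankMatrix k n}
    {x : Fin (k + m) → ℝ} : x ∈ zMap Z (rowSpan A) ↔ ∃ φ, Z *ᵥ (φ ᵥ* A.1) = x := by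
  rw [zMap, Submodule.mem_map]
  constructor
  · rintro ⟨y, hy, rfl⟩
    obtain ⟨φ, rfl⟩ := mem_rowSpan_iff.1 hy
    exact ⟨φ, rfl⟩
  · rintro ⟨φ, rfl⟩
    exact ⟨_, mem_rowSpan_iff.2 ⟨φ, rfl⟩, rfl⟩

lemma ProjNonneg.eq_zero_of_mulVec {k m n : ℕ} (hn : k + m ≤ n) {V : Matrix (Fin k) (Fin n) ℝ}
    (hV : ProjNonneg V) (hli : LinearIndependent ℝ V.row) {Z : Matrix (Fin (k + m)) (Fin n) ℝ}
    (hZ : PosMinors 1 Z) {φ : Fin k → ℝ} (h0 : Z *ᵥ (φ ᵥ* V) = 0) : φ = 0 := by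
  obtain ⟨e, he, hV⟩ := hV
  exact injective_of_nonnegMinors hn hV he (exists_tupleMinor_of_linearIndependent hli) hZ h0

lemma PosMinors.exists_isKernelMatrix {p l n : ℕ} (hn : p + l = n) {Z : Matrix (Fin p) (Fin n) ℝ}
    (hZ : PosMinors 1 Z) : ∃ W : Matrix (Fin l) (Fin n) ℝ, IsKernelMatrix Z W := by
  obtain ⟨h, hh, hhZ⟩ := hZ.exists_normalized (by omega)
  have h1 := (isKernelMatrix_kernelMatrix hn hhZ.1).mul_left h⁻¹
  rw [← Matrix.mul_assoc, Matrix.nonsing_inv_mul _ hh.isUnit, Matrix.one_mul] at h1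
  exact ⟨_, h1⟩

lemma zMap_rowSpan_eq_of_eq_add {k l m n : ℕ} {Z : Matrix (Fin (k + m)) (Fin n) ℝ}
    {W : Matrix (Fin l) (Fin n) ℝ} (hW : IsKernelMatrix Z W) {A B : FullRankMatrix k n}
    {a : Matrix (Fin k) (Fin k) ℝ} {b : Matrix (Fin k) (Fin l) ℝ} (ha : a.det ≠ 0)
    (h : B.1 = a * A.1 + b * W) : zMap Z (rowSpan A) = zMap Z (rowSpan B) := by
  have h1 : ∀ φ, Z *ᵥ (φ ᵥ* B.1) = Z *ᵥ ((φ ᵥ* a) ᵥ* A.1) := fun φ => by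
    rw [h, Matrix.vecMul_add, Matrix.mulVec_add, ← Matrix.vecMul_vecMul, ← Matrix.vecMul_vecMul,
      hW.mulVec, add_zero]
  ext x
  rw [mem_zMap_rowSpan_iff, mem_zMap_rowSpan_iff]
  constructor
  · rintro ⟨φ, rfl⟩
    refine ⟨φ ᵥ* a⁻¹, ?_⟩
    rw [h1, Matrix.vecMul_vecMul φ, Matrix.nonsing_inv_mul _ ha.isUnit, Matrix.vecMul_one]
  · rintro ⟨φ, rfl⟩
    exact ⟨φ ᵥ* a, (h1 φ).symm⟩

/-- Each row of `B` agrees with a combination of the rows of `A` modulo the kernel of `Z`, which is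
the row span of `W`. The matrix `a` is invertible because `Z` is injective on totally nonnegative
subspaces. -/
lemma exists_eq_add_of_zMap_eq {k l m n : ℕ} (hn : k + m + l = n)
    {Z : Matrix (Fin (k + m)) (Fin n) ℝ} (hZ : PosMinors 1 Z) {W : Matrix (Fin l) (Fin n) ℝ}
    (hW : IsKernelMatrix Z W) {A B : FullRankMatrix k n} (hB : ProjNonneg B.1)
    (h : zMap Z (rowSpan A) = zMap Z (rowSpan B)) :
    ∃ (a : Matrix (Fin k) (Fin k) ℝ) (b : Matrix (Fin k) (Fin l) ℝ), a.det ≠ 0 ∧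
      B.1 = a * A.1 + b * W := by
  have h1 : ∀ c, ∃ φ : Fin k → ℝ, ∃ β : Fin l → ℝ, B.1 c = φ ᵥ* A.1 + β ᵥ* W := fun c => by
    have h2 : Z *ᵥ (B.1 c) ∈ zMap Z (rowSpan A) := by
      rw [h, mem_zMap_rowSpan_iff]
      refine ⟨Pi.single c 1, ?_⟩
      rw [Matrix.single_one_vecMul]; rfl
    obtain ⟨φ, hφ⟩ := mem_zMap_rowSpan_iff.1 h2
    obtain ⟨β, hβ⟩ := hW.exists_vecMul hn hZ (x := B.1 c - φ ᵥ* A.1) (by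
      rw [Matrix.mulVec_sub, hφ, sub_self])
    exact ⟨φ, β, by rw [← hβ]; abel⟩
  choose a b hab using h1
  have h2 : B.1 = Matrix.of a * A.1 + Matrix.of b * W := by
    ext c j
    rw [hab]; rfl
  refine ⟨Matrix.of a, Matrix.of b, fun h0 => ?_, h2⟩
  obtain ⟨φ, hφ, h3⟩ := Matrix.exists_vecMul_eq_zero_iff.2 h0
  refine hφ (hB.eq_zero_of_mulVec (by omega) B.2 hZ ?_)
  rw [h2, Matrix.vecMul_add, ← Matrix.vecMul_vecMul, h3, Matrix.zero_vecMul, zero_add,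
    ← Matrix.vecMul_vecMul, hW.mulVec]

/-! ### Transfer through the twist -/

section dual
variable {n : ℕ} [NeZero n] {k l m : ℕ} {f g : Perm ℤ}

lemma exists_goodScaling [NeZero (k + l)] (hn : k + l + m = n) (hm : Even m)
    (e : Fin k ⊕ Fin l ≃ Fin (k + l)) : ∃ s : Fin n → ℝ, GoodScaling k l m e s :=
  exists_twist_nonneg hn hm e

/-- Two points of cells with the same image under `Z` give rise to two points of the dual cells
with the same image under a dual `Z'`. -/
theorem exists_dual_pair [NeZero (k + l)] (hn : k + l + m = n) (hm : Even m)
    (hf : f ∈ affinePerms n k l) (hg : g ∈ affinePerms n k l)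
    {Z : Matrix (Fin (k + m)) (Fin n) ℝ} (hZ : PosMinors 1 Z) {A B : FullRankMatrix k n}
    (hA : IsCellMatrix f A.1) (hB : IsCellMatrix g B.1)
    (h : zMap Z (rowSpan A) = zMap Z (rowSpan B)) :
    ∃ (Z' : Matrix (Fin (l + m)) (Fin n) ℝ) (A' B' : FullRankMatrix l n), PosMinors 1 Z' ∧
      IsCellMatrix f⁻¹ A'.1 ∧ IsCellMatrix g⁻¹ B'.1 ∧
      zMap Z' (rowSpan A') = zMap Z' (rowSpan B') ∧
      (rowSpan A' = rowSpan B' → rowSpan A = rowSpan B) := by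
  obtain ⟨s, hs⟩ := exists_goodScaling hn hm finSumFinEquiv
  obtain ⟨W, hW⟩ := hZ.exists_isKernelMatrix (l := l) (by omega)
  obtain ⟨a, b, ha, hab⟩ := exists_eq_add_of_zMap_eq (by omega) hZ hW hB.nonneg h
  obtain ⟨Z', hZ', hX⟩ := hA.exists_dual hs hn hf hZ hW
  have hY := hA.twist hs hn hm hf hZ hW
  have hY' := hB.twist hs hn hm hg hZ hW
  have hU := hA.nondeg_fromRows hn hm hf hZ hW
  have hT := (hU.isTwist_twist (k := k) (l := l) finSumFinEquiv hs.1).nondeg hU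
  -- Both points are stacked with the same `W`, so the second twist arises from the first by the row
  -- operation with blocks `a`, `b`, `0`, `1`. Both lower blocks are then compared modulo the `X` of
  -- the first twist.
  have htw := twist_fromBlocks finSumFinEquiv (s := s) b ha
    (h := (1 : Matrix (Fin l) (Fin l) ℝ)) (by simp) (fromRows_toRows (twist finSumFinEquiv l s
      (fromRows A.1 W))).symm
  rw [Matrix.one_mul, ← hab] at htw
  rw [← fromRows_toRows (twist finSumFinEquiv l s (fromRows A.1 W))] at hT
  set X := (twist finSumFinEquiv l s (fromRows A.1 W)).toRows₁
  set Y := (twist finSumFinEquiv l s (fromRows A.1 W)).toRows₂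
  rw [htw, toRows₂_fromRows] at hY'
  set a' := ((a.det * (1 : Matrix (Fin l) (Fin l) ℝ).det) • (1 : Matrix (Fin l) (Fin l) ℝ)⁻¹)ᵀ
    with ha'
  set N := ((a.det * (1 : Matrix (Fin l) (Fin l) ℝ).det) • (a⁻¹ * b * (1 : Matrix (Fin l) (Fin l) ℝ)⁻¹))ᵀ with hN
  have ha'0 : a'.det ≠ 0 := by
    rw [ha', Matrix.det_transpose, Matrix.det_smul]
    simpa using fun h => absurd h ha
  refine ⟨Z', ⟨Y, hY.linearIndependent⟩, ⟨_, hY'.linearIndependent⟩, hZ', hY, hY', ?_, ?_⟩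
  · refine zMap_rowSpan_eq_of_eq_add hX (a := a') (b := -N) ha'0 ?_
    rw [Matrix.neg_mul]
    exact sub_eq_add_neg _ _
  · intro hYY
    obtain ⟨c, -, hc⟩ := exists_mul_of_rowSpan_eq hYY
    change a' * Y - N * X = c * Y at hc
    -- Equal row spans give a linear relation between the rows of `X` and `Y`, and these are
    -- independent. Hence `b = 0`, and the original subspaces coincide.
    have hN0 : N = 0 := by
      ext i j
      have h1 : Sum.elim (N i) ((c - a') i) = 0 := by
        refine hT 0 _ fun t _ _ => ?_
        rw [fromRows_dotProduct]
        have h2 := congrFun (congrFun hc i) (idx n t)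
        have h3 : (N i ᵥ* X + (c - a') i ᵥ* Y) (idx n t) = (N * X + (c - a') * Y) i (idx n t) := rfl
        change (N i ᵥ* X + (c - a') i ᵥ* Y) (idx n t) = 0
        rw [h3, Matrix.sub_mul, ← hc]
        simp
      exact congrFun h1 (Sum.inl j)
    have hb : b = 0 := by
      have h1 : a⁻¹ * b = 0 := by
        have h2 := congrArg Matrix.transpose hN0
        rw [hN, Matrix.transpose_transpose, Matrix.transpose_zero] at h2
        simpa [ha] using h2
      calc b = a * (a⁻¹ * b) := by
            rw [← Matrix.mul_assoc, Matrix.mul_nonsing_inv _ ha.isUnit, Matrix.one_mul]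
        _ = 0 := by rw [h1, Matrix.mul_zero]
    rw [hb, Matrix.zero_mul, add_zero] at hab
    have h1 := rowSpan_mul ha A (linearIndependent_row_mul ha A.2)
    rw [← h1]
    congr 1
    exact Subtype.ext hab.symm

theorem isZAdmissible_of_inv [NeZero (k + l)] (hn : k + l + m = n) (hm : Even m)
    (hf : f ∈ affinePerms n k l) {Z : Matrix (Fin (k + m)) (Fin n) ℝ} (hZ : IsTotallyPositive Z)
    (h : IsAdmissible n l m f⁻¹) : IsZAdmissible Z f := by
  intro X hX X' hX' heq
  obtain ⟨A, rfl, hA⟩ := (mem_cell_iff hf (by omega)).1 hX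
  obtain ⟨B, rfl, hB⟩ := (mem_cell_iff hf (by omega)).1 hX'
  obtain ⟨Z', A', B', hZ', hA', hB', h1, h2⟩ :=
    exists_dual_pair hn hm hf hf (isTotallyPositive_iff.1 hZ) hA hB heq
  have hf' := inv_mem_affinePerms hf
  exact h2 (h Z' (isTotallyPositive_iff.2 hZ') ((rowSpan_mem_cell_iff hf' (by omega)).2 hA')
    ((rowSpan_mem_cell_iff hf' (by omega)).2 hB') h1)

theorem isZCompatible_of_inv [NeZero (k + l)] (hn : k + l + m = n) (hm : Even m)
    (hf : f ∈ affinePerms n k l) (hg : g ∈ affinePerms n k l)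
    {Z : Matrix (Fin (k + m)) (Fin n) ℝ} (hZ : IsTotallyPositive Z)
    (h : IsCompatible n l m f⁻¹ g⁻¹) : IsZCompatible Z f g := by
  rw [IsZCompatible, Set.disjoint_left]
  rintro _ ⟨X, hX, rfl⟩ ⟨X', hX', heq⟩
  obtain ⟨A, rfl, hA⟩ := (mem_cell_iff hf (by omega)).1 hX
  obtain ⟨B, rfl, hB⟩ := (mem_cell_iff hg (by omega)).1 hX'
  obtain ⟨Z', A', B', hZ', hA', hB', h1, -⟩ :=
    exists_dual_pair hn hm hf hg (isTotallyPositive_iff.1 hZ) hA hB heq.symm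
  refine Set.disjoint_left.1 (h Z' (isTotallyPositive_iff.2 hZ'))
    ⟨_, (rowSpan_mem_cell_iff (inv_mem_affinePerms hf) (by omega)).2 hA', rfl⟩
    ⟨_, (rowSpan_mem_cell_iff (inv_mem_affinePerms hg) (by omega)).2 hB', h1.symm⟩

end dual
end Amplituhedron

namespace Amplituhedron
open Matrix Equiv Filter Topology

/-! ## The topology of the Grassmannian -/

lemma continuous_rowSpan {k n : ℕ} : Continuous (rowSpan : FullRankMatrix k n → Gr k n) :=
  continuous_coinduced_rng

lemma rowSpan_surjective {k n : ℕ} : Function.Surjective (rowSpan : FullRankMatrix k n → Gr k n) := by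
  intro X
  let b := Module.finBasisOfFinrankEq ℝ X.1 X.2
  have h1 : LinearIndependent ℝ fun a => (b a : Fin n → ℝ) :=
    b.linearIndependent.map' X.1.subtype (Submodule.ker_subtype _)
  refine ⟨⟨Matrix.of fun a => (b a : Fin n → ℝ), h1⟩, Subtype.ext ?_⟩
  change Submodule.span ℝ (Set.range fun a => (b a : Fin n → ℝ)) = X.1
  have h2 : (Set.range fun a => (b a : Fin n → ℝ)) = X.1.subtype '' Set.range b := by
    rw [← Set.range_comp]; rfl
  rw [h2, Submodule.span_image, b.span_eq, Submodule.map_top, Submodule.range_subtype]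

lemma FullRankMatrix.isUnit_det {k n : ℕ} (A : FullRankMatrix k n) : IsUnit (A.1 * A.1ᵀ).det :=
  (det_mul_transpose_ne_zero (linearIndependent_row_iff.1 A.2)).isUnit

/-- The orthogonal projection to the row span. -/
noncomputable def rowProjection {k n : ℕ} (A : FullRankMatrix k n) : Matrix (Fin n) (Fin n) ℝ :=
  A.1ᵀ * (A.1 * A.1ᵀ)⁻¹ * A.1

lemma continuous_rowProjection {k n : ℕ} :
    Continuous (rowProjection : FullRankMatrix k n → Matrix (Fin n) (Fin n) ℝ) := by
  have h1 : Continuous fun A : FullRankMatrix k n => A.1 * A.1ᵀ :=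
    continuous_subtype_val.matrix_mul continuous_subtype_val.matrix_transpose
  have h2 : Continuous fun A : FullRankMatrix k n => (A.1 * A.1ᵀ)⁻¹ := by
    simp only [Matrix.inv_def, Ring.inverse_eq_inv']
    exact (h1.matrix_det.inv₀ fun A => A.isUnit_det.ne_zero).smul h1.matrix_adjugate
  exact (continuous_subtype_val.matrix_transpose.matrix_mul h2).matrix_mul continuous_subtype_val

lemma mul_rowProjection {k n : ℕ} (A : FullRankMatrix k n) : A.1 * rowProjection A = A.1 := by
  rw [rowProjection, ← Matrix.mul_assoc, ← Matrix.mul_assoc, Matrix.mul_nonsing_inv _ A.isUnit_det,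
    Matrix.one_mul]

lemma rowProjection_eq_of_rowSpan_eq {k n : ℕ} {A B : FullRankMatrix k n}
    (h : rowSpan A = rowSpan B) : rowProjection A = rowProjection B := by
  obtain ⟨g, hg, hB⟩ := exists_mul_of_rowSpan_eq h
  have hu := hg.isUnit
  have hu' : IsUnit gᵀ.det := by rwa [Matrix.det_transpose]
  rw [rowProjection, rowProjection, hB, Matrix.transpose_mul,
    show g * A.1 * (A.1ᵀ * gᵀ) = g * (A.1 * A.1ᵀ) * gᵀ by simp only [Matrix.mul_assoc],
    Matrix.mul_inv_rev, Matrix.mul_inv_rev]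
  calc A.1ᵀ * (A.1 * A.1ᵀ)⁻¹ * A.1 =
      A.1ᵀ * ((gᵀ * gᵀ⁻¹) * ((A.1 * A.1ᵀ)⁻¹ * ((g⁻¹ * g) * A.1))) := by
        rw [Matrix.mul_nonsing_inv _ hu', Matrix.nonsing_inv_mul _ hu, Matrix.one_mul,
          Matrix.one_mul, Matrix.mul_assoc]
    _ = _ := by simp only [Matrix.mul_assoc]

lemma rowSpan_eq_of_rowProjection_eq {k n : ℕ} {A B : FullRankMatrix k n}
    (h : rowProjection A = rowProjection B) : rowSpan A = rowSpan B := by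
  have key : ∀ {A B : FullRankMatrix k n}, rowProjection A = rowProjection B →
      (rowSpan A).1 ≤ (rowSpan B).1 := by
    intro A B h x hx
    obtain ⟨φ, rfl⟩ := mem_rowSpan_iff.1 hx
    refine mem_rowSpan_iff.2 ⟨φ ᵥ* (A.1 * (B.1ᵀ * (B.1 * B.1ᵀ)⁻¹)), ?_⟩
    conv_rhs => rw [← mul_rowProjection A, h, rowProjection]
    rw [Matrix.vecMul_vecMul]
    simp only [Matrix.mul_assoc]
  exact Subtype.ext (le_antisymm (key h) (key h.symm))

/-- Orthogonal projection embeds the Grassmannian continuously and injectively into a matrix space.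
The Hausdorff property is needed to make compact images closed. -/
instance t2Space_gr (k n : ℕ) : T2Space (Gr k n) := by
  choose σ hσ using rowSpan_surjective (k := k) (n := n)
  refine T2Space.of_injective_continuous (f := fun X => rowProjection (σ X)) ?_ ?_
  · intro X X' h
    rw [← hσ X, ← hσ X', rowSpan_eq_of_rowProjection_eq h]
  · refine continuous_coinduced_dom.2 ?_
    have : (fun X => rowProjection (σ X)) ∘ rowSpan =
        (rowProjection : FullRankMatrix k n → Matrix (Fin n) (Fin n) ℝ) := by
      ext1 A
      exact rowProjection_eq_of_rowSpan_eq (hσ _)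
    rw [this]
    exact continuous_rowProjection

open scoped MatrixOrder in
lemma exists_transpose_mul_self {k : ℕ} {M : Matrix (Fin k) (Fin k) ℝ} (h : M.PosSemidef) :
    ∃ B : Matrix (Fin k) (Fin k) ℝ, M = Bᵀ * B := by
  have h0 := Matrix.nonneg_iff_posSemidef.2 h
  have h1 := (Matrix.nonneg_iff_posSemidef.1 (CFC.sqrt_nonneg M)).isHermitian
  refine ⟨CFC.sqrt M, ?_⟩
  rw [← Matrix.conjTranspose_eq_transpose_of_trivial, h1.eq, CFC.sqrt_mul_sqrt_self M h0]

lemma exists_orthonormal_mul {k n : ℕ} (A : FullRankMatrix k n) :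
    ∃ g : Matrix (Fin k) (Fin k) ℝ, g.det ≠ 0 ∧ (g * A.1) * (g * A.1)ᵀ = 1 := by
  have h1 : (A.1 * A.1ᵀ).PosSemidef := by
    have := Matrix.posSemidef_self_mul_conjTranspose A.1
    rwa [Matrix.conjTranspose_eq_transpose_of_trivial] at this
  obtain ⟨B, hB⟩ := exists_transpose_mul_self h1
  have hdet : B.det ≠ 0 := by
    intro h0
    have := A.isUnit_det.ne_zero
    rw [hB, Matrix.det_mul, h0, mul_zero] at this
    exact this rfl
  have hu : IsUnit B.det := hdet.isUnit
  have hu' : IsUnit Bᵀ.det := by rwa [Matrix.det_transpose]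
  refine ⟨Bᵀ⁻¹, by rw [Matrix.det_nonsing_inv]; simpa using hdet, ?_⟩
  rw [Matrix.transpose_mul, Matrix.transpose_nonsing_inv, Matrix.transpose_transpose]
  calc Bᵀ⁻¹ * A.1 * (A.1ᵀ * B⁻¹) = Bᵀ⁻¹ * (A.1 * A.1ᵀ) * B⁻¹ := by simp only [Matrix.mul_assoc]
    _ = (Bᵀ⁻¹ * Bᵀ) * (B * B⁻¹) := by rw [hB]; simp only [Matrix.mul_assoc]
    _ = 1 := by rw [Matrix.nonsing_inv_mul _ hu', Matrix.mul_nonsing_inv _ hu, Matrix.one_mul]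

lemma isCompact_orthonormal (k n : ℕ) :
    IsCompact {A : Matrix (Fin k) (Fin n) ℝ | A * Aᵀ = 1} := by
  have h1 : IsCompact (Set.pi Set.univ fun _ : Fin k => Set.pi Set.univ fun _ : Fin n =>
      Set.Icc (-1 : ℝ) 1) := isCompact_univ_pi fun _ => isCompact_univ_pi fun _ => isCompact_Icc
  refine h1.of_isClosed_subset ?_ ?_
  · exact isClosed_eq (continuous_id.matrix_mul continuous_id.matrix_transpose) continuous_const
  · intro A hA
    have h4 : ∀ a c, A a c ∈ Set.Icc (-1 : ℝ) 1 := by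
      intro a c
      have h2 : ∑ j, A a j * A a j = 1 := by
        have := congrFun (congrFun hA a) a
        rwa [Matrix.one_apply_eq] at this
      have h3 : A a c * A a c ≤ 1 := by
        rw [← h2]
        exact Finset.single_le_sum (f := fun j => A a j * A a j) (fun j _ => mul_self_nonneg _)
          (Finset.mem_univ c)
      rw [Set.mem_Icc, ← abs_le, ← sq_le_one_iff_abs_le_one, sq]
      exact h3
    exact fun a _ c _ => h4 a c

/-! ## The image of a matrix under `Z` -/

/-- The point of the Grassmannian spanned by the rows of `A * Zᵀ`. -/
def imageSpan {k m n : ℕ} (Z : Matrix (Fin (k + m)) (Fin n) ℝ)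
    (A : {A : Matrix (Fin k) (Fin n) ℝ // LinearIndependent ℝ (A * Zᵀ).row}) : Gr k (k + m) :=
  rowSpan ⟨A.1 * Zᵀ, A.2⟩

section image
variable {k m n : ℕ} {Z : Matrix (Fin (k + m)) (Fin n) ℝ}

lemma continuous_imageSpan : Continuous (imageSpan Z) := by
  refine continuous_rowSpan.comp (Continuous.subtype_mk ?_ _)
  exact continuous_subtype_val.matrix_mul continuous_const

lemma vecMul_mul_transpose (φ : Fin k → ℝ) (A : Matrix (Fin k) (Fin n) ℝ) :
    φ ᵥ* (A * Zᵀ) = Z *ᵥ (φ ᵥ* A) := by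
  rw [← Matrix.vecMul_vecMul, Matrix.vecMul_transpose]

lemma zMap_rowSpan (A : FullRankMatrix k n) (h : LinearIndependent ℝ (A.1 * Zᵀ).row) :
    zMap Z (rowSpan A) = (imageSpan Z ⟨A.1, h⟩).1 := by
  ext x
  rw [mem_zMap_rowSpan_iff, imageSpan, mem_rowSpan_iff]
  simp only [vecMul_mul_transpose]

lemma linearIndependent_of_mul_transpose {A : Matrix (Fin k) (Fin n) ℝ}
    (h : LinearIndependent ℝ (A * Zᵀ).row) : LinearIndependent ℝ A.row := by
  rw [linearIndependent_row_iff] at h ⊢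
  intro φ hφ
  refine h φ ?_
  rw [vecMul_mul_transpose, hφ, Matrix.mulVec_zero]

lemma ProjNonneg.linearIndependent_mul_transpose (hn : k + m ≤ n) (hZ : PosMinors 1 Z)
    {A : Matrix (Fin k) (Fin n) ℝ} (hA : ProjNonneg A) (hli : LinearIndependent ℝ A.row) :
    LinearIndependent ℝ (A * Zᵀ).row := by
  rw [linearIndependent_row_iff]
  intro φ hφ
  rw [vecMul_mul_transpose] at hφ
  exact hA.eq_zero_of_mulVec hn hli hZ hφ

lemma imageSpan_mem_closure {C : Set (Matrix (Fin k) (Fin n) ℝ)} {T : Set (Gr k (k + m))}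
    (hC : ∀ B ∈ C, ∃ h : LinearIndependent ℝ (B * Zᵀ).row, imageSpan Z ⟨B, h⟩ ∈ closure T)
    {A : {A : Matrix (Fin k) (Fin n) ℝ // LinearIndependent ℝ (A * Zᵀ).row}} (hA : A.1 ∈ closure C) :
    imageSpan Z A ∈ closure T := by
  have h1 : A ∈ closure (Subtype.val ⁻¹' C) := by
    have h0 : Subtype.val '' (Subtype.val ⁻¹' C :
        Set {A : Matrix (Fin k) (Fin n) ℝ // LinearIndependent ℝ (A * Zᵀ).row}) = C :=
      Set.image_preimage_eq_of_subset fun B hB => ⟨⟨B, (hC B hB).1⟩, rfl⟩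
    rw [closure_subtype, h0]
    exact hA
  have h2 : Set.MapsTo (imageSpan Z) (Subtype.val ⁻¹' C) (closure T) := fun B hB => by
    obtain ⟨h, h'⟩ := hC B.1 hB
    exact h'
  have h3 := map_mem_closure continuous_imageSpan h1 h2
  rwa [closure_closure] at h3

lemma ProjNonneg.rowSpan_mem {A : FullRankMatrix k n} (hA : ProjNonneg A.1) :
    rowSpan A ∈ tnnGr k n := by
  obtain ⟨g, hg, h⟩ := hA.exists_mul
  refine ⟨⟨g * A.1, linearIndependent_row_mul hg A.2⟩, rowSpan_mul hg A _, fun J hJ => ?_⟩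
  simpa using nonnegMinors_iff.1 h J hJ

end image

end Amplituhedron

namespace Amplituhedron
open Matrix Equiv Filter Topology

/-! ## Density -/

section scaling
variable {n : ℕ}

/-- The matrix with its columns multiplied by the given factors. -/
def scaleCols {k : ℕ} (c : Fin n → ℝ) (A : Matrix (Fin k) (Fin n) ℝ) : Matrix (Fin k) (Fin n) ℝ :=
  Matrix.of fun a j => c j * A a j

lemma tupleMinor_scaleCols {k : ℕ} (c : Fin n → ℝ) (A : Matrix (Fin k) (Fin n) ℝ)
    (t : Fin k → Fin n) : tupleMinor (scaleCols c A) t = (∏ a, c (t a)) * tupleMinor A t := by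
  rw [tupleMinor, tupleMinor, ← Matrix.det_mul_row]
  rfl

lemma continuous_scaleCols {k : ℕ} (c : Fin n → ℝ) :
    Continuous (scaleCols c : Matrix (Fin k) (Fin n) ℝ → Matrix (Fin k) (Fin n) ℝ) :=
  continuous_pi fun a => continuous_pi fun j => by simp only [scaleCols, Matrix.of_apply]; fun_prop

lemma scaleCols_scaleCols {k : ℕ} (c d : Fin n → ℝ) (A : Matrix (Fin k) (Fin n) ℝ) :
    scaleCols c (scaleCols d A) = scaleCols (c * d) A := by
  ext a j; simp [scaleCols, mul_assoc]

lemma scaleCols_one {k : ℕ} (A : Matrix (Fin k) (Fin n) ℝ) : scaleCols 1 A = A := by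
  ext a j; simp [scaleCols]

lemma mul_scaleCols {j k : ℕ} (c : Fin n → ℝ) (g : Matrix (Fin j) (Fin k) ℝ)
    (A : Matrix (Fin k) (Fin n) ℝ) : g * scaleCols c A = scaleCols c (g * A) := by
  ext a i
  simp only [scaleCols, Matrix.mul_apply, Matrix.of_apply, Finset.mul_sum]
  exact Finset.sum_congr rfl fun b _ => by ring

lemma scaleCols_inv_scaleCols {k : ℕ} {c : Fin n → ℝ} (hc : ∀ j, c j ≠ 0)
    (A : Matrix (Fin k) (Fin n) ℝ) : scaleCols c⁻¹ (scaleCols c A) = A := by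
  rw [scaleCols_scaleCols, show c⁻¹ * c = 1 from funext fun j => inv_mul_cancel₀ (hc j),
    scaleCols_one]

/-- If a column scaling preserves the positivity of one totally positive matrix, then its inverse
preserves total nonnegativity. -/
lemma ProjNonneg.scaleCols_inv {k : ℕ} {c : Fin n → ℝ} {V : Matrix (Fin k) (Fin n) ℝ}
    (hV : ProjPos V) (hcV : ProjPos (scaleCols c V)) {A : Matrix (Fin k) (Fin n) ℝ}
    (hA : ProjNonneg A) : ProjNonneg (scaleCols c⁻¹ A) := by
  obtain ⟨e₁, h₁, hV⟩ := hV
  obtain ⟨e₂, h₂, hcV⟩ := hcV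
  obtain ⟨e, h, hA⟩ := hA
  refine ⟨e₁ * e₂ * e, mul_ne_zero (mul_ne_zero h₁ h₂) h, fun t => ?_⟩
  by_cases ht : Function.Injective t
  · have a1 := hV t ht
    have a2 := hcV t ht
    rw [tupleMinor_scaleCols] at a2 ⊢
    have a3 := hA t
    simp only [Pi.inv_apply, Finset.prod_inv_distrib]
    set p := ∏ a, c (t a)
    have a4 : 0 < e₁ * e₂ * p := by
      have h0 := mul_pos a1 a2
      have h1 : tupleMinor V t * vdm t ≠ 0 := fun h => by rw [h] at a1; simp at a1
      have h2 : 0 < (tupleMinor V t * vdm t) ^ 2 := by positivity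
      refine pos_of_mul_pos_left (?_ : 0 < e₁ * e₂ * p * (tupleMinor V t * vdm t) ^ 2) h2.le
      linarith
    have hp : p ≠ 0 := fun h => by rw [h] at a4; simp at a4
    have a5 : 0 < e₁ * e₂ * p⁻¹ := by
      have : e₁ * e₂ * p⁻¹ = e₁ * e₂ * p * (p⁻¹) ^ 2 := by field_simp
      rw [this]; positivity
    have := mul_nonneg a5.le a3
    linarith
  · rw [tupleMinor_eq_zero _ ht]; simp

variable [NeZero n]

lemma ivlRank_scaleCols_le {k : ℕ} (c : Fin n → ℝ) (A : Matrix (Fin k) (Fin n) ℝ) (i b : ℤ) :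
    ivlRank (scaleCols c A) i b ≤ ivlRank A i b := by
  refine Submodule.finrank_mono (Submodule.span_le.2 ?_)
  rintro _ ⟨t, ht, rfl⟩
  exact Submodule.smul_mem _ (c (idx n t)) (Submodule.subset_span ⟨t, ht, rfl⟩)

lemma ivlRank_scaleCols {k : ℕ} {c : Fin n → ℝ} (hc : ∀ j, c j ≠ 0) (A : Matrix (Fin k) (Fin n) ℝ)
    (i b : ℤ) : ivlRank (scaleCols c A) i b = ivlRank A i b := by
  refine le_antisymm (ivlRank_scaleCols_le c A i b) ?_
  have := ivlRank_scaleCols_le c⁻¹ (scaleCols c A) i b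
  rwa [scaleCols_inv_scaleCols hc] at this

lemma IsCellMatrix.scaleCols_inv {k : ℕ} {f : Perm ℤ} {c : Fin n → ℝ} (hc : ∀ j, c j ≠ 0)
    {V : Matrix (Fin k) (Fin n) ℝ} (hV : ProjPos V) (hcV : ProjPos (scaleCols c V))
    {A : Matrix (Fin k) (Fin n) ℝ} (hA : IsCellMatrix f A) : IsCellMatrix f (scaleCols c⁻¹ A) := by
  have hr := ivlRank_scaleCols (c := c⁻¹) (fun j => inv_ne_zero (hc j)) A
  exact ⟨hA.nonneg.scaleCols_inv hV hcV, linearIndependent_of_ivlRank (i := 0) (r := n) (by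
    rw [hr, ivlRank_full hA.linearIndependent]), fun i b h1 h2 => by rw [hr, hA.rank i b h1 h2]⟩

end scaling

section density
variable {n : ℕ} [NeZero n] {k l m : ℕ}

/-- If the images of the cells are dense in the amplituhedron, then each of its points is the image
of a point in the closure of one of the cells. -/
theorem exists_mem_closure_of_dense (hkl : k + l ≤ n) (hkm : k + m ≤ n)
    {Z : Matrix (Fin (k + m)) (Fin n) ℝ} (hZ : PosMinors 1 Z) {N : ℕ} {f : Fin N → Perm ℤ}
    (hf : ∀ s, f s ∈ affinePerms n k l)
    (h : amplituhedron Z ⊆ closure (⋃ s, zImage Z (cell k n (f s)))) {V : FullRankMatrix k n}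
    (hV : ProjNonneg V.1) : ∃ s, ∃ A : FullRankMatrix k n, A.1 ∈ closure {B | IsCellMatrix (f s) B} ∧
      ProjNonneg A.1 ∧ zMap Z (rowSpan V) = zMap Z (rowSpan A) := by
  -- Orthonormal representatives make the closure of each cell compact. Closure points are still
  -- totally nonnegative, so `Z` is injective on them and maps them continuously. The union `T` of
  -- the images is closed, hence contains the whole amplituhedron.
  let K : Fin N → Set (Matrix (Fin k) (Fin n) ℝ) := fun s =>
    {A | A * Aᵀ = 1} ∩ closure {B | IsCellMatrix (f s) B}
  have hKc : ∀ s, IsCompact (K s) := fun s => (isCompact_orthonormal k n).inter_right isClosed_closure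
  have hnn : ∀ s, ∀ A ∈ closure {B : Matrix (Fin k) (Fin n) ℝ | IsCellMatrix (f s) B},
      ProjNonneg A := fun s A hA =>
    closure_minimal (fun B hB => IsCellMatrix.nonneg hB) (isClosed_projNonneg k n) hA
  have hli : ∀ A : Matrix (Fin k) (Fin n) ℝ, A * Aᵀ = 1 → LinearIndependent ℝ A.row := by
    intro A hA
    rw [linearIndependent_row_iff]
    intro φ hφ
    rw [← Matrix.vecMul_one φ, ← hA, ← Matrix.vecMul_vecMul, hφ, Matrix.zero_vecMul]
  have hKl : ∀ s, ∀ A ∈ K s, LinearIndependent ℝ (A * Zᵀ).row := fun s A hA =>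
    (hnn s A hA.2).linearIndependent_mul_transpose hkm hZ (hli A hA.1)
  let T : Set (Gr k (k + m)) := ⋃ s, imageSpan Z '' (Subtype.val ⁻¹' K s)
  have hT : IsClosed T := by
    refine isClosed_iUnion_of_finite fun s => ?_
    refine (IsCompact.image ?_ continuous_imageSpan).isClosed
    exact IsEmbedding.subtypeVal.isInducing.isCompact_preimage' (hKc s)
      fun A hA => ⟨⟨A, hKl s A hA⟩, rfl⟩
  have hsub : (⋃ s, zImage Z (cell k n (f s))) ⊆ T := by
    refine Set.iUnion_mono fun s => ?_
    rintro Y ⟨X, hX, hXY⟩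
    obtain ⟨A, rfl, hA⟩ := (mem_cell_iff (hf s) hkl).1 hX
    obtain ⟨g, hg, hgA⟩ := exists_orthonormal_mul A
    have hK : g * A.1 ∈ K s := ⟨hgA, subset_closure (hA.mul hg)⟩
    refine ⟨⟨g * A.1, hKl s _ hK⟩, hK, ?_⟩
    apply Subtype.ext
    rw [← zMap_rowSpan ⟨g * A.1, (hA.mul hg).linearIndependent⟩, rowSpan_mul hg A, hXY]
  have hVl := hV.linearIndependent_mul_transpose hkm hZ V.2
  have hmem : imageSpan Z ⟨V.1, hVl⟩ ∈ T :=
    closure_minimal hsub hT (h ⟨rowSpan V, hV.rowSpan_mem, zMap_rowSpan V hVl⟩)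
  obtain ⟨s, A, hA, hAV⟩ := Set.mem_iUnion.1 hmem
  refine ⟨s, ⟨A.1, hli A.1 hA.1⟩, hA.2, hnn s _ hA.2, ?_⟩
  rw [zMap_rowSpan V hVl, ← hAV, zMap_rowSpan ⟨A.1, hli A.1 hA.1⟩ A.2]

/-- The twist of the twist agrees with the original matrix up to column scaling. -/
lemma exists_scaleCols_twist [NeZero (k + l)] [NeZero (l + k)] {e : Fin k ⊕ Fin l ≃ Fin (k + l)}
    {e' : Fin l ⊕ Fin k ≃ Fin (l + k)} {s s' : Fin n → ℝ} (hs : ∀ c, s c ≠ 0)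
    (hs' : ∀ c, s' c ≠ 0) {V : Matrix (Fin k) (Fin n) ℝ} {W : Matrix (Fin l) (Fin n) ℝ}
    (hU : Nondeg (k + l) (fromRows V W)) : ∃ c : Fin n → ℝ, (∀ j, c j ≠ 0) ∧
      twist e' k s' (fromRows (twist e l s (fromRows V W)).toRows₂
        (twist e l s (fromRows V W)).toRows₁) = fromRows (scaleCols c W) (scaleCols c V) := by
  have hT := hU.isTwist_twist (k := k) (l := l) e hs
  have hTn := hT.nondeg hU
  have hsymm := hT.symm hU
  rw [← fromRows_toRows (twist e l s (fromRows V W))] at hTn hsymm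
  set X := (twist e l s (fromRows V W)).toRows₁
  set Y := (twist e l s (fromRows V W)).toRows₂
  have hdot : ∀ {A B : Matrix (Fin k) (Fin n) ℝ} {C D : Matrix (Fin l) (Fin n) ℝ} (j t : ℤ),
      ucol (fromRows C A) j ⬝ᵥ ucol (fromRows D B) t =
        ucol (fromRows A C) j ⬝ᵥ ucol (fromRows B D) t := by
    intro A B C D j t
    simp [dotProduct, Fintype.sum_sum_type, add_comm]
  have hYX : Nondeg (l + k) (fromRows Y X) := by
    intro j φ hφ
    have := hTn j (φ ∘ Sum.swap) fun t h1 h2 => by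
      rw [← hφ t h1 (by push_cast at h2 ⊢; omega)]
      simp [dotProduct, Fintype.sum_sum_type, add_comm]
    ext a
    have := congrFun this a.swap
    simpa using this
  -- By symmetry, and after exchanging the blocks, `W` over `V` satisfies the conditions for a twist
  -- of `Y` over `X`; uniqueness gives the column scaling.
  have h1 : IsTwist l k (fromRows Y X) (fromRows W V) := by
    refine ⟨fun j t h1 h2 => by rw [hdot]; exact hsymm.1 j t h1 h2, fun j h0 => hsymm.2 j ?_⟩
    ext a
    have := congrFun h0 a.swap
    rcases a with a | a <;> simpa using this
  have h2 := hYX.isTwist_twist (k := l) (l := k) e' hs'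
  choose c hc hcT using fun j : Fin n => h1.exists_smul hYX h2 ((j : ℤ) + 1)
  refine ⟨c, hc, ?_⟩
  ext a j
  have h3 := congrFun (hcT j) a
  rw [ucol, ucol, idx_coe_add_one] at h3
  rw [show twist e' k s' (fromRows Y X) a j = colv (twist e' k s' (fromRows Y X)) j a from rfl, h3]
  rcases a with a | a <;> rfl

/-- A totally positive matrix is, modulo the kernel of `Z`, in the closure of one of the cells if
the dual statement holds. -/
theorem exists_mem_closure_of_dual [NeZero (k + l)] (hn : k + l + m = n) (hm : Even m)
    {Z : Matrix (Fin (k + m)) (Fin n) ℝ} (hZ : PosMinors 1 Z) {N : ℕ} {f : Fin N → Perm ℤ}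
    (hf : ∀ s, f s ∈ affinePerms n k l)
    (h : ∀ Z' : Matrix (Fin (l + m)) (Fin n) ℝ, PosMinors 1 Z' → ∀ Y : FullRankMatrix l n,
      ProjNonneg Y.1 → ∃ s, ∃ A : FullRankMatrix l n, A.1 ∈ closure {B | IsCellMatrix (f s)⁻¹ B} ∧
      ProjNonneg A.1 ∧ zMap Z' (rowSpan Y) = zMap Z' (rowSpan A))
    {V : FullRankMatrix k n} (hV : ProjPos V.1) :
    ∃ s, ∃ A : FullRankMatrix k n, A.1 ∈ closure {B | IsCellMatrix (f s) B} ∧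
      zMap Z (rowSpan V) = zMap Z (rowSpan A) := by
  have : NeZero (l + k) := ⟨by have := NeZero.ne (k + l); omega⟩
  obtain ⟨s, hs⟩ := exists_goodScaling hn hm (finSumFinEquiv (m := k) (n := l))
  obtain ⟨s', hs'⟩ := exists_goodScaling (n := n) (k := l) (l := k) (by omega) hm
    (finSumFinEquiv (m := l) (n := k))
  obtain ⟨W, hW⟩ := hZ.exists_isKernelMatrix (l := l) (by omega)
  obtain ⟨ε, hε, hVε⟩ := hV
  have hVn : Nondeg k V.1 := hVε.nondeg (by omega)
  have hwin : ∀ j, ivlRank V.1 j (j + (k + l : ℕ)) = k := fun j => hVn.ivlRank_of_le (by omega) j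
  have hU := nondeg_fromRows hn hm hε hVε.nonneg hwin hZ hW
  have hgood := hs.2 V.1 W Z ⟨ε, hε, hVε.nonneg⟩ hwin hZ hW
  have hYn := (nondeg_twist hn finSumFinEquiv hs.1 hU hZ hW).2 hVn
  obtain ⟨c, hc, htw⟩ := exists_scaleCols_twist (e := finSumFinEquiv) (e' := finSumFinEquiv)
    hs.1 hs'.1 hU
  set X := (twist finSumFinEquiv l s (fromRows V.1 W)).toRows₁
  set Y := (twist finSumFinEquiv l s (fromRows V.1 W)).toRows₂
  have hY : ProjPos Y := hgood.2.projPos hYn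
  have hYl : LinearIndependent ℝ Y.row :=
    linearIndependent_of_ivlRank (hYn.ivlRank_of_le le_rfl 0)
  obtain ⟨⟨ε', -, hX⟩, -⟩ := hgood
  obtain ⟨Z', hZ', hX'⟩ := exists_posMinors_orthogonal (p := l + m) (by omega) hX
  rw [altSign_altSign] at hX'
  obtain ⟨i, A, hA, hAn, hYA⟩ := h Z' hZ' ⟨Y, hYl⟩ hY.projNonneg
  obtain ⟨a, b, ha, hab⟩ := exists_eq_add_of_zMap_eq (by omega) hZ' hX' hAn hYA
  -- The double twist is nonnegative by the choice of `s'` and nondegenerate like `V`. Hence the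
  -- scaling `c` preserves positivity, and its inverse can be applied to every matrix of a cell.
  have hcV : ProjPos (scaleCols c V.1) := by
    have hwin' : ∀ j, ivlRank Y j (j + (l + k : ℕ)) = l := fun j => hYn.ivlRank_of_le (by omega) j
    have h1 := (hs'.2 Y X Z' hY.projNonneg hwin' hZ' hX').2
    rw [htw, toRows₂_fromRows] at h1
    refine h1.projPos (nondeg_iff.2 fun j => ?_)
    rw [ivlRank_scaleCols hc, nondeg_iff.1 hVn]
  -- With `X` fixed, the rescaled second twist is a continuous map from the cell of `f⁻¹` to the
  -- cell of `f`, and therefore also between their closures.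
  let Ψ : Matrix (Fin l) (Fin n) ℝ → Matrix (Fin k) (Fin n) ℝ := fun B =>
    scaleCols c⁻¹ (twist finSumFinEquiv k s' (fromRows B X)).toRows₂
  have hΨ : Continuous Ψ := by
    refine (continuous_scaleCols _).comp (continuous_toRows₂.comp ((continuous_twist _ _ _).comp ?_))
    refine continuous_pi fun a => continuous_pi fun j => ?_
    rcases a with a | a
    · simp only [fromRows_apply_inl]; fun_prop
    · simp only [fromRows_apply_inr]; fun_prop
  have hmaps : Set.MapsTo Ψ {B | IsCellMatrix (f i)⁻¹ B} {B | IsCellMatrix (f i) B} := by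
    intro B hB
    have h1 := IsCellMatrix.twist hs' (by omega) hm (inv_mem_affinePerms (hf i)) hB hZ' hX'
    rw [inv_inv] at h1
    exact h1.scaleCols_inv hc ⟨ε, hε, hVε⟩ hcV
  have hcl := map_mem_closure hΨ hA hmaps
  have hT' := twist_fromBlocks finSumFinEquiv (s := s') b ha (h := (1 : Matrix (Fin k) (Fin k) ℝ))
    (by simp) htw
  rw [Matrix.one_mul] at hT'
  -- Since `A = a Y + b X`, twisting back yields an invertible multiple of `V` plus a multiple of
  -- `W`: the same image under `Z` as `V`.
  have hΨA : Ψ A.1 = ((a.det * (1 : Matrix (Fin k) (Fin k) ℝ).det) •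
      (1 : Matrix (Fin k) (Fin k) ℝ)⁻¹)ᵀ * V.1 + (-((a.det * (1 : Matrix (Fin k) (Fin k) ℝ).det) •
      (a⁻¹ * b * (1 : Matrix (Fin k) (Fin k) ℝ)⁻¹))ᵀ) * W := by
    change scaleCols c⁻¹ (twist finSumFinEquiv k s' (fromRows A.1 X)).toRows₂ = _
    rw [hab]
    change scaleCols c⁻¹ (twist finSumFinEquiv k s' (fromRows (a * Y + b * X) X)).toRows₂ = _
    rw [hT', toRows₂_fromRows, mul_scaleCols, mul_scaleCols,
      ← scaleCols_inv_scaleCols hc (_ * V.1 + _ * W)]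
    congr 1
    ext p j
    simp only [scaleCols, Matrix.sub_apply, Matrix.of_apply, Matrix.add_apply, Matrix.neg_mul,
      Matrix.neg_apply]
    ring
  have hd : (((a.det * (1 : Matrix (Fin k) (Fin k) ℝ).det) •
      (1 : Matrix (Fin k) (Fin k) ℝ)⁻¹)ᵀ).det ≠ 0 := by
    rw [Matrix.det_transpose, Matrix.det_smul]
    simpa using fun h => absurd h ha
  have hVl := ProjNonneg.linearIndependent_mul_transpose (by omega) hZ ⟨ε, hε, hVε.nonneg⟩ V.2
  have hli : LinearIndependent ℝ (Ψ A.1).row := by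
    refine linearIndependent_of_mul_transpose (Z := Z) ?_
    have hWZ : W * Zᵀ = 0 := by
      have := congrArg Matrix.transpose hW.1
      rwa [Matrix.transpose_mul, Matrix.transpose_transpose, Matrix.transpose_zero] at this
    rw [hΨA, Matrix.add_mul, Matrix.mul_assoc _ W, hWZ, Matrix.mul_zero, add_zero, Matrix.mul_assoc]
    exact linearIndependent_row_mul hd hVl
  exact ⟨i, ⟨Ψ A.1, hli⟩, hcl, zMap_rowSpan_eq_of_eq_add hW hd hΨA⟩

/-- The density part of the duality of triangulations. -/
theorem dense_of_inv [NeZero (k + l)] (hn : k + l + m = n) (hm : Even m)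
    {Z : Matrix (Fin (k + m)) (Fin n) ℝ} (hZ : PosMinors 1 Z) {N : ℕ} {f : Fin N → Perm ℤ}
    (hf : ∀ s, f s ∈ affinePerms n k l)
    (h : ∀ Z' : Matrix (Fin (l + m)) (Fin n) ℝ, PosMinors 1 Z' →
      amplituhedron Z' ⊆ closure (⋃ s, zImage Z' (cell l n (f s)⁻¹))) :
    amplituhedron Z ⊆ closure (⋃ s, zImage Z (cell k n (f s))) := by
  set T := ⋃ s, zImage Z (cell k n (f s))
  have hpos : ∀ V : FullRankMatrix k n, ProjPos V.1 → ∀ hV : LinearIndependent ℝ (V.1 * Zᵀ).row,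
      imageSpan Z ⟨V.1, hV⟩ ∈ closure T := by
    intro V hVp hV
    obtain ⟨s, A, hA, hVA⟩ := exists_mem_closure_of_dual hn hm hZ hf (fun Z' hZ' Y hY =>
      exists_mem_closure_of_dense (l := k) (by omega) (by omega) hZ'
        (fun s => inv_mem_affinePerms (hf s)) (h Z' hZ') hY) hVp
    have hAn : ProjNonneg A.1 :=
      closure_minimal (fun B hB => IsCellMatrix.nonneg hB) (isClosed_projNonneg k n) hA
    have hAl := hAn.linearIndependent_mul_transpose (by omega) hZ A.2
    have h1 : imageSpan Z ⟨V.1, hV⟩ = imageSpan Z ⟨A.1, hAl⟩ := by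
      apply Subtype.ext
      rw [← zMap_rowSpan, ← zMap_rowSpan, hVA]
    rw [h1]
    refine imageSpan_mem_closure (C := {B | IsCellMatrix (f s) B}) (fun B hB => ?_) hA
    have hB' : IsCellMatrix (f s) B := hB
    have hBl := hB'.nonneg.linearIndependent_mul_transpose (by omega) hZ hB'.linearIndependent
    refine ⟨hBl, subset_closure (Set.mem_iUnion.2 ⟨s, rowSpan ⟨B, hB'.linearIndependent⟩,
      (rowSpan_mem_cell_iff (hf s) (by omega)).2 hB', zMap_rowSpan ⟨B, _⟩ hBl⟩)⟩
  rintro Y ⟨X, ⟨V, rfl, hV⟩, hXY⟩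
  have hVn : NonnegMinors 1 V.1 := nonnegMinors_iff.2 fun J hJ => by rw [one_mul]; exact hV J hJ
  have hVp : ProjNonneg V.1 := ⟨1, one_ne_zero, hVn⟩
  have hVl := hVp.linearIndependent_mul_transpose (by omega) hZ V.2
  have hY : Y = imageSpan Z ⟨V.1, hVl⟩ := Subtype.ext (by rw [← hXY, zMap_rowSpan])
  rw [hY]
  -- The general case follows from the totally positive one, as perturbation approximates every
  -- totally nonnegative point.
  have hev := eventually_posMinors_mul_gaussMatrix hVn one_ne_zero
    (exists_tupleMinor_of_linearIndependent V.2)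
  have hlim : Tendsto (fun q : ℝ => V.1 * gaussMatrix n q) (𝓝[>] 0) (𝓝 V.1) := by
    have h4 : Continuous fun q : ℝ => V.1 * gaussMatrix n q :=
      continuous_const.matrix_mul (continuous_gaussMatrix n)
    have h5 := (h4.tendsto 0).mono_left (nhdsWithin_le_nhds (s := Set.Ioi 0))
    simpa [gaussMatrix_zero] using h5
  refine imageSpan_mem_closure (C := {B | PosMinors 1 B}) (fun B hB => ?_)
    (mem_closure_of_tendsto hlim hev)
  have hBp : ProjPos B := ⟨1, one_ne_zero, hB⟩
  have hBl : LinearIndependent ℝ B.row :=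
    linearIndependent_row_iff.2 fun φ hφ => PosMinors.eq_zero_of_vecMul (by omega) hB hφ
  have hBl' := hBp.projNonneg.linearIndependent_mul_transpose (by omega) hZ hBl
  exact ⟨hBl', hpos ⟨B, hBl⟩ hBp hBl'⟩

end density

/-! ## Triangulations -/

section triangulation
variable {n : ℕ} [NeZero n] {k l m : ℕ}

theorem isTriangulation_of_inv [NeZero (k + l)] (hn : k + l + m = n) (hm : Even m) {N : ℕ}
    {f : Fin N → Perm ℤ} (hf : ∀ s, f s ∈ affinePerms n k l)
    (h : IsTriangulation n l m fun s => (f s)⁻¹) : IsTriangulation n k m f := by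
  intro Z hZ
  -- The inversion numbers do not involve the matrix, but reading them off the hypothesis requires
  -- some totally positive matrix to exist.
  have hZex : ∃ Z' : Matrix (Fin (l + m)) (Fin n) ℝ, IsTotallyPositive Z' := by
    exact ⟨_, isTotallyPositive_iff.2 (posMinors_trig (l + m) n)⟩
  obtain ⟨Z₀, hZ₀⟩ := hZex
  refine ⟨fun s => ⟨(hf s).1, fun i => ⟨((hf s).2 i).1, ?_⟩⟩, fun s => ?_, fun s t hst => ?_,
    fun s => ?_, ?_⟩
  · have := ((hf s).2 i).2
    omega
  · exact isZAdmissible_of_inv hn hm (hf s) hZ fun Z' hZ' => (h Z' hZ').admissible s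
  · exact isZCompatible_of_inv hn hm (hf s) (hf t) hZ fun Z' hZ' => (h Z' hZ').compatible s t hst
  · rw [← inv_inv_eq (hf s).1, (h Z₀ hZ₀).inv_eq s, show n - l - m = k by omega,
      show n - k - m = l by omega, mul_comm]
  · exact dense_of_inv hn hm (isTotallyPositive_iff.1 hZ) hf fun Z' hZ' =>
      (h Z' (isTotallyPositive_iff.2 hZ')).dense

end triangulation

end Amplituhedron

theorem theorem3p3 (k l m n : ℕ) (hm : Even m) (hn : k + l + m = n) :
    (∀ f ∈ Amplituhedron.affinePerms n k l,
      f⁻¹ ∈ Amplituhedron.affinePerms n l k ∧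
        (Amplituhedron.IsAdmissible n k m f ↔ Amplituhedron.IsAdmissible n l m f⁻¹)) ∧
    (∀ f ∈ Amplituhedron.affinePerms n k l, ∀ g ∈ Amplituhedron.affinePerms n k l,
      (Amplituhedron.IsCompatible n k m f g ↔ Amplituhedron.IsCompatible n l m f⁻¹ g⁻¹)) ∧
    (∀ (N : ℕ) (f : Fin N → Equiv.Perm ℤ), (∀ s, f s ∈ Amplituhedron.affinePerms n k l) →
      (Amplituhedron.IsTriangulation n k m f ↔
        Amplituhedron.IsTriangulation n l m (fun s => (f s)⁻¹))) := by
  open Amplituhedron in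
  -- The twist needs a nonempty window. For `k = l = 0` the bounds force every permutation to be the
  -- identity, and nothing remains to be proved.
  rcases Nat.eq_zero_or_pos (k + l) with h0 | hpos
  · obtain rfl : k = 0 := by omega
    obtain rfl : l = 0 := by omega
    have hone : ∀ f ∈ affinePerms n 0 0, f = 1 := by
      intro f hf
      ext i
      have := hf.2 i
      simp only [Nat.cast_zero, sub_zero, add_zero] at this
      exact le_antisymm this.2 this.1
    refine ⟨fun f hf => ?_, fun f hf g hg => ?_, fun N f hf => ?_⟩
    · have := hone f hf
      subst this
      exact ⟨by simpa using hf, by rw [inv_one]⟩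
    · rw [hone f hf, hone g hg, inv_one]
    · have : (fun s => (f s)⁻¹) = f := by
        funext s
        rw [hone _ (hf s), inv_one]
      rw [this]
  · have : NeZero n := ⟨by omega⟩
    have : NeZero (k + l) := ⟨by omega⟩
    have : NeZero (l + k) := ⟨by omega⟩
    refine ⟨fun f hf => ⟨inv_mem_affinePerms hf, fun h Z hZ => ?_, fun h Z hZ => ?_⟩,
      fun f hf g hg => ⟨fun h Z hZ => ?_, fun h Z hZ => ?_⟩, fun N f hf => ⟨fun h => ?_, fun h => ?_⟩⟩
    -- The forward implications are the backward ones for `f⁻¹` with `k` and `l` exchanged.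
    · exact isZAdmissible_of_inv (k := l) (l := k) (by omega) hm (inv_mem_affinePerms hf) hZ
        (by rwa [inv_inv])
    · exact isZAdmissible_of_inv hn hm hf hZ h
    · exact isZCompatible_of_inv (k := l) (l := k) (by omega) hm (inv_mem_affinePerms hf)
        (inv_mem_affinePerms hg) hZ (by rwa [inv_inv, inv_inv])
    · exact isZCompatible_of_inv hn hm hf hg hZ h
    · exact isTriangulation_of_inv (k := l) (l := k) (by omega) hm
        (fun s => inv_mem_affinePerms (hf s)) (by simpa only [inv_inv] using h)
    · exact isTriangulation_of_inv hn hm hf h
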